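/- Let $dA$ be Lebesgue area measure on the open unit disc $\mathbb D$, normalized so that $\mathbb D$ has measure $1$, let $L^2(\mathbb D)=L^2(\mathbb D,dA)$, and let $A^2(\mathbb D)$ be the Bergman space, i.e. the closed subspace of $L^2(\mathbb D)$ consisting of the analytic functions. Let $P_B$ be the orthogonal projection of $L^2(\mathbb D)$ onto $A^2(\mathbb D)$. For $f\in A^2(\mathbb D)$ let $T_f$ be the densely defined Toeplitz operator $T_fu=P_B(fu)$ on $A^2(\mathbb D)$, with domain $\{u\in A^2(\mathbb D): fu\in L^2(\mathbb D)\}$. Let $T_g^*$ be the Hilbert space adjoint of $T_g$, and let $T_fT_g^*$ have its natural domain $\{u\in\operatorname{dom}T_g^*: T_g^*u\in\operatorname{dom}T_f\}$. This product is called bounded on $A^2(\mathbb D)$ if its domain is dense in $A^2(\mathbb D)$ and there is a constant $C$ with $\|T_fT_g^*u\|_2\le C\|u\|_2$ for all $u$ in its domain (equivalently, it is densely defined and extends to a bounded operator on $A^2(\mathbb D)$). **Theorem.** Let $f,g\in A^2(\mathbb D)$. Then $T_fT_g^*$ is bounded on $A^2(\mathbb D)$ if and only if the operator $P^+_{f,g}$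 defined by $$P^+_{f,g}u(z)=|f(z)|\int_{\mathbb D}\frac{|g(\zeta)|\,u(\zeta)}{|1-\overline{\zeta}z|^2}\,dA(\zeta)$$ is bounded on $L^2(\mathbb D)$, i.e. there is a constant $C$ such that $P^+_{f,g}u\in L^2(\mathbb D)$ and $\|P^+_{f,g}u\|_2\le C\|u\|_2$ for all $u\in L^2(\mathbb D)$. -/

import Mathlib

open MeasureTheory Set Filter Topology Metric
open scoped ENNReal NNReal LinearPMap ComplexConjugate

noncomputable section

namespace BergmanToeplitz

/-- Lebesgue area measure on the open unit disc, normalized so that the disc has measure `1`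
(a measure on `ℂ` that does not charge the complement of the disc). -/
def dA : Measure ℂ :=
  (volume (ball (0 : ℂ) 1))⁻¹ • (volume : Measure ℂ).restrict (ball (0 : ℂ) 1)

/-- `f ∈ A²(𝔻)` for a function `f`: analytic on the open unit disc and square integrable there.
The values of `f` outside of the disc play no role. -/
def MemA2 (f : ℂ → ℂ) : Prop :=
  DifferentiableOn ℂ f (ball (0 : ℂ) 1) ∧ MemLp f 2 dA

instance : IsProbabilityMeasure dA := by
  refine ⟨?_⟩
  have h0 : volume (ball (0 : ℂ) 1) ≠ 0 := (measure_ball_pos volume (0 : ℂ) one_pos).ne'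
  have h1 : volume (ball (0 : ℂ) 1) ≠ ∞ := measure_ball_lt_top.ne
  rw [dA, Measure.smul_apply, Measure.restrict_apply_univ, smul_eq_mul,
    ENNReal.inv_mul_cancel h0 h1]

/-- The Bergman space `A²(𝔻)`, as the subspace of `L²(𝔻, dA)` of those (classes of) functions
that have an analytic representative. -/
def A2 : Submodule ℂ (Lp ℂ 2 dA) where
  carrier := {u | ∃ h : ℂ → ℂ, DifferentiableOn ℂ h (ball (0 : ℂ) 1) ∧ u =ᵐ[dA] h}
  zero_mem' := ⟨0, differentiableOn_const 0, Lp.coeFn_zero _ _ _⟩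
  add_mem' := by
    rintro u v ⟨h, hh, hu⟩ ⟨k, hk, hv⟩
    exact ⟨h + k, hh.add hk, (Lp.coeFn_add u v).trans (hu.add hv)⟩
  smul_mem' := by
    rintro c u ⟨h, hh, hu⟩
    exact ⟨c • h, hh.const_smul c, (Lp.coeFn_smul c u).trans (hu.const_smul c)⟩

/-! `A²(𝔻)` is closed in `L²(𝔻, dA)`. -/

theorem enorm_le_circle {h : ℂ → ℂ} {z : ℂ} {r ρ : ℝ} (hr : ball z r ⊆ ball (0 : ℂ) 1)
    (hh : DifferentiableOn ℂ h (ball (0 : ℂ) 1)) (h0 : 0 < ρ) (h1 : ρ < r) :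
    ‖h z‖ₑ * ENNReal.ofReal (2 * Real.pi) ≤
      ∫⁻ θ in Ioo (-Real.pi) Real.pi, ‖h (z + ρ * (Real.cos θ + Real.sin θ * Complex.I))‖ₑ := by
  have hd : DiffContOnCl ℂ h (ball z |ρ|) := by
    refine (hh.mono ?_).diffContOnCl
    refine Subset.trans closure_ball_subset_closedBall ?_
    rw [abs_of_pos h0]
    exact (closedBall_subset_ball h1).trans hr
  have key := hd.circleAverage
  rw [Real.circleAverage] at key
  have hper : Function.Periodic (fun θ : ℝ => h (circleMap z ρ θ)) (2 * Real.pi) := by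
    intro θ
    simp only [periodic_circleMap z ρ θ]
  have h2 := hper.intervalIntegral_add_eq (-Real.pi) 0
  have e1 : -Real.pi + 2 * Real.pi = Real.pi := by ring
  rw [e1, zero_add] at h2
  rw [← h2] at key
  have hpi : (0 : ℝ) < 2 * Real.pi := by positivity
  have h3 : ∫ θ in (-Real.pi)..Real.pi, h (circleMap z ρ θ) = (2 * Real.pi) • h z := by
    rw [← key, smul_smul, mul_inv_cancel₀ hpi.ne', one_smul]
  have h4 : ‖h z‖ₑ * ENNReal.ofReal (2 * Real.pi) = ‖(2 * Real.pi) • h z‖ₑ := by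
    rw [enorm_smul, mul_comm, Real.enorm_eq_ofReal hpi.le]
  rw [h4, ← h3, intervalIntegral.integral_of_le (by linarith), integral_Ioc_eq_integral_Ioo]
  refine (enorm_integral_le_lintegral_enorm _).trans (le_of_eq ?_)
  refine lintegral_congr fun θ => ?_
  rw [circleMap, Complex.exp_mul_I, Complex.ofReal_cos, Complex.ofReal_sin]

theorem lintegral_polar (F : ℂ → ℝ≥0∞) (hF : Measurable F) (z : ℂ) :
    ∫⁻ w, F w = ∫⁻ ρ in Ioi (0 : ℝ), ∫⁻ θ in Ioo (-Real.pi) Real.pi,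
      ENNReal.ofReal ρ * F (z + ρ * (Real.cos θ + Real.sin θ * Complex.I)) := by
  rw [← lintegral_add_left_eq_self _ z, ← Complex.lintegral_comp_polarCoord_symm,
    polarCoord_target, Measure.volume_eq_prod, ← Measure.prod_restrict, lintegral_prod]
  · simp only [Complex.polarCoord_symm_apply, smul_eq_mul]
  · simp only [Complex.polarCoord_symm_apply, smul_eq_mul]
    refine Measurable.aemeasurable ?_
    refine (ENNReal.measurable_ofReal.comp measurable_fst).mul (hF.comp ?_)
    fun_prop

/-- The sub-mean value property over discs. -/
theorem enorm_mul_le_lintegral {h : ℂ → ℂ} {z : ℂ} {r : ℝ} (hr : ball z r ⊆ ball (0 : ℂ) 1)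
    (hh : DifferentiableOn ℂ h (ball (0 : ℂ) 1)) :
    ‖h z‖ₑ * volume (ball z r) ≤ ∫⁻ w in ball z r, ‖h w‖ₑ := by
  classical
  have hG : Measurable ((ball z r).indicator fun w => ‖h w‖ₑ) := by
    have hc : ContinuousOn (fun w => ‖h w‖ₑ) (ball z r) := (hh.mono hr).continuousOn.enorm
    rw [← piecewise_eq_indicator]
    exact hc.measurable_piecewise continuous_zero.continuousOn measurableSet_ball
  have hK : Measurable ((ball z r).indicator fun _ => ‖h z‖ₑ) :=
    measurable_const.indicator measurableSet_ball
  rw [← lintegral_indicator measurableSet_ball, ← setLIntegral_const,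
    ← lintegral_indicator measurableSet_ball, lintegral_polar _ hG z, lintegral_polar _ hK z]
  refine setLIntegral_mono' measurableSet_Ioi fun ρ hρ => ?_
  have hρ0 : 0 < ρ := hρ
  rw [lintegral_const_mul _ (by fun_prop), lintegral_const_mul _ (by fun_prop)]
  refine mul_le_mul_right ?_ _
  have hmem : ∀ θ : ℝ, z + ρ * (Real.cos θ + Real.sin θ * Complex.I) ∈ ball z r ↔ ρ < r := by
    intro θ
    rw [mem_ball, dist_eq_norm, add_sub_cancel_left, norm_mul, Complex.ofReal_cos,
      Complex.ofReal_sin, ← Complex.exp_mul_I, Complex.norm_exp_ofReal_mul_I, mul_one,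
      Complex.norm_real, Real.norm_of_nonneg hρ0.le]
  by_cases h1 : ρ < r
  · simp only [indicator_of_mem ((hmem _).2 h1)]
    refine le_trans (le_of_eq ?_) (enorm_le_circle hr hh hρ0 h1)
    rw [setLIntegral_const, Real.volume_Ioo]
    congr 2
    ring
  · have h2 : ∀ θ : ℝ, z + ρ * (Real.cos θ + Real.sin θ * Complex.I) ∉ ball z r :=
      fun θ hθ => h1 ((hmem θ).1 hθ)
    simp only [indicator_of_notMem (h2 _)]
    exact le_rfl

/-- Point evaluations are bounded on `A²(𝔻)`, locally uniformly. -/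
theorem enorm_le_eLpNorm {h : ℂ → ℂ} {z : ℂ} {r : ℝ} (hr : ball z r ⊆ ball (0 : ℂ) 1)
    (hh : DifferentiableOn ℂ h (ball (0 : ℂ) 1)) :
    ‖h z‖ₑ * volume (ball z r) ≤ volume (ball (0 : ℂ) 1) * eLpNorm h 2 dA := by
  have hc : ContinuousOn h (ball (0 : ℂ) 1) := hh.continuousOn
  have hm : AEStronglyMeasurable h dA := by
    refine AEStronglyMeasurable.smul_measure ?_ _
    exact hc.aestronglyMeasurable measurableSet_ball
  have h0 : volume (ball (0 : ℂ) 1) ≠ 0 := (measure_ball_pos volume (0 : ℂ) one_pos).ne'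
  have h1 : volume (ball (0 : ℂ) 1) ≠ ∞ := measure_ball_lt_top.ne
  calc ‖h z‖ₑ * volume (ball z r) ≤ ∫⁻ w in ball z r, ‖h w‖ₑ := enorm_mul_le_lintegral hr hh
    _ ≤ ∫⁻ w in ball (0 : ℂ) 1, ‖h w‖ₑ := lintegral_mono_set hr
    _ = volume (ball (0 : ℂ) 1) * ∫⁻ w, ‖h w‖ₑ ∂dA := by
      rw [dA, lintegral_smul_measure, smul_eq_mul, ← mul_assoc, ENNReal.mul_inv_cancel h0 h1,
        one_mul]
    _ = volume (ball (0 : ℂ) 1) * eLpNorm h 1 dA := by rw [eLpNorm_one_eq_lintegral_enorm]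
    _ ≤ volume (ball (0 : ℂ) 1) * eLpNorm h 2 dA := by
      gcongr
      exact eLpNorm_le_eLpNorm_of_exponent_le (by norm_num) hm

theorem isClosed_A2 : IsClosed (A2 : Set (Lp ℂ 2 dA)) := by
  refine isSeqClosed_iff_isClosed.1 fun u v hu huv => ?_
  choose h hh hae using hu
  -- the analytic representatives are uniformly Cauchy near every point
  have hC : ∀ z ∈ ball (0 : ℂ) 1, ∃ r > 0, ball z r ⊆ ball (0 : ℂ) 1 ∧
      UniformCauchySeqOn h atTop (ball z r) := by
    intro z hz
    obtain ⟨R, hR, hRs⟩ := Metric.isOpen_iff.1 isOpen_ball z hz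
    refine ⟨R / 2, by positivity, (ball_subset_ball (by linarith)).trans hRs, ?_⟩
    have hsub : ∀ w ∈ ball z (R / 2), ball w (R / 2) ⊆ ball (0 : ℂ) 1 := by
      intro w hw
      refine Subset.trans (ball_subset_ball' ?_) hRs
      have := mem_ball.1 hw
      linarith
    have hV0 : volume (ball (0 : ℂ) (R / 2)) ≠ 0 :=
      (measure_ball_pos volume (0 : ℂ) (by positivity)).ne'
    have hV1 : volume (ball (0 : ℂ) (R / 2)) ≠ ∞ := measure_ball_lt_top.ne
    have h1 : volume (ball (0 : ℂ) 1) ≠ ∞ := measure_ball_lt_top.ne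
    set a : ℝ := (volume (ball (0 : ℂ) (R / 2))).toReal with ha
    set b : ℝ := (volume (ball (0 : ℂ) 1)).toReal with hb
    have ha0 : 0 < a := ENNReal.toReal_pos hV0 hV1
    have hbound : ∀ m n, ∀ w ∈ ball z (R / 2), ‖h m w - h n w‖ * a ≤ b * ‖u m - u n‖ := by
      intro m n w hw
      have key := enorm_le_eLpNorm (hsub w hw) ((hh m).sub (hh n))
      have e1 : eLpNorm (h m - h n) 2 dA = ENNReal.ofReal ‖u m - u n‖ := by
        rw [Lp.norm_def, ENNReal.ofReal_toReal (Lp.eLpNorm_ne_top _)]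
        exact eLpNorm_congr_ae (((hae m).symm.sub (hae n).symm).trans
          (Lp.coeFn_sub (u m) (u n)).symm)
      rw [e1, show volume (ball w (R / 2)) = volume (ball (0 : ℂ) (R / 2)) by
        simp [Complex.volume_ball]] at key
      have := ENNReal.toReal_mono (ENNReal.mul_ne_top h1 ENNReal.ofReal_ne_top) key
      rwa [ENNReal.toReal_mul, ENNReal.toReal_mul, toReal_enorm,
        ENNReal.toReal_ofReal (norm_nonneg _)] at this
    rw [Metric.uniformCauchySeqOn_iff]
    intro ε hε
    have hb0 : 0 ≤ b := ENNReal.toReal_nonneg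
    obtain ⟨N, hN⟩ := Metric.cauchySeq_iff.1 huv.cauchySeq (ε * a / (b + 1)) (by positivity)
    refine ⟨N, fun m hm n hn w hw => ?_⟩
    have h2 := hN m hm n hn
    rw [dist_eq_norm, lt_div_iff₀ (by positivity)] at h2
    rw [dist_eq_norm]
    have h3 := hbound m n w hw
    have h4 := norm_nonneg (u m - u n)
    nlinarith
  -- their pointwise limit
  have hlim : ∀ z ∈ ball (0 : ℂ) 1, ∃ l, Tendsto (fun n => h n z) atTop (𝓝 l) := by
    intro z hz
    obtain ⟨r, hr, -, hU⟩ := hC z hz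
    exact cauchySeq_tendsto_of_complete (hU.cauchySeq (mem_ball_self hr))
  choose! k hk using hlim
  have hloc : TendstoLocallyUniformlyOn h k atTop (ball (0 : ℂ) 1) := by
    intro s hs z hz
    obtain ⟨r, hr, hsub, hU⟩ := hC z hz
    have := hU.tendstoUniformlyOn_of_tendsto fun w hw => hk w (hsub hw)
    exact ⟨ball z r, mem_nhdsWithin_of_mem_nhds (ball_mem_nhds z hr), this s hs⟩
  refine ⟨k, hloc.differentiableOn (Eventually.of_forall hh) isOpen_ball, ?_⟩
  obtain ⟨φ, hφ, hφae⟩ := (tendstoInMeasure_of_tendsto_Lp huv).exists_seq_tendsto_ae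
  have hall : ∀ᵐ z ∂dA, ∀ n, u n z = h n z := ae_all_iff.2 hae
  have hball : ∀ᵐ z ∂dA, z ∈ ball (0 : ℂ) 1 :=
    Measure.ae_smul_measure (ae_restrict_mem measurableSet_ball) _
  filter_upwards [hφae, hall, hball] with z hz1 hz2 hz3
  refine tendsto_nhds_unique hz1 ?_
  simp only [hz2]
  exact (hk z hz3).comp hφ.tendsto_atTop

instance : CompleteSpace A2 := isClosed_A2.completeSpace_coe

/-- The Bergman projection `P_B`: the orthogonal projection of `L²(𝔻, dA)` onto `A²(𝔻)`. -/
def bergmanProj : Lp ℂ 2 dA →L[ℂ] A2 := A2.orthogonalProjectionOnto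

/-- The natural domain of the Toeplitz operator with symbol `f`: all `u ∈ A²(𝔻)` for which the
product `f u` is square integrable. -/
def toeplitzDomain (f : ℂ → ℂ) : Submodule ℂ A2 where
  carrier := {u | MemLp (fun z => f z * (u : Lp ℂ 2 dA) z) 2 dA}
  zero_mem' := by
    refine (MemLp.zero' (p := 2) (μ := dA) (ε := ℂ)).ae_eq ?_
    filter_upwards [Lp.coeFn_zero ℂ 2 dA] with z hz
    rw [Submodule.coe_zero, hz, Pi.zero_apply, mul_zero]
  add_mem' := by
    intro u v hu hv
    refine (hu.add hv).ae_eq ?_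
    filter_upwards [Lp.coeFn_add (u : Lp ℂ 2 dA) (v : Lp ℂ 2 dA)] with z hz
    rw [Submodule.coe_add, hz, Pi.add_apply, Pi.add_apply, mul_add]
  smul_mem' := by
    intro c u hu
    refine (hu.const_smul c).ae_eq ?_
    filter_upwards [Lp.coeFn_smul c (u : Lp ℂ 2 dA)] with z hz
    rw [Submodule.coe_smul, hz, Pi.smul_apply, Pi.smul_apply, smul_eq_mul, smul_eq_mul,
      mul_left_comm]

theorem memLp_of_toeplitzDomain {f : ℂ → ℂ} (u : toeplitzDomain f) :
    MemLp (fun z => f z * ((u : A2) : Lp ℂ 2 dA) z) 2 dA := u.2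

/-- Multiplication by `f`, from its natural domain in `A²(𝔻)` into `L²(𝔻, dA)`. -/
def mulSymbol (f : ℂ → ℂ) : toeplitzDomain f →ₗ[ℂ] Lp ℂ 2 dA where
  toFun u := MemLp.toLp (fun z => f z * ((u : A2) : Lp ℂ 2 dA) z) (memLp_of_toeplitzDomain u)
  map_add' u v := by
    rw [← MemLp.toLp_add]
    refine MemLp.toLp_congr _ _ ?_
    filter_upwards [Lp.coeFn_add ((u : A2) : Lp ℂ 2 dA) ((v : A2) : Lp ℂ 2 dA)] with z hz
    rw [Submodule.coe_add, Submodule.coe_add, hz, Pi.add_apply, Pi.add_apply, mul_add]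
  map_smul' c u := by
    rw [RingHom.id_apply, ← MemLp.toLp_const_smul]
    refine MemLp.toLp_congr _ _ ?_
    filter_upwards [Lp.coeFn_smul c ((u : A2) : Lp ℂ 2 dA)] with z hz
    rw [Submodule.coe_smul, Submodule.coe_smul, hz, Pi.smul_apply, Pi.smul_apply, smul_eq_mul,
      smul_eq_mul, mul_left_comm]

/-- The (in general unbounded) Toeplitz operator `T_f u = P_B (f u)` on `A²(𝔻)`, with its natural
domain. For `f ∈ L²(𝔻)` the domain contains all bounded analytic functions, hence is dense. -/
def toeplitz (f : ℂ → ℂ) : A2 →ₗ.[ℂ] A2 where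
  domain := toeplitzDomain f
  toFun := bergmanProj.toLinearMap ∘ₗ mulSymbol f

/-- The product `S T` of two unbounded operators, with its natural domain
`{u ∈ dom T : T u ∈ dom S}`. -/
def opProd {E : Type*} [AddCommGroup E] [Module ℂ E] (S T : E →ₗ.[ℂ] E) : E →ₗ.[ℂ] E :=
  S.comp (T.domRestrict ((S.domain.comap T.toFun).map T.domain.subtype)) (by
    intro x
    have hx : (x : E) ∈ (S.domain.comap T.toFun).map T.domain.subtype := x.2.1
    obtain ⟨y, hy, hyx⟩ := Submodule.mem_map.1 hx
    rw [LinearPMap.domRestrict_apply (x := x) (y := y) hyx.symm]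
    exact hy)

theorem mem_opProd_domain {E : Type*} [AddCommGroup E] [Module ℂ E] {S T : E →ₗ.[ℂ] E} {u : E} :
    u ∈ (opProd S T).domain ↔ ∃ h : u ∈ T.domain, T ⟨u, h⟩ ∈ S.domain := by
  constructor
  · rintro ⟨h1, h2⟩
    obtain ⟨y, hy, rfl⟩ := Submodule.mem_map.1 h1
    exact ⟨h2, hy⟩
  · rintro ⟨h, hS⟩
    exact ⟨Submodule.mem_map.2 ⟨⟨u, h⟩, hS, rfl⟩, h⟩

theorem opProd_apply {E : Type*} [AddCommGroup E] [Module ℂ E] {S T : E →ₗ.[ℂ] E}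
    (u : (opProd S T).domain) (h : (u : E) ∈ T.domain) (hS : T ⟨u, h⟩ ∈ S.domain) :
    opProd S T u = S ⟨T ⟨u, h⟩, hS⟩ := rfl

/-- The Toeplitz product `T_f T_g^*`, where `T_g^*` is the Hilbert space adjoint of the densely
defined operator `T_g` on `A²(𝔻)`. -/
def toeplitzProd (f g : ℂ → ℂ) : A2 →ₗ.[ℂ] A2 :=
  opProd (toeplitz f) (toeplitz g)†

/-- A (densely defined) operator on `A²(𝔻)` is bounded: it is densely defined, and it is bounded
on its domain with respect to the norm of `A²(𝔻)`. Equivalently, it extends (uniquely) to a bounded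
operator on all of `A²(𝔻)`. -/
def IsBoundedOnA2 (T : A2 →ₗ.[ℂ] A2) : Prop :=
  Dense (T.domain : Set A2) ∧ ∃ C : ℝ, ∀ u : T.domain, ‖T u‖ ≤ C * ‖u‖

/-- The positive operator
`P⁺_{f,g} u (z) = |f(z)| ∫_𝔻 |g(ζ)| u(ζ) / |1 - conj ζ * z|² dA(ζ)`. -/
def Pplus (f g u : ℂ → ℂ) (z : ℂ) : ℂ :=
  (‖f z‖ : ℂ) * ∫ ζ, (‖g ζ‖ : ℂ) * u ζ / ((‖1 - conj ζ * z‖ ^ 2 : ℝ) : ℂ) ∂dA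

/-- `P⁺_{f,g}` is bounded on `L²(𝔻)`: it maps `L²(𝔻)` into itself, with a norm bound. -/
def PplusBounded (f g : ℂ → ℂ) : Prop :=
  ∃ C : ℝ, ∀ u : Lp ℂ 2 dA, ∃ v : Lp ℂ 2 dA,
    Pplus f g u =ᵐ[dA] v ∧ ‖v‖ ≤ C * ‖u‖

end BergmanToeplitz

end

open MeasureTheory Set Filter Topology Metric
open scoped ENNReal NNReal LinearPMap ComplexConjugate

noncomputable section

namespace BergmanToeplitz

/-! If `P^+` is bounded, so is the product: on its domain `T_f T_g^*` is the integral operator `v ↦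
f P_B(ḡ v)`, and the modulus of its kernel is the kernel of `P^+`. Density of the domain holds
because it contains the projections of all bounded functions with compact support in the disc.

For the converse, `T_f T_g^*` sends the projection of such a function `u` to `f P_B(ḡ u)`, so this
map is bounded in `L²`, and by duality so is `u ↦ g P_B(f̄ u)` (`DiscBound.swap`). The Cayley
transform turns the Bergman kernel into `-1/(z - ζ̄)²` on the upper half plane (`kernel_cay`). For a
density `a ≥ 0` let `F`, `P`, `H` be the integrals of `1/(z - ζ̄)²`, `1/|z - ζ̄|²` and `(Im z + Im
ζ)²/|z - ζ̄|⁴` against `|f| a`. Real parts give `P = Re F + 2H`, and `gF` is bounded in `L²` by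
hypothesis, so only `gH` is in question. Testing on discs gives a two-point condition on `|f(ζ)|
|g(z)|`, which with Schur's test settles the points `ζ` of height comparable with that of `z`
(`mid_bound`). The contribution from far above is the transpose of that from far below, with `f` and
`g` exchanged.

The core is `below_bound`: if `t` bounds the squared norm of the full positive operator, the part of
`gH` from far below has squared norm at most `Kθt + CB`, with `θ` as small as desired. It rests on a
dichotomy (`large_or_small`) about `F` on a box of horizontal size `Im z / θ` and heights from `θ Im
z` to `Im z`.

If `F` is not small compared with `P(z)` at some point of the box, then, since `-log|F|` is
superharmonic, a Harnack chain shows that `log|F|` is not too negative on average near `z`. Hence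
`F` may be divided out of the sub-mean value property of `gF`, and `|g(z)| P(z)` is at most a
multiple of a local average of `|gF|`.

If `F` is small on the box, then up to the mid part the potential `F` of the far-below measure is
almost constant there, because the potential of the far-above measure is. Its primitive `G` is then
almost affine, and `λ = Re G - Im z Re F`, which has a nonnegative kernel and dominates `2 Im z H`,
is almost affine in `Re z` alone. Nonnegativity at the lower corners of the box bounds the slope, so
`λ(z)` is controlled by `λ(w)` at points `w` of height `θ Im z`, where `λ ≤ 3 θ Im z P(w)`. This
gains a factor `θ`. A Poisson-type formula bounds `|g(z)|` by `|g|` on that line. The line averages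
cost `θ⁻¹` in squared norm against a gain of `θ²`, which leaves `θ`.

Choosing `θ` small improves any bound `t` to `t/2 + MB`. Iterating from a crude finite bound,
available after truncation, gives `2MB` (`exists_kerBound`). Cutoffs and Fatou's lemma remove the
truncation. -/

/-! ### Mean value inequalities over discs from circle averages -/

theorem continuous_comp_circleMap {u : ℂ → ℝ} {z : ℂ} {r ρ : ℝ} (hc : ContinuousOn u (ball z r))
    (h0 : 0 < ρ) (h1 : ρ < r) : Continuous fun θ : ℝ => u (circleMap z ρ θ) := by
  refine hc.comp_continuous (continuous_circleMap z ρ) fun θ => ?_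
  rw [mem_ball, dist_eq_norm, circleMap_sub_center, norm_circleMap_zero, abs_of_pos h0]
  exact h1

/-- Area integrals over a disc in terms of circle averages. -/
theorem setLIntegral_ball_eq {u : ℂ → ℝ} {z : ℂ} {r : ℝ} (hc : ContinuousOn u (ball z r))
    (hu : ∀ w ∈ ball z r, 0 ≤ u w) :
    ∫⁻ w in ball z r, ENNReal.ofReal (u w) =
      ∫⁻ ρ in Ioo 0 r, ENNReal.ofReal (2 * Real.pi * ρ * Real.circleAverage u z ρ) := by
  classical
  have hG : Measurable ((ball z r).indicator fun w => ENNReal.ofReal (u w)) := by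
    have hc' : ContinuousOn (fun w => ENNReal.ofReal (u w)) (ball z r) :=
      ENNReal.continuous_ofReal.comp_continuousOn hc
    rw [← piecewise_eq_indicator]
    exact hc'.measurable_piecewise continuous_zero.continuousOn measurableSet_ball
  have hIoo : Ioo (0 : ℝ) r = Ioi 0 ∩ Iio r := rfl
  rw [← lintegral_indicator measurableSet_ball, lintegral_polar _ hG z, hIoo, inter_comm,
    ← setLIntegral_indicator measurableSet_Iio]
  refine setLIntegral_congr_fun measurableSet_Ioi fun ρ hρ => ?_
  have hρ0 : 0 < ρ := hρ
  have hmap : ∀ θ : ℝ, z + ρ * (Real.cos θ + Real.sin θ * Complex.I) = circleMap z ρ θ := by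
    intro θ
    rw [circleMap, Complex.exp_mul_I, Complex.ofReal_cos, Complex.ofReal_sin]
  have hmem : ∀ θ : ℝ, circleMap z ρ θ ∈ ball z r ↔ ρ < r := by
    intro θ
    rw [mem_ball, dist_eq_norm, circleMap_sub_center, norm_circleMap_zero, abs_of_pos hρ0]
  simp only [hmap]
  by_cases h1 : ρ < r
  · have h1' : ρ ∈ Iio r := h1
    simp only [indicator_of_mem ((hmem _).2 h1), indicator_of_mem h1']
    have hcont := continuous_comp_circleMap hc hρ0 h1
    rw [lintegral_const_mul' _ _ ENNReal.ofReal_ne_top,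
      ← ofReal_integral_eq_lintegral_ofReal, ← ENNReal.ofReal_mul hρ0.le]
    · congr 1
      rw [← integral_Ioc_eq_integral_Ioo,
        ← intervalIntegral.integral_of_le (by linarith [Real.pi_pos])]
      have hper : Function.Periodic (fun θ : ℝ => u (circleMap z ρ θ)) (2 * Real.pi) := by
        intro θ
        simp only [periodic_circleMap z ρ θ]
      have h2 := hper.intervalIntegral_add_eq (-Real.pi) 0
      have e1 : -Real.pi + 2 * Real.pi = Real.pi := by ring
      rw [e1, zero_add] at h2
      rw [h2, Real.circleAverage, smul_eq_mul]
      have := Real.pi_pos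
      field_simp
    · exact (hcont.continuousOn.integrableOn_Icc (a := -Real.pi) (b := Real.pi)).mono_set
        Ioo_subset_Icc_self
    · exact Eventually.of_forall fun θ => hu _ ((hmem θ).2 h1)
  · have h1' : ρ ∉ Iio r := h1
    have h2 : ∀ θ : ℝ, circleMap z ρ θ ∉ ball z r := fun θ hθ => h1 ((hmem θ).1 hθ)
    simp only [indicator_of_notMem (h2 _), indicator_of_notMem h1']
    simp

theorem volume_ball_eq_setLIntegral (z : ℂ) (r : ℝ) :
    volume (ball z r) = ∫⁻ ρ in Ioo 0 r, ENNReal.ofReal (2 * Real.pi * ρ) := by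
  have := setLIntegral_ball_eq (u := fun _ => (1 : ℝ)) (z := z) (r := r) continuousOn_const
    (fun _ _ => zero_le_one)
  simpa [Real.circleAverage_const] using this

theorem le_setLIntegral_ball {u : ℂ → ℝ} {z : ℂ} {r : ℝ} (hc : ContinuousOn u (ball z r))
    (hu : ∀ w ∈ ball z r, 0 ≤ u w) (h : ∀ ρ ∈ Ioo 0 r, u z ≤ Real.circleAverage u z ρ) :
    ENNReal.ofReal (u z) * volume (ball z r) ≤ ∫⁻ w in ball z r, ENNReal.ofReal (u w) := by
  rw [setLIntegral_ball_eq hc hu, volume_ball_eq_setLIntegral,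
    ← lintegral_const_mul' _ _ ENNReal.ofReal_ne_top]
  refine setLIntegral_mono' measurableSet_Ioo fun ρ hρ => ?_
  have hz : 0 ≤ u z := hu z (mem_ball_self (hρ.1.trans hρ.2))
  rw [← ENNReal.ofReal_mul hz, mul_comm]
  refine ENNReal.ofReal_le_ofReal (mul_le_mul_of_nonneg_left (h ρ hρ) ?_)
  have := hρ.1
  positivity

theorem setLIntegral_ball_le {u : ℂ → ℝ} {z : ℂ} {r : ℝ} (hc : ContinuousOn u (ball z r))
    (hu : ∀ w ∈ ball z r, 0 ≤ u w) (h : ∀ ρ ∈ Ioo 0 r, Real.circleAverage u z ρ ≤ u z) :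
    ∫⁻ w in ball z r, ENNReal.ofReal (u w) ≤ ENNReal.ofReal (u z) * volume (ball z r) := by
  rw [setLIntegral_ball_eq hc hu, volume_ball_eq_setLIntegral,
    ← lintegral_const_mul' _ _ ENNReal.ofReal_ne_top]
  refine setLIntegral_mono' measurableSet_Ioo fun ρ hρ => ?_
  have hz : 0 ≤ u z := hu z (mem_ball_self (hρ.1.trans hρ.2))
  rw [← ENNReal.ofReal_mul hz, mul_comm (u z)]
  refine ENNReal.ofReal_le_ofReal (mul_le_mul_of_nonneg_left (h ρ hρ) ?_)
  have := hρ.1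
  positivity

/-- The sub-mean value property of `‖h‖²` over discs. -/
theorem enorm_sq_mul_volume_le {h : ℂ → ℂ} {z : ℂ} {r : ℝ} (hh : DifferentiableOn ℂ h (ball z r)) :
    ‖h z‖ₑ ^ 2 * volume (ball z r) ≤ ∫⁻ w in ball z r, ‖h w‖ₑ ^ 2 := by
  have key := le_setLIntegral_ball (u := fun w => ‖h w‖ ^ 2) (z := z) (r := r)
    (hh.continuousOn.norm.pow 2) (fun _ _ => by positivity) ?_
  · simpa only [ENNReal.ofReal_pow (norm_nonneg _), ofReal_norm] using key
  · intro ρ hρ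
    -- Since `h²` is analytic, the mean value property and the triangle inequality give
    -- subharmonicity of `‖h‖²`.
    have hd : DiffContOnCl ℂ (fun w => h w ^ 2) (ball z |ρ|) := by
      refine ((hh.pow 2).mono ?_).diffContOnCl
      refine Subset.trans closure_ball_subset_closedBall ?_
      rw [abs_of_pos hρ.1]
      exact closedBall_subset_ball hρ.2
    have h1 := hd.circleAverage
    have h2 : ‖Real.circleAverage (fun w => h w ^ 2) z ρ‖ ≤
        Real.circleAverage (fun w => ‖h w‖ ^ 2) z ρ := by
      rw [Real.circleAverage, Real.circleAverage, norm_smul, smul_eq_mul,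
        Real.norm_of_nonneg (by positivity)]
      refine mul_le_mul_of_nonneg_left ?_ (by positivity)
      refine (intervalIntegral.norm_integral_le_integral_norm (by positivity)).trans_eq ?_
      simp only [norm_pow]
    simpa [h1] using h2

/-! ### Subharmonicity of the truncated logarithm, and division by `F` -/

/-- `log max (‖F‖, δ)` is subharmonic. -/
theorem log_max_norm_le_circleAverage {F : ℂ → ℂ} {p : ℂ} {ρ δ : ℝ} (hρ : 0 < ρ) (hδ : 0 < δ)
    (hF : AnalyticOnNhd ℂ F (closedBall p ρ)) :
    Real.log (max ‖F p‖ δ) ≤ Real.circleAverage (fun w => Real.log (max ‖F w‖ δ)) p ρ := by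
  have hcs : ContinuousOn (fun w => Real.log (max ‖F w‖ δ)) (sphere p |ρ|) := by
    rw [abs_of_pos hρ]
    refine ContinuousOn.log ?_ fun w _ => (lt_of_lt_of_le hδ (le_max_right _ _)).ne'
    exact ((hF.continuousOn.mono sphere_subset_closedBall).norm).sup continuousOn_const
  have hint : CircleIntegrable (fun w => Real.log (max ‖F w‖ δ)) p ρ := hcs.circleIntegrable'
  rcases le_or_gt ‖F p‖ δ with h | h
  · rw [max_eq_right h, ← Real.circleAverage_const (Real.log δ) p ρ]
    refine Real.circleAverage_mono (circleIntegrable_const _ _ _) hint fun w _ => ?_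
    exact Real.log_le_log hδ (le_max_right _ _)
  · rw [max_eq_left h.le]
    have hF' : AnalyticOnNhd ℂ F (closedBall p |ρ|) := by rwa [abs_of_pos hρ]
    have hp : F p ≠ 0 := norm_pos_iff.1 (hδ.trans h)
    -- Jensen's formula: the average of `log ‖F‖` exceeds its value at the centre by a sum over the
    -- zeros `u`, with multiplicity, of `log (ρ / ‖p - u‖) ≥ 0`.
    have key := AnalyticOnNhd.circleAverage_log_norm hρ.ne' hF' hp
    have hint' : CircleIntegrable (fun w => Real.log ‖F w‖) p ρ :=
      (hF'.mono sphere_subset_closedBall).meromorphicOn.circleIntegrable_log_norm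
    have h1 : Real.log ‖F p‖ ≤ Real.circleAverage (fun w => Real.log ‖F w‖) p ρ := by
      rw [key]
      refine le_add_of_nonneg_left (finsum_nonneg fun u => ?_)
      by_cases hu : u ∈ closedBall p |ρ|
      · refine mul_nonneg (mod_cast MeromorphicOn.AnalyticOnNhd.divisor_nonneg hF' u) ?_
        rw [abs_of_pos hρ, mem_closedBall, dist_comm, dist_eq_norm] at hu
        rcases eq_or_lt_of_le (norm_nonneg (p - u)) with h0 | h0
        · rw [← h0]; simp
        · refine Real.log_nonneg ?_
          rw [← div_eq_mul_inv, le_div_iff₀ h0, one_mul]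
          exact hu
      · simp [Function.locallyFinsuppWithin.apply_eq_zero_of_notMem _ hu]
    refine h1.trans ?_
    -- the two sides differ only where `F = 0`
    rw [← sub_nonneg]
    have hmono : ∀ w, F w ≠ 0 → Real.log ‖F w‖ ≤ Real.log (max ‖F w‖ δ) := fun w hw =>
      Real.log_le_log (norm_pos_iff.2 hw) (le_max_left _ _)
    have hne : ∀ᶠ w in codiscreteWithin (sphere p |ρ|), F w ≠ 0 := by
      rcases hF'.eqOn_zero_or_eventually_ne_zero_of_preconnected
        (convex_closedBall p |ρ|).isPreconnected with h2 | h2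
      · exact absurd (h2 (mem_closedBall_self (abs_nonneg ρ))) hp
      · exact Filter.codiscreteWithin_mono sphere_subset_closedBall h2
    -- Because `Real.log 0 = 0`, the pointwise inequality can fail at zeros of `F` on the circle.
    -- The minimum repairs it there and leaves the average unchanged.
    have e1 : Real.circleAverage (fun w => Real.log ‖F w‖) p ρ =
        Real.circleAverage (fun w => min (Real.log ‖F w‖) (Real.log (max ‖F w‖ δ))) p ρ := by
      refine Real.circleAverage_congr_codiscreteWithin ?_ hρ.ne'
      filter_upwards [hne] with w hw using (min_eq_left (hmono w hw)).symm
    have hint'' : CircleIntegrable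
        (fun w => min (Real.log ‖F w‖) (Real.log (max ‖F w‖ δ))) p ρ :=
      ⟨hint'.1.inf hint.1, hint'.2.inf hint.2⟩
    rw [e1, sub_nonneg]
    exact Real.circleAverage_mono hint'' hint fun w _ => min_le_right _ _

theorem neg_log_max_nonneg {F : ℂ → ℂ} {w : ℂ} {δ : ℝ} (hδ : 0 < δ) (hδ1 : δ ≤ 1)
    (h : ‖F w‖ ≤ 1) : 0 ≤ -Real.log (max ‖F w‖ δ) :=
  neg_nonneg.2 (Real.log_nonpos (hδ.le.trans (le_max_right _ _)) (max_le h hδ1))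

theorem continuousOn_log_max {F : ℂ → ℂ} {s : Set ℂ} {δ : ℝ} (hδ : 0 < δ)
    (hF : ContinuousOn F s) : ContinuousOn (fun w => Real.log (max ‖F w‖ δ)) s :=
  (hF.norm.sup continuousOn_const).log fun _ _ => (lt_of_lt_of_le hδ (le_max_right _ _)).ne'

theorem setLIntegral_neg_log_max_le {F : ℂ → ℂ} {p : ℂ} {R δ : ℝ} (hδ : 0 < δ) (hδ1 : δ ≤ 1)
    (hF : AnalyticOnNhd ℂ F (ball p R)) (hF1 : ∀ w ∈ ball p R, ‖F w‖ ≤ 1) :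
    ∫⁻ w in ball p R, ENNReal.ofReal (-Real.log (max ‖F w‖ δ)) ≤
      ENNReal.ofReal (-Real.log (max ‖F p‖ δ)) * volume (ball p R) := by
  refine setLIntegral_ball_le (u := fun w => -Real.log (max ‖F w‖ δ))
    (continuousOn_log_max hδ hF.continuousOn).neg
    (fun w hw => neg_log_max_nonneg hδ hδ1 (hF1 w hw)) fun ρ hρ => ?_
  have h := log_max_norm_le_circleAverage hρ.1 hδ (hF.mono (closedBall_subset_ball hρ.2))
  have e : Real.circleAverage (fun w => -Real.log (max ‖F w‖ δ)) p ρ =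
      -Real.circleAverage (fun w => Real.log (max ‖F w‖ δ)) p ρ := by
    simp [Real.circleAverage]
  rw [e]
  exact neg_le_neg h

theorem volume_ball_three_mul (p z : ℂ) (r : ℝ) :
    volume (ball p (3 * r)) = 9 * volume (ball z r) := by
  rw [Complex.volume_ball, Complex.volume_ball, ← mul_assoc, ENNReal.ofReal_mul (by norm_num),
    mul_pow]
  norm_num

/-- The integrand is superharmonic and nonnegative, so its mean over the disc of radius `3r` is at
most its value at the centre. Shrinking to a disc of radius `r` costs the ratio of areas, `9`, and
some point of the small disc does not exceed the average. -/
theorem exists_neg_log_max_le {F : ℂ → ℂ} {p z : ℂ} {r δ L : ℝ} (hr : 0 < r) (hδ : 0 < δ)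
    (hδ1 : δ ≤ 1) (hF : AnalyticOnNhd ℂ F (ball p (3 * r)))
    (hF1 : ∀ w ∈ ball p (3 * r), ‖F w‖ ≤ 1) (hz : ball z r ⊆ ball p (3 * r))
    (hL : -Real.log (max ‖F p‖ δ) ≤ L) :
    ∫⁻ w in ball z r, ENNReal.ofReal (-Real.log (max ‖F w‖ δ)) ≤
        ENNReal.ofReal (9 * L) * volume (ball z r) ∧
      ∃ q ∈ ball z r, -Real.log (max ‖F q‖ δ) ≤ 9 * L := by
  have hL0 : 0 ≤ L := (neg_log_max_nonneg hδ hδ1 (hF1 p (mem_ball_self (by positivity)))).trans hL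
  have h1 : ∫⁻ w in ball z r, ENNReal.ofReal (-Real.log (max ‖F w‖ δ)) ≤
      ENNReal.ofReal (9 * L) * volume (ball z r) := by
    calc _ ≤ ∫⁻ w in ball p (3 * r), ENNReal.ofReal (-Real.log (max ‖F w‖ δ)) :=
          lintegral_mono_set hz
      _ ≤ ENNReal.ofReal (-Real.log (max ‖F p‖ δ)) * volume (ball p (3 * r)) :=
          setLIntegral_neg_log_max_le hδ hδ1 hF hF1
      _ ≤ ENNReal.ofReal L * volume (ball p (3 * r)) := by gcongr
      _ = ENNReal.ofReal (9 * L) * volume (ball z r) := by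
          rw [volume_ball_three_mul p z r, ENNReal.ofReal_mul (by norm_num)]
          norm_num
          ring
  refine ⟨h1, ?_⟩
  have hv0 : volume (ball z r) ≠ 0 := (measure_ball_pos volume z hr).ne'
  have hv1 : volume (ball z r) ≠ ∞ := measure_ball_lt_top.ne
  have hm : AEMeasurable (fun w => ENNReal.ofReal (-Real.log (max ‖F w‖ δ)))
      (volume.restrict (ball z r)) :=
    (ENNReal.continuous_ofReal.comp_continuousOn
      (continuousOn_log_max hδ (hF.continuousOn.mono hz)).neg).aemeasurable measurableSet_ball
  obtain ⟨q, hq, hle⟩ := exists_le_setLAverage hv0 hv1 hm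
  refine ⟨q, hq, ?_⟩
  rw [setLAverage_eq] at hle
  have h2 : ENNReal.ofReal (-Real.log (max ‖F q‖ δ)) ≤ ENNReal.ofReal (9 * L) :=
    hle.trans (ENNReal.div_le_of_le_mul h1)
  exact (ENNReal.ofReal_le_ofReal_iff (by positivity)).1 h2

/-- A Harnack chain for the superharmonic function `-log max (‖F‖, δ)`. -/
theorem exists_neg_log_max_le_chain {F : ℂ → ℂ} {U : Set ℂ} {r δ L : ℝ} (hr : 0 < r) (hδ : 0 < δ)
    (hδ1 : δ ≤ 1) (hF : AnalyticOnNhd ℂ F U) (hF1 : ∀ w ∈ U, ‖F w‖ ≤ 1) {z : ℕ → ℂ} {n : ℕ}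
    (hz : ∀ k ≤ n, ball (z k) (4 * r) ⊆ U) (hd : ∀ k < n, dist (z (k + 1)) (z k) ≤ r)
    (hL : -Real.log (max ‖F (z 0)‖ δ) ≤ L) :
    ∀ k ≤ n, ∃ q ∈ ball (z k) r, -Real.log (max ‖F q‖ δ) ≤ 9 ^ k * L := by
  intro k
  induction k with
  | zero => exact fun _ => ⟨z 0, mem_ball_self hr, by simpa using hL⟩
  | succ k ih =>
    intro hk
    obtain ⟨p, hp, hpL⟩ := ih (by omega)
    have hp' := mem_ball.1 hp
    -- As `p` is within `r` of `z k`, this disc lies in `ball (z k) (4 * r)`. It contains the next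
    -- disc of the chain, whose centre is within `2r` of `p`.
    have h1 : ball p (3 * r) ⊆ U :=
      (ball_subset_ball' (by linarith)).trans (hz k (by omega))
    have hdk := hd k (by omega)
    obtain ⟨-, q, hq, hqL⟩ := exists_neg_log_max_le (z := z (k + 1)) hr hδ hδ1 (hF.mono h1)
      (fun w hw => hF1 w (h1 hw))
      (ball_subset_ball' (by have := dist_triangle_right (z (k+1)) p (z k); linarith)) hpL
    exact ⟨q, hq, hqL.trans_eq (by ring)⟩

/-- Write `log ‖g‖ = log ‖g F‖ - log ‖F‖`. The left side has the sub-mean value property, the last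
term has average at most `L`, and the average of `log ‖g F‖` is at most the logarithm of the average
by concavity. All logarithms are truncated at `δ`, and `δ → 0` at the end. -/
theorem norm_mul_volume_le_of_neg_log {F g : ℂ → ℂ} {z : ℂ} {r L : ℝ} (hr : 0 < r)
    (hF : AnalyticOnNhd ℂ F (closedBall z r)) (hg : AnalyticOnNhd ℂ g (closedBall z r))
    (hF1 : ∀ w ∈ closedBall z r, ‖F w‖ ≤ 1) {δ₀ : ℝ} (hδ₀ : 0 < δ₀) (hL0 : 0 ≤ L)
    (hL : ∀ δ, 0 < δ → δ ≤ δ₀ → ∫⁻ w in ball z r, ENNReal.ofReal (-Real.log (max ‖F w‖ δ)) ≤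
      ENNReal.ofReal L * volume (ball z r)) :
    ‖g z‖ * volume.real (ball z r) ≤ Real.exp L * ∫ w in ball z r, ‖g w * F w‖ := by
  have hv0 : volume (ball z r) ≠ 0 := (measure_ball_pos volume z hr).ne'
  have hv1 : volume (ball z r) ≠ ∞ := measure_ball_lt_top.ne
  set V := volume.real (ball z r) with hV
  have hVpos : 0 < V := ENNReal.toReal_pos hv0 hv1
  obtain ⟨G, hG⟩ := (isCompact_closedBall z r).exists_bound_of_continuousOn hg.continuousOn
  have hG0 : 0 ≤ G := (norm_nonneg _).trans (hG z (mem_closedBall_self hr.le))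
  have hion : ∀ u : ℂ → ℝ, ContinuousOn u (closedBall z r) → IntegrableOn u (ball z r) :=
    fun u hu => (hu.integrableOn_compact (isCompact_closedBall z r)).mono_set ball_subset_closedBall
  set J := ∫ w in ball z r, ‖g w * F w‖ with hJ
  have hJ0 : 0 ≤ J := integral_nonneg fun _ => norm_nonneg _
  have hgF : ContinuousOn (fun w => ‖g w * F w‖) (closedBall z r) :=
    (hg.continuousOn.mul hF.continuousOn).norm
  have main : ∀ δ, 0 < δ → δ ≤ min δ₀ 1 → ‖g z‖ ≤ (J / V + (G * δ + δ)) * Real.exp L := by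
    intro δ hδ hδ'
    have hδ1 : δ ≤ 1 := hδ'.trans (min_le_right _ _)
    -- The error of truncating both factors: `max ‖g‖ δ * max ‖F‖ δ ≤ ‖g F‖ + κ`, because `‖g‖ ≤ G`,
    -- `‖F‖ ≤ 1` and `δ ≤ 1`.
    set κ := G * δ + δ with hκ
    have hκ0 : 0 < κ := by positivity
    set c := J / V + κ with hc
    have hc0 : 0 < c := by positivity
    have cg := continuousOn_log_max hδ hg.continuousOn
    have cF := continuousOn_log_max hδ hF.continuousOn
    -- sub-mean value property for `log max (‖g‖, δ)`
    have h1 : (Real.log (max ‖g z‖ δ) - Real.log δ) * V ≤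
        ∫ w in ball z r, (Real.log (max ‖g w‖ δ) - Real.log δ) := by
      have hpos : ∀ w, 0 ≤ Real.log (max ‖g w‖ δ) - Real.log δ := fun w =>
        sub_nonneg.2 (Real.log_le_log hδ (le_max_right _ _))
      have key := le_setLIntegral_ball (u := fun w => Real.log (max ‖g w‖ δ) - Real.log δ)
        (z := z) (r := r) ((cg.sub continuousOn_const).mono ball_subset_closedBall)
        (fun w _ => hpos w) ?_
      · have hi : Integrable (fun w => Real.log (max ‖g w‖ δ) - Real.log δ)
            (volume.restrict (ball z r)) := hion _ (cg.sub continuousOn_const)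
        rw [← ofReal_integral_eq_lintegral_ofReal hi
          (Eventually.of_forall fun w => hpos w), ← ENNReal.ofReal_toReal hv1,
          ← ENNReal.ofReal_mul (hpos z)] at key
        exact (ENNReal.ofReal_le_ofReal_iff (integral_nonneg fun w => hpos w)).1 key
      · intro ρ hρ
        have hsub : closedBall z ρ ⊆ closedBall z r := closedBall_subset_closedBall hρ.2.le
        have h := log_max_norm_le_circleAverage hρ.1 hδ (hg.mono hsub)
        have hs : sphere z |ρ| ⊆ closedBall z r := by
          rw [abs_of_pos hρ.1]
          exact sphere_subset_closedBall.trans hsub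
        have e : Real.circleAverage (fun w => Real.log (max ‖g w‖ δ) - Real.log δ) z ρ =
            Real.circleAverage (fun w => Real.log (max ‖g w‖ δ)) z ρ - Real.log δ := by
          rw [Real.circleAverage_fun_sub (cg.mono hs).circleIntegrable'
            (circleIntegrable_const _ _ _), Real.circleAverage_const]
        rw [e]
        exact sub_le_sub_right h _
    have h2 : ∀ w ∈ ball z r, Real.log (max ‖g w‖ δ) - Real.log δ ≤
        (‖g w * F w‖ + κ) / c + (Real.log c - 1 - Real.log δ) + -Real.log (max ‖F w‖ δ) := by
      intro w hw
      have hw' := ball_subset_closedBall hw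
      have a1 : 0 < max ‖g w‖ δ := lt_of_lt_of_le hδ (le_max_right _ _)
      have a2 : 0 < max ‖F w‖ δ := lt_of_lt_of_le hδ (le_max_right _ _)
      have a3 : max ‖g w‖ δ * max ‖F w‖ δ ≤ ‖g w * F w‖ + κ := by
        have b1 := hG w hw'
        have b2 := hF1 w hw'
        have b3 := norm_nonneg (g w)
        have b4 := norm_nonneg (F w)
        rw [norm_mul]
        have b5 : 0 ≤ ‖g w‖ * ‖F w‖ := by positivity
        rcases max_cases ‖g w‖ δ with ⟨h, -⟩ | ⟨h, -⟩ <;>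
          rcases max_cases ‖F w‖ δ with ⟨h', -⟩ | ⟨h', -⟩ <;> rw [h, h'] <;> nlinarith
      -- Jensen's inequality for the logarithm in the form of its tangent line at `c`.
      have a4 : Real.log ((‖g w * F w‖ + κ) / c) ≤ (‖g w * F w‖ + κ) / c - 1 :=
        Real.log_le_sub_one_of_pos (by positivity)
      rw [Real.log_div (by positivity) hc0.ne'] at a4
      have a5 := Real.log_le_log (mul_pos a1 a2) a3
      rw [Real.log_mul a1.ne' a2.ne'] at a5
      linarith
    have h3 : ∫ w in ball z r, -Real.log (max ‖F w‖ δ) ≤ L * V := by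
      have key := hL δ hδ (hδ'.trans (min_le_left _ _))
      have hpos : ∀ᵐ w ∂volume.restrict (ball z r), 0 ≤ -Real.log (max ‖F w‖ δ) :=
        (ae_restrict_mem measurableSet_ball).mono fun w hw =>
          neg_log_max_nonneg hδ hδ1 (hF1 w (ball_subset_closedBall hw))
      rw [← ofReal_integral_eq_lintegral_ofReal
          (hion (fun w => -Real.log (max ‖F w‖ δ)) cF.neg) hpos, ← ENNReal.ofReal_toReal hv1,
        ← ENNReal.ofReal_mul hL0] at key
      exact (ENNReal.ofReal_le_ofReal_iff (mul_nonneg hL0 hVpos.le)).1 key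
    have h4 := setIntegral_mono_on (hion _ (cg.sub continuousOn_const))
      (((hion (fun w => (‖g w * F w‖ + κ) / c) ((hgF.add continuousOn_const).div_const c)).add
        (hion (fun _ => Real.log c - 1 - Real.log δ) continuousOn_const)).add (hion _ cF.neg))
      measurableSet_ball h2
    have e1 : ∫ w in ball z r, ((‖g w * F w‖ + κ) / c + (Real.log c - 1 - Real.log δ) +
        -Real.log (max ‖F w‖ δ)) = (J + κ * V) / c + (Real.log c - 1 - Real.log δ) * V +
          ∫ w in ball z r, -Real.log (max ‖F w‖ δ) := by
      rw [integral_add, integral_add, integral_div, integral_add]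
      · simp only [integral_const, measureReal_restrict_apply_univ, smul_eq_mul]
        rw [← hV, ← hJ]
        ring
      · exact hion _ hgF
      · exact hion _ continuousOn_const
      · exact hion _ ((hgF.add continuousOn_const).div_const c)
      · exact hion _ continuousOn_const
      · exact (hion _ ((hgF.add continuousOn_const).div_const c)).add (hion _ continuousOn_const)
      · exact hion _ cF.neg
    -- The tangent point `c` is the average of `‖g F‖ + κ`, so the linear term cancels the `-1`
    -- exactly.
    have e2 : (J + κ * V) / c = V := by
      rw [hc]
      field_simp
    have h5 : Real.log (max ‖g z‖ δ) * V ≤ (Real.log c + L) * V := by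
      have := h1.trans (h4.trans_eq e1)
      rw [e2] at this
      linarith
    have h6 : Real.log (max ‖g z‖ δ) ≤ Real.log c + L := le_of_mul_le_mul_right h5 hVpos
    have a1 : 0 < max ‖g z‖ δ := lt_of_lt_of_le hδ (le_max_right _ _)
    calc ‖g z‖ ≤ max ‖g z‖ δ := le_max_left _ _
      _ = Real.exp (Real.log (max ‖g z‖ δ)) := (Real.exp_log a1).symm
      _ ≤ Real.exp (Real.log c + L) := Real.exp_le_exp.2 h6
      _ = c * Real.exp L := by rw [Real.exp_add, Real.exp_log hc0]
  have hlim : Tendsto (fun δ : ℝ => (J / V + (G * δ + δ)) * Real.exp L) (𝓝[>] 0)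
      (𝓝 ((J / V + (G * 0 + 0)) * Real.exp L)) := by
    refine Tendsto.mono_left ?_ nhdsWithin_le_nhds
    exact Continuous.tendsto (by fun_prop) 0
  have h7 : ‖g z‖ ≤ (J / V + (G * 0 + 0)) * Real.exp L := by
    refine ge_of_tendsto hlim ?_
    filter_upwards [Ioc_mem_nhdsGT (lt_min hδ₀ one_pos)] with δ hδ using main δ hδ.1 hδ.2
  rw [mul_zero, add_zero, add_zero] at h7
  calc ‖g z‖ * V ≤ J / V * Real.exp L * V := by gcongr
    _ = Real.exp L * J := by field_simp

/-- If `F` is bounded by `1` and not too small at one point of a chain of discs, then `F` may be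
divided out of the sub-mean value property of `g F` at the other end of the chain. -/
theorem norm_mul_volume_le_of_chain {F g : ℂ → ℂ} {U : Set ℂ} {r L : ℝ} (hr : 0 < r)
    (hF : AnalyticOnNhd ℂ F U) (hg : AnalyticOnNhd ℂ g U) (hF1 : ∀ w ∈ U, ‖F w‖ ≤ 1)
    {z : ℕ → ℂ} {n : ℕ} (hz : ∀ k ≤ n, ball (z k) (4 * r) ⊆ U)
    (hd : ∀ k < n, dist (z (k + 1)) (z k) ≤ r) (hL0 : 0 ≤ L) (hL : Real.exp (-L) ≤ ‖F (z 0)‖) :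
    ‖g (z n)‖ * volume.real (ball (z n) r) ≤
      Real.exp (9 ^ (n + 1) * L) * ∫ w in ball (z n) r, ‖g w * F w‖ := by
  have hsub : closedBall (z n) r ⊆ U :=
    (closedBall_subset_ball (by linarith)).trans (hz n le_rfl)
  refine norm_mul_volume_le_of_neg_log hr (hF.mono hsub) (hg.mono hsub)
    (fun w hw => hF1 w (hsub hw)) one_pos (by positivity) fun δ hδ hδ1 => ?_
  have hL' : -Real.log (max ‖F (z 0)‖ δ) ≤ L := by
    rw [neg_le, Real.le_log_iff_exp_le (lt_of_lt_of_le hδ (le_max_right _ _))]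
    exact hL.trans (le_max_left _ _)
  -- The `n` links cost `9 ^ n`. The passage from the point `p` to the average over the last disc
  -- costs one more factor `9`.
  obtain ⟨p, hp, hpL⟩ := exists_neg_log_max_le_chain hr hδ hδ1 hF hF1 hz hd hL' n le_rfl
  have hp' := mem_ball.1 hp
  have h1 : ball p (3 * r) ⊆ U :=
    (ball_subset_ball' (by linarith)).trans (hz n le_rfl)
  have h2 := (exists_neg_log_max_le (z := z n) hr hδ hδ1 (hF.mono h1)
    (fun w hw => hF1 w (h1 hw))
    (ball_subset_ball' (by rw [dist_comm] at hp'; linarith)) hpL).1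
  rwa [← mul_assoc, ← pow_succ'] at h2

/-! ### A Poisson formula with rapid decay in the upper half plane -/

theorem inv_sq_add_sq_eq {δ : ℝ} (hδ : 0 < δ) (x : ℝ) :
    (x ^ 2 + δ ^ 2)⁻¹ = δ⁻¹ ^ 2 * (1 + (x / δ) ^ 2)⁻¹ := by
  field_simp
  ring

theorem integrable_inv_sq_add_sq {δ : ℝ} (hδ : 0 < δ) :
    Integrable fun x : ℝ => (x ^ 2 + δ ^ 2)⁻¹ := by
  simp only [inv_sq_add_sq_eq hδ]
  exact (integrable_inv_one_add_sq.comp_div hδ.ne').const_mul _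

theorem integral_inv_sq_add_sq {δ : ℝ} (hδ : 0 < δ) :
    ∫ x : ℝ, (x ^ 2 + δ ^ 2)⁻¹ = Real.pi / δ := by
  simp only [inv_sq_add_sq_eq hδ]
  rw [integral_const_mul, Measure.integral_comp_div (fun x : ℝ => (1 + x ^ 2)⁻¹) δ,
    integral_univ_inv_one_add_sq, abs_of_pos hδ, smul_eq_mul]
  field_simp

theorem norm_sq_ofReal_add_mul_I (x δ : ℝ) : ‖(x + δ * Complex.I : ℂ)‖ ^ 2 = x ^ 2 + δ ^ 2 := by
  rw [← Complex.normSq_eq_norm_sq, Complex.normSq_add_mul_I]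

/-- Decay of `(h(z) - h(iδ)) / (z² + δ²)`, which makes the three far sides of a rectangle of size
`T` contribute `O(1/T)`. The numerator is at most `2K`, and `|z² + δ²| ≥ T² - δ² ≥ T²/2`. -/
theorem poisson_aux_norm_le {h : ℂ → ℂ} {δ K T : ℝ} (hδ : 0 < δ)
    (hK : ∀ z : ℂ, 0 ≤ z.im → ‖h z‖ ≤ K) (hT : 2 * δ ≤ T) {z : ℂ} (hz : 0 ≤ z.im)
    (hzT : T ≤ ‖z‖) :
    ‖dslope h (δ * Complex.I) z / (z + δ * Complex.I)‖ ≤ 4 * K / T ^ 2 := by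
  have hnI : ‖(δ * Complex.I : ℂ)‖ = δ := by simp [abs_of_pos hδ]
  have hT0 : 0 < T := by linarith
  have hne : z ≠ δ * Complex.I := by
    rintro rfl
    rw [hnI] at hzT
    linarith
  have hK0 : 0 ≤ K := (norm_nonneg _).trans (hK z hz)
  rw [dslope_of_ne _ hne, slope_def_field, div_div, norm_div,
    show (z - δ * Complex.I) * (z + δ * Complex.I) = z ^ 2 + δ ^ 2 by ring_nf; simp]
  have h1 : ‖h z - h (δ * Complex.I)‖ ≤ 2 * K := by
    refine (norm_sub_le _ _).trans ?_
    have := hK z hz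
    have := hK (δ * Complex.I) (by simpa using hδ.le)
    linarith
  have h2 : T ^ 2 / 2 ≤ ‖z ^ 2 + (δ : ℂ) ^ 2‖ := by
    have h3 : ‖z ^ 2‖ ≤ ‖z ^ 2 + (δ : ℂ) ^ 2‖ + ‖(δ : ℂ) ^ 2‖ := by
      have := norm_sub_le (z ^ 2 + (δ : ℂ) ^ 2) ((δ : ℂ) ^ 2)
      simpa using this
    rw [norm_pow, norm_pow, Complex.norm_real, Real.norm_of_nonneg hδ.le] at h3
    nlinarith
  calc ‖h z - h (δ * Complex.I)‖ / ‖z ^ 2 + (δ : ℂ) ^ 2‖ ≤ 2 * K / (T ^ 2 / 2) := by gcongr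
    _ = 4 * K / T ^ 2 := by field_simp; ring

/-- The Poisson formula in the upper half plane, for bounded analytic functions. -/
theorem integral_poisson {h : ℂ → ℂ} {δ K c : ℝ} (hδ : 0 < δ) (hc : 0 < c)
    (hh : DifferentiableOn ℂ h {z | -c < z.im}) (hK : ∀ z : ℂ, 0 ≤ z.im → ‖h z‖ ≤ K) :
    ∫ x : ℝ, h x * ((x ^ 2 + δ ^ 2)⁻¹ : ℝ) = Real.pi / δ * h (δ * Complex.I) := by
  set U : Set ℂ := {z | -c < z.im} with hU
  have hUo : IsOpen U := isOpen_lt continuous_const Complex.continuous_im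
  have hI : (δ * Complex.I : ℂ) ∈ U := by
    simp only [hU, mem_ofPred_eq, Complex.mul_I_im, Complex.ofReal_re]
    linarith
  have hsub : ∀ z : ℂ, 0 ≤ z.im → z ∈ U := fun z hz => by
    simp only [hU, mem_ofPred_eq]; linarith
  have hne : ∀ z : ℂ, 0 ≤ z.im → z + δ * Complex.I ≠ 0 := by
    intro z hz h0
    have := congrArg Complex.im h0
    simp at this
    linarith
  -- The pole at `iδ` is removed by subtracting `h(iδ)`, so `k` is holomorphic on the closed half
  -- plane and its integral over the real line vanishes. What remains is `h(iδ)` times the integral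
  -- of `1/(x² + δ²)`.
  set k : ℂ → ℂ := fun z => dslope h (δ * Complex.I) z / (z + δ * Complex.I) with hk
  have hkd : DifferentiableOn ℂ k {z | 0 ≤ z.im} := by
    refine DifferentiableOn.div ?_ (by fun_prop) hne
    exact ((Complex.differentiableOn_dslope (hUo.mem_nhds hI)).2 hh).mono hsub
  have hK0 : 0 ≤ K := (norm_nonneg _).trans (hK 0 le_rfl)
  have hkx : ∀ x : ℝ, k x = (h x - h (δ * Complex.I)) * ((x ^ 2 + δ ^ 2)⁻¹ : ℝ) := by
    intro x
    have hx : (x : ℂ) ≠ δ * Complex.I := by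
      intro h0
      have := congrArg Complex.im h0
      simp at this
      linarith
    rw [hk]
    simp only
    rw [dslope_of_ne _ hx, slope_def_field, div_div,
      show ((x : ℂ) - δ * Complex.I) * (x + δ * Complex.I) = x ^ 2 + δ ^ 2 by ring_nf; simp]
    push_cast
    rw [div_eq_mul_inv]
  have hcont : Continuous fun x : ℝ => h x :=
    hh.continuousOn.comp_continuous Complex.continuous_ofReal fun x => hsub _ (by simp)
  have hint1 : Integrable fun x : ℝ => h x * ((x ^ 2 + δ ^ 2)⁻¹ : ℝ) :=
    Integrable.bdd_mul (c := K) (integrable_inv_sq_add_sq hδ).ofReal hcont.aestronglyMeasurable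
      (Eventually.of_forall fun x => hK x (by simp))
  have hint2 : Integrable fun x : ℝ => h (δ * Complex.I) * ((x ^ 2 + δ ^ 2)⁻¹ : ℝ) :=
    (integrable_inv_sq_add_sq hδ).ofReal.const_mul _
  have hintk : Integrable fun x : ℝ => k x := by
    simp only [hkx, sub_mul]
    exact hint1.sub hint2
  -- the contour shift
  have hbound : ∀ T : ℝ, 2 * δ ≤ T → ‖∫ x in (-T)..T, k x‖ ≤ 16 * K / T := by
    intro T hT
    have hT0 : 0 < T := by linarith
    have hrect := Complex.integral_boundary_rect_eq_zero_of_differentiableOn k (-T : ℝ)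
      (T + T * Complex.I) (hkd.mono ?_)
    · simp only [Complex.ofReal_re, Complex.ofReal_im, Complex.add_re, Complex.mul_re,
        Complex.I_re, mul_zero, Complex.I_im, mul_one, sub_self, add_zero, Complex.add_im,
        Complex.mul_im, zero_add, Complex.ofReal_zero, zero_mul] at hrect
      have n1 : ‖∫ x in (-T)..T, k (x + T * Complex.I)‖ ≤ 4 * K / T ^ 2 * |T - -T| := by
        refine intervalIntegral.norm_integral_le_of_norm_le_const fun x _ => ?_
        refine poisson_aux_norm_le hδ hK hT (by simpa using hT0.le) ?_
        refine le_trans ?_ (Complex.abs_im_le_norm _)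
        simp [le_abs_self]
      have n2 : ‖∫ y in (0 : ℝ)..T, k (T + y * Complex.I)‖ ≤ 4 * K / T ^ 2 * |T - 0| := by
        refine intervalIntegral.norm_integral_le_of_norm_le_const fun y hy => ?_
        rw [uIoc_of_le hT0.le] at hy
        refine poisson_aux_norm_le hδ hK hT (by simpa using hy.1.le) ?_
        refine le_trans ?_ (Complex.abs_re_le_norm _)
        simp [le_abs_self]
      have n3 : ‖∫ y in (0 : ℝ)..T, k ((-T : ℝ) + y * Complex.I)‖ ≤ 4 * K / T ^ 2 * |T - 0| := by
        refine intervalIntegral.norm_integral_le_of_norm_le_const fun y hy => ?_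
        rw [uIoc_of_le hT0.le] at hy
        refine poisson_aux_norm_le hδ hK hT (by simpa using hy.1.le) ?_
        refine le_trans ?_ (Complex.abs_re_le_norm _)
        simp [le_abs_self]
      rw [show T - -T = 2 * T by ring, abs_of_pos (by positivity)] at n1
      rw [sub_zero, abs_of_pos hT0] at n2 n3
      have e : ∫ x in (-T)..T, k x = (∫ x in (-T)..T, k (x + T * Complex.I)) -
          Complex.I • (∫ y in (0 : ℝ)..T, k (T + y * Complex.I)) +
          Complex.I • (∫ y in (0 : ℝ)..T, k ((-T : ℝ) + y * Complex.I)) := by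
        linear_combination hrect
      rw [e]
      refine (norm_add_le _ _).trans ((add_le_add_left (norm_sub_le _ _) _).trans ?_)
      rw [norm_smul, norm_smul, Complex.norm_I, one_mul, one_mul]
      refine (add_le_add (add_le_add n1 n2) n3).trans_eq ?_
      field_simp
      ring
    · intro z hz
      have h2 := hz.2
      simp only [Complex.ofReal_im, Complex.add_im, Complex.mul_im, Complex.ofReal_re,
        Complex.I_im, mul_one, Complex.I_re, mul_zero, add_zero, zero_add, mem_preimage,
        uIcc_of_le hT0.le] at h2
      exact h2.1
  have hzero : ∫ x : ℝ, k x = 0 := by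
    have t1 : Tendsto (fun T : ℝ => ∫ x in (-T)..T, k x) atTop (𝓝 (∫ x : ℝ, k x)) :=
      intervalIntegral_tendsto_integral hintk tendsto_neg_atTop_atBot tendsto_id
    have t2 : Tendsto (fun T : ℝ => ∫ x in (-T)..T, k x) atTop (𝓝 0) := by
      refine squeeze_zero_norm' ?_ (tendsto_const_nhds.div_atTop tendsto_id : Tendsto
        (fun T : ℝ => 16 * K / T) atTop (𝓝 0))
      filter_upwards [eventually_ge_atTop (2 * δ)] with T hT using hbound T hT
    exact tendsto_nhds_unique t1 t2
  simp only [hkx, sub_mul] at hzero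
  rw [integral_sub hint1 hint2, integral_const_mul, integral_complex_ofReal,
    integral_inv_sq_add_sq hδ, sub_eq_zero] at hzero
  rw [hzero]
  push_cast
  ring

/-- A bound for a bounded analytic function by its values on a lower horizontal line, with a
rapidly decreasing kernel. -/
theorem norm_le_lintegral_line {g : ℂ → ℂ} {K s : ℝ} {z : ℂ} (hs : 0 < s) (hz : s < z.im)
    (hg : DifferentiableOn ℂ g {w | 0 < w.im}) (hK : ∀ w : ℂ, s ≤ w.im → ‖g w‖ ≤ K) :
    ‖g z‖ₑ ≤ ∫⁻ x : ℝ, ENNReal.ofReal (16 * (z.im - s) ^ 5 / (Real.pi *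
      (x ^ 2 + (z.im - s) ^ 2) ^ 3)) * ‖g ((z.re + x : ℝ) + s * Complex.I)‖ₑ := by
  set δ := z.im - s with hδd
  have hδ : 0 < δ := sub_pos.2 hz
  have hne : ∀ w : ℂ, -min s δ < w.im → w + δ * Complex.I ≠ 0 := by
    intro w hw h0
    have := congrArg Complex.im h0
    simp at this
    have := min_le_right s δ
    linarith
  -- The multiplier equals `1` at `iδ`, is bounded by `2`, and `‖ψ‖⁴` decays like `x⁻⁴` on the line.
  -- Multiplied by the Poisson kernel it leaves enough decay to absorb the growth `(1 + |x|/y)³` met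
  -- in `large_or_small`. The translation in `h` moves the line `Im = s` to the real axis and `z` to
  -- `iδ`.
  set ψ : ℂ → ℂ := fun w => 2 * δ * Complex.I / (w + δ * Complex.I) with hψ
  set h : ℂ → ℂ := fun w => g (w + (z.re + s * Complex.I)) * ψ w ^ 4 with hh
  have hψn : ∀ w : ℂ, 0 ≤ w.im → ‖ψ w‖ ≤ 2 := by
    intro w hw
    have h1 : δ ≤ ‖w + δ * Complex.I‖ := by
      refine le_trans ?_ (Complex.abs_im_le_norm _)
      simp only [Complex.add_im, Complex.mul_I_im, Complex.ofReal_re]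
      exact le_trans (by linarith) (le_abs_self _)
    rw [hψ]
    simp only [norm_div, norm_mul, Complex.norm_I, mul_one, Complex.norm_real, Complex.norm_ofNat,
      Real.norm_of_nonneg hδ.le]
    rw [div_le_iff₀ (hδ.trans_le h1)]
    linarith
  have hdiff : DifferentiableOn ℂ h {w | -min s δ < w.im} := by
    refine DifferentiableOn.mul ?_ (DifferentiableOn.pow ?_ 4)
    · refine hg.comp (by fun_prop) fun w hw => ?_
      simp only [mem_ofPred_eq, Complex.add_im, Complex.ofReal_im, Complex.mul_I_im,
        Complex.ofReal_re, zero_add] at hw ⊢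
      have := min_le_left s δ
      linarith
    · exact DifferentiableOn.div (by fun_prop) (by fun_prop) fun w hw => hne w hw
  have hbd : ∀ w : ℂ, 0 ≤ w.im → ‖h w‖ ≤ K * 2 ^ 4 := by
    intro w hw
    rw [hh]
    simp only [norm_mul, norm_pow]
    have h1 : ‖g (w + (z.re + s * Complex.I))‖ ≤ K := hK _ (by simpa using hw)
    have h2 := hψn w hw
    gcongr
    exact (norm_nonneg _).trans h1
  have key := integral_poisson hδ (lt_min hs hδ) hdiff hbd
  have hψ1 : ψ (δ * Complex.I) = 1 := by
    have : (δ : ℂ) ≠ 0 := by exact_mod_cast hδ.ne'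
    rw [hψ]
    simp only
    rw [← two_mul, ← mul_assoc]
    exact div_self (by simp [this])
  have hzz : (δ * Complex.I : ℂ) + (z.re + s * Complex.I) = z := by
    apply Complex.ext <;> simp [hδd]
  have hval : h (δ * Complex.I) = g z := by
    rw [hh]
    simp only [hψ1, hzz, one_pow, mul_one]
  rw [hval] at key
  have key2 : g z = ((δ / Real.pi : ℝ) : ℂ) * ∫ x : ℝ, h x * ((x ^ 2 + δ ^ 2)⁻¹ : ℝ) := by
    rw [key]
    have h1 : (δ : ℂ) ≠ 0 := by exact_mod_cast hδ.ne'
    have h2 : (Real.pi : ℂ) ≠ 0 := by exact_mod_cast Real.pi_ne_zero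
    push_cast
    field_simp
  rw [key2, enorm_mul]
  refine (mul_le_mul_right (enorm_integral_le_lintegral_enorm _) _).trans ?_
  rw [← lintegral_const_mul' _ _ enorm_ne_top]
  refine lintegral_mono fun x => le_of_eq ?_
  have hx0 : 0 < x ^ 2 + δ ^ 2 := by positivity
  have hψx : ‖ψ x‖ ^ 4 = 16 * δ ^ 4 / (x ^ 2 + δ ^ 2) ^ 2 := by
    rw [hψ]
    simp only [norm_div, norm_mul, Complex.norm_I, mul_one, Complex.norm_real, Complex.norm_ofNat,
      Real.norm_of_nonneg hδ.le]
    rw [div_pow, show ‖(x : ℂ) + δ * Complex.I‖ ^ 4 = (‖(x : ℂ) + δ * Complex.I‖ ^ 2) ^ 2 by ring,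
      norm_sq_ofReal_add_mul_I]
    ring
  have hxx : (x : ℂ) + (z.re + s * Complex.I) = (z.re + x : ℝ) + s * Complex.I := by
    push_cast; ring
  rw [← ofReal_norm, ← ofReal_norm, ← ofReal_norm, ← ENNReal.ofReal_mul (norm_nonneg _),
    ← ENNReal.ofReal_mul (by positivity)]
  congr 1
  rw [hh]
  simp only [norm_mul, norm_pow, Complex.norm_real, hψx, hxx]
  rw [Real.norm_of_nonneg (by positivity), Real.norm_of_nonneg (by positivity)]
  have := Real.pi_pos
  field_simp

/-! ### The potentials `F`, `G`, `P`, `H` of a measure on the upper half plane -/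

/-- `∫ i / (z - ζ̄) dA(ζ)`. -/
def cauchyG (A : Measure ℂ) (z : ℂ) : ℂ := ∫ ζ, Complex.I / (z - conj ζ) ∂A

/-- `∫ 1 / (z - ζ̄)² dA(ζ)`: up to the sign, the Bergman projection of a measure on the upper half
plane. -/
def cauchyF (A : Measure ℂ) (z : ℂ) : ℂ := ∫ ζ, 1 / (z - conj ζ) ^ 2 ∂A

/-- `∫ 1 / |z - ζ̄|² dA(ζ)`. -/
def posP (A : Measure ℂ) (z : ℂ) : ℝ := ∫ ζ, 1 / ‖z - conj ζ‖ ^ 2 ∂A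

/-- `∫ (Im z + Im ζ)² / |z - ζ̄|⁴ dA(ζ)`. -/
def posH (A : Measure ℂ) (z : ℂ) : ℝ := ∫ ζ, (z.im + ζ.im) ^ 2 / ‖z - conj ζ‖ ^ 4 ∂A

theorem norm_sub_conj_sq (z ζ : ℂ) :
    ‖z - conj ζ‖ ^ 2 = (z.re - ζ.re) ^ 2 + (z.im + ζ.im) ^ 2 := by
  rw [← Complex.normSq_eq_norm_sq, Complex.normSq_apply]
  simp
  ring

theorem im_add_im_le_norm {z ζ : ℂ} : z.im + ζ.im ≤ ‖z - conj ζ‖ := by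
  refine le_trans ?_ (Complex.abs_im_le_norm _)
  simp [le_abs_self]

theorem norm_sub_conj_comm (z ζ : ℂ) : ‖z - conj ζ‖ = ‖ζ - conj z‖ := by
  rw [← Complex.norm_conj (ζ - conj z), map_sub, Complex.conj_conj, norm_sub_rev]

theorem im_le_norm {z ζ : ℂ} (hζ : 0 ≤ ζ.im) : z.im ≤ ‖z - conj ζ‖ :=
  le_trans (by linarith) im_add_im_le_norm

theorem sub_conj_ne_zero {z ζ : ℂ} (hz : 0 < z.im) (hζ : 0 ≤ ζ.im) : z - conj ζ ≠ 0 :=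
  norm_pos_iff.1 (hz.trans_le (im_le_norm hζ))

theorem re_I_div_sub_conj {z ζ : ℂ} :
    (Complex.I / (z - conj ζ)).re = (z.im + ζ.im) / ‖z - conj ζ‖ ^ 2 := by
  rw [Complex.div_re, Complex.normSq_eq_norm_sq]
  simp

theorem re_one_div_sub_conj_sq {z ζ : ℂ} :
    (1 / (z - conj ζ) ^ 2).re =
      ((z.re - ζ.re) ^ 2 - (z.im + ζ.im) ^ 2) / ‖z - conj ζ‖ ^ 4 := by
  rw [Complex.div_re, Complex.normSq_eq_norm_sq, norm_pow]
  simp [sq]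
  ring

/-- The kernel of `Re G - Im z * Re F`. -/
theorem lam_kernel_eq {z ζ : ℂ} (hz : 0 < z.im) (hζ : 0 ≤ ζ.im) :
    (Complex.I / (z - conj ζ)).re - z.im * (1 / (z - conj ζ) ^ 2).re =
      ζ.im * (1 / ‖z - conj ζ‖ ^ 2) + 2 * z.im * ((z.im + ζ.im) ^ 2 / ‖z - conj ζ‖ ^ 4) := by
  have h : 0 < ‖z - conj ζ‖ := hz.trans_le (im_le_norm hζ)
  rw [re_I_div_sub_conj, re_one_div_sub_conj_sq]
  have e := norm_sub_conj_sq z ζ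
  have e4 : ‖z - conj ζ‖ ^ 4 = (‖z - conj ζ‖ ^ 2) ^ 2 := by ring
  have h2 : 0 < ‖z - conj ζ‖ ^ 2 := by positivity
  rw [e4]
  field_simp
  rw [e]
  ring

theorem posP_kernel_le {z ζ : ℂ} (hz : 0 < z.im) (hζ : 0 ≤ ζ.im) :
    1 / ‖z - conj ζ‖ ^ 2 ≤ 1 / z.im ^ 2 := by
  have h := im_le_norm (z := z) hζ
  gcongr

theorem posH_kernel_le {z ζ : ℂ} (hz : 0 < z.im) (hζ : 0 ≤ ζ.im) :
    (z.im + ζ.im) ^ 2 / ‖z - conj ζ‖ ^ 4 ≤ 1 / ‖z - conj ζ‖ ^ 2 := by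
  have h : 0 < ‖z - conj ζ‖ := hz.trans_le (im_le_norm hζ)
  rw [div_le_div_iff₀ (by positivity) (by positivity)]
  have h1 : (z.im + ζ.im) ^ 2 ≤ ‖z - conj ζ‖ ^ 2 := by
    rw [norm_sub_conj_sq]
    nlinarith [sq_nonneg (z.re - ζ.re)]
  nlinarith [sq_nonneg ‖z - conj ζ‖]

/-- Comparison of the kernel at two points. -/
theorem norm_sub_conj_le_mul {z w ζ : ℂ} {c : ℝ} (hz : 0 < z.im) (hζ : 0 ≤ ζ.im)
    (h : ‖z - w‖ ≤ c * z.im) : ‖w - conj ζ‖ ≤ (1 + c) * ‖z - conj ζ‖ := by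
  have h1 : ‖w - conj ζ‖ ≤ ‖z - conj ζ‖ + ‖z - w‖ := by
    have := norm_sub_le (z - conj ζ) (z - w)
    simpa using this
  have h2 := im_le_norm (z := z) hζ
  have hc : 0 ≤ c := by
    by_contra hc
    have := norm_nonneg (z - w)
    nlinarith
  nlinarith

section Measure

variable {A : Measure ℂ} [IsFiniteMeasure A]

theorem integrable_of_bound_kernel {E : Type*} [NormedAddCommGroup E] {k : ℂ → E} {C : ℝ}
    (hA : ∀ᵐ ζ ∂A, 0 ≤ ζ.im) (hk : AEStronglyMeasurable k A)
    (hb : ∀ ζ : ℂ, 0 ≤ ζ.im → ‖k ζ‖ ≤ C) : Integrable k A :=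
  (integrable_const C).mono' hk (hA.mono hb)

theorem integrable_posP (hA : ∀ᵐ ζ ∂A, 0 ≤ ζ.im) {z : ℂ} (hz : 0 < z.im) :
    Integrable (fun ζ : ℂ => 1 / ‖z - conj ζ‖ ^ 2) A := by
  refine integrable_of_bound_kernel hA ?_ (C := 1 / z.im ^ 2) fun ζ hζ => ?_
  · exact Measurable.aestronglyMeasurable (by fun_prop)
  · rw [Real.norm_of_nonneg (by positivity)]
    exact posP_kernel_le hz hζ

theorem integrable_posH (hA : ∀ᵐ ζ ∂A, 0 ≤ ζ.im) {z : ℂ} (hz : 0 < z.im) :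
    Integrable (fun ζ : ℂ => (z.im + ζ.im) ^ 2 / ‖z - conj ζ‖ ^ 4) A := by
  refine integrable_of_bound_kernel hA ?_ (C := 1 / z.im ^ 2) fun ζ hζ => ?_
  · exact Measurable.aestronglyMeasurable (by fun_prop)
  · rw [Real.norm_of_nonneg (by positivity)]
    exact (posH_kernel_le hz hζ).trans (posP_kernel_le hz hζ)

theorem integrable_cauchyF (hA : ∀ᵐ ζ ∂A, 0 ≤ ζ.im) {z : ℂ} (hz : 0 < z.im) :
    Integrable (fun ζ : ℂ => 1 / (z - conj ζ) ^ 2) A := by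
  refine integrable_of_bound_kernel hA ?_ (C := 1 / z.im ^ 2) fun ζ hζ => ?_
  · refine Measurable.aestronglyMeasurable ?_
    exact measurable_const.div ((measurable_const.sub Complex.continuous_conj.measurable).pow_const 2)
  · rw [norm_div, norm_one, norm_pow]
    exact posP_kernel_le hz hζ

theorem integrable_cauchyG (hA : ∀ᵐ ζ ∂A, 0 ≤ ζ.im) {z : ℂ} (hz : 0 < z.im) :
    Integrable (fun ζ : ℂ => Complex.I / (z - conj ζ)) A := by
  refine integrable_of_bound_kernel hA ?_ (C := 1 / z.im) fun ζ hζ => ?_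
  · refine Measurable.aestronglyMeasurable ?_
    exact measurable_const.div (measurable_const.sub Complex.continuous_conj.measurable)
  · rw [norm_div, Complex.norm_I]
    have h := im_le_norm (z := z) hζ
    gcongr

theorem posP_nonneg (A : Measure ℂ) (z : ℂ) : 0 ≤ posP A z :=
  integral_nonneg fun _ => by positivity

theorem posH_nonneg (A : Measure ℂ) (z : ℂ) : 0 ≤ posH A z :=
  integral_nonneg fun _ => by positivity

theorem norm_cauchyF_le (A : Measure ℂ) (z : ℂ) : ‖cauchyF A z‖ ≤ posP A z := by
  refine (norm_integral_le_integral_norm _).trans_eq ?_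
  simp only [norm_div, norm_one, norm_pow, posP]

theorem posH_le_posP (hA : ∀ᵐ ζ ∂A, 0 ≤ ζ.im) {z : ℂ} (hz : 0 < z.im) :
    posH A z ≤ posP A z :=
  integral_mono_ae (integrable_posH hA hz) (integrable_posP hA hz)
    (hA.mono fun _ hζ => posH_kernel_le hz hζ)

theorem posP_le_mul_posP (hA : ∀ᵐ ζ ∂A, 0 ≤ ζ.im) {z w : ℂ} (hz : 0 < z.im) (hw : 0 < w.im)
    {c : ℝ} (h : ‖z - w‖ ≤ c * z.im) : posP A z ≤ (1 + c) ^ 2 * posP A w := by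
  rw [posP, posP, ← integral_const_mul]
  refine integral_mono_ae (integrable_posP hA hz) ((integrable_posP hA hw).const_mul _)
    (hA.mono fun ζ hζ => ?_)
  have h1 := norm_sub_conj_le_mul hz hζ h
  have h2 : 0 < ‖z - conj ζ‖ := hz.trans_le (im_le_norm hζ)
  have h3 : 0 < ‖w - conj ζ‖ := hw.trans_le (im_le_norm hζ)
  simp only
  rw [mul_one_div, div_le_div_iff₀ (by positivity) (by positivity), one_mul, ← mul_pow]
  gcongr

/-- Differentiation under the integral, dominated on the disc of radius half the height. This makes
`G` a primitive of `F` up to the factor `-i`, and it also yields the analyticity of `F`. -/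
theorem hasDerivAt_cauchyG (hA : ∀ᵐ ζ ∂A, 0 ≤ ζ.im) {z : ℂ} (hz : 0 < z.im) :
    HasDerivAt (cauchyG A) (-Complex.I * cauchyF A z) z := by
  have him : ∀ w ∈ ball z (z.im / 2), z.im / 2 < w.im := by
    intro w hw
    have h1 := (Complex.abs_im_le_norm (w - z)).trans_lt (mem_ball_iff_norm.1 hw)
    rw [Complex.sub_im, abs_lt] at h1
    linarith
  have key := hasDerivAt_integral_of_dominated_loc_of_deriv_le (μ := A)
    (F := fun (w : ℂ) (ζ : ℂ) => Complex.I / (w - conj ζ))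
    (F' := fun (w : ℂ) (ζ : ℂ) => -Complex.I * (1 / (w - conj ζ) ^ 2)) (x₀ := z)
    (s := ball z (z.im / 2)) (bound := fun _ => 1 / (z.im / 2) ^ 2)
    (ball_mem_nhds z (by positivity)) ?_ (integrable_cauchyG hA hz) ?_ ?_ (integrable_const _) ?_
  · rw [cauchyF, ← integral_const_mul]
    exact key.2
  · refine Eventually.of_forall fun w => Measurable.aestronglyMeasurable ?_
    exact measurable_const.div (measurable_const.sub Complex.continuous_conj.measurable)
  · exact (integrable_cauchyF hA hz).aestronglyMeasurable.const_mul _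
  · refine hA.mono fun ζ hζ w hw => ?_
    have h1 := him w hw
    rw [norm_mul, norm_neg, Complex.norm_I, one_mul, norm_div, norm_one, norm_pow]
    refine (posP_kernel_le (by linarith) hζ).trans ?_
    gcongr
  · refine hA.mono fun ζ hζ w hw => ?_
    have h1 : w - conj ζ ≠ 0 := sub_conj_ne_zero (by linarith [him w hw]) hζ
    have h2 := ((hasDerivAt_id w).sub_const (conj ζ)).inv h1
    have h3 := h2.const_mul Complex.I
    have h4 : HasDerivAt (fun w : ℂ => Complex.I / (w - conj ζ))
        (Complex.I * (-1 / (w - conj ζ) ^ 2)) w := by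
      simpa only [div_eq_mul_inv, Pi.inv_apply, id] using h3
    exact h4.congr_deriv (by ring)

theorem differentiableOn_cauchyF (hA : ∀ᵐ ζ ∂A, 0 ≤ ζ.im) :
    DifferentiableOn ℂ (cauchyF A) {z | 0 < z.im} := by
  have ho : IsOpen {z : ℂ | 0 < z.im} := isOpen_lt continuous_const Complex.continuous_im
  have h1 : DifferentiableOn ℂ (cauchyG A) {z | 0 < z.im} := fun z hz =>
    (hasDerivAt_cauchyG hA hz).differentiableAt.differentiableWithinAt
  have h2 := (h1.deriv ho).const_mul Complex.I
  refine h2.congr fun z hz => ?_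
  rw [(hasDerivAt_cauchyG hA hz).deriv, ← mul_assoc]
  simp

/-! ### The nonnegative potential `λ` and its almost affine behaviour -/

/-- `Re G - Im z * Re F`. -/
def lam (A : Measure ℂ) (z : ℂ) : ℝ := (cauchyG A z).re - z.im * (cauchyF A z).re

theorem lam_eq (hA : ∀ᵐ ζ ∂A, 0 ≤ ζ.im) {z : ℂ} (hz : 0 < z.im) :
    lam A z = ∫ ζ, (ζ.im * (1 / ‖z - conj ζ‖ ^ 2) +
      2 * z.im * ((z.im + ζ.im) ^ 2 / ‖z - conj ζ‖ ^ 4)) ∂A := by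
  have e1 : (cauchyG A z).re = ∫ ζ, (Complex.I / (z - conj ζ)).re ∂A :=
    (integral_re (integrable_cauchyG hA hz)).symm
  have e2 : (cauchyF A z).re = ∫ ζ, (1 / (z - conj ζ) ^ 2).re ∂A :=
    (integral_re (integrable_cauchyF hA hz)).symm
  rw [lam, e1, e2, ← integral_const_mul, ← integral_sub]
  · exact integral_congr_ae (hA.mono fun ζ hζ => lam_kernel_eq hz hζ)
  · exact (integrable_cauchyG hA hz).re
  · exact (integrable_cauchyF hA hz).re.const_mul _

theorem lam_nonneg (hA : ∀ᵐ ζ ∂A, 0 ≤ ζ.im) {z : ℂ} (hz : 0 < z.im) : 0 ≤ lam A z := by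
  rw [lam_eq hA hz]
  exact integral_nonneg_of_ae (hA.mono fun ζ hζ => by positivity)

theorem integrable_im_mul (hA : ∀ᵐ ζ ∂A, 0 ≤ ζ.im) {z : ℂ} (hz : 0 < z.im) :
    Integrable (fun ζ : ℂ => ζ.im * (1 / ‖z - conj ζ‖ ^ 2)) A := by
  refine integrable_of_bound_kernel hA ?_ (C := 1 / z.im) fun ζ hζ => ?_
  · exact Measurable.aestronglyMeasurable (by fun_prop)
  · rw [Real.norm_of_nonneg (by positivity)]
    have h := im_add_im_le_norm (z := z) (ζ := ζ)
    have h2 := im_le_norm (z := z) hζ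
    have h0 : 0 < ‖z - conj ζ‖ := hz.trans_le h2
    rw [mul_one_div, div_le_div_iff₀ (by positivity) hz]
    nlinarith

theorem two_mul_im_mul_posH_le_lam (hA : ∀ᵐ ζ ∂A, 0 ≤ ζ.im) {z : ℂ} (hz : 0 < z.im) :
    2 * z.im * posH A z ≤ lam A z := by
  rw [lam_eq hA hz, posH, ← integral_const_mul]
  refine integral_mono_ae ((integrable_posH hA hz).const_mul _)
    ((integrable_im_mul hA hz).add ((integrable_posH hA hz).const_mul _))
    (hA.mono fun ζ hζ => ?_)
  simp only
  exact le_add_of_nonneg_left (by positivity)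

/-- In the kernel of `λ` the first term is at most `Im z` times the kernel of `P`, as `Im ζ ≤ Im z`.
The second is at most `2 Im z` times it, as `H ≤ P`. -/
theorem lam_le_posP (hA : ∀ᵐ ζ ∂A, 0 ≤ ζ.im) {z : ℂ} (hz : 0 < z.im)
    (hA' : ∀ᵐ ζ ∂A, ζ.im ≤ z.im) : lam A z ≤ 3 * z.im * posP A z := by
  rw [lam_eq hA hz, posP, ← integral_const_mul]
  refine integral_mono_ae ((integrable_im_mul hA hz).add ((integrable_posH hA hz).const_mul _))
    ((integrable_posP hA hz).const_mul _) ?_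
  filter_upwards [hA, hA'] with ζ h1 h2
  have h3 := posH_kernel_le hz h1
  have h4 : 0 ≤ 1 / ‖z - conj ζ‖ ^ 2 := by positivity
  nlinarith

/-- If `F` is almost constant, then `lam` is almost affine in the horizontal direction. -/
theorem abs_lam_sub_le (hA : ∀ᵐ ζ ∂A, 0 ≤ ζ.im) {S : Set ℂ} (hS : Convex ℝ S)
    (hS0 : ∀ z ∈ S, 0 < z.im) {c : ℂ} {E : ℝ} (hE : ∀ z ∈ S, ‖cauchyF A z - c‖ ≤ E) {z w : ℂ}
    (hz : z ∈ S) (hw : w ∈ S) :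
    |lam A w - lam A z - c.im * (w.re - z.re)| ≤ E * (‖w - z‖ + z.im + w.im) := by
  have h1 : ‖(cauchyG A w + Complex.I * c * w) - (cauchyG A z + Complex.I * c * z)‖ ≤
      E * ‖w - z‖ := by
    refine hS.norm_image_sub_le_of_norm_hasDerivWithin_le
      (f := fun z => cauchyG A z + Complex.I * c * z)
      (f' := fun z => -Complex.I * cauchyF A z + Complex.I * c * 1) (fun x hx => ?_)
      (fun x hx => ?_) hz hw
    · exact ((hasDerivAt_cauchyG hA (hS0 x hx)).add
        ((hasDerivAt_id x).const_mul (Complex.I * c))).hasDerivWithinAt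
    · rw [show -Complex.I * cauchyF A x + Complex.I * c * 1 = -Complex.I * (cauchyF A x - c) by
        ring, norm_mul, norm_neg, Complex.norm_I, one_mul]
      exact hE x hx
  have h2 := (Complex.abs_re_le_norm _).trans h1
  have h3 := (Complex.abs_re_le_norm _).trans (hE z hz)
  have h4 := (Complex.abs_re_le_norm _).trans (hE w hw)
  have hz0 := hS0 z hz
  have hw0 := hS0 w hw
  -- The term `Im z * Re F` in `λ` is what cancels the vertical part `Re c * Im z` of the affine
  -- function, so only a horizontal slope `Im c` survives. The rest is the increment of `G + i c z`,
  -- whose derivative is `-i (F - c)`, and two boundary terms.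
  have e : lam A w - lam A z - c.im * (w.re - z.re) =
      ((cauchyG A w + Complex.I * c * w) - (cauchyG A z + Complex.I * c * z)).re
        - w.im * (cauchyF A w - c).re + z.im * (cauchyF A z - c).re := by
    simp only [lam, Complex.sub_re, Complex.add_re, Complex.mul_re, Complex.I_re, Complex.I_im,
      Complex.mul_im]
    ring
  rw [e]
  have h5 : |w.im * (cauchyF A w - c).re| ≤ w.im * E := by
    rw [abs_mul, abs_of_pos hw0]; gcongr
  have h6 : |z.im * (cauchyF A z - c).re| ≤ z.im * E := by
    rw [abs_mul, abs_of_pos hz0]; gcongr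
  rw [abs_le] at *
  constructor <;> linarith [h2.1, h2.2, h5.1, h5.2, h6.1, h6.2]

/-- The rectangle on which `F` is compared with a constant. -/
def box (z : ℂ) (R θ : ℝ) : Set ℂ :=
  {w | |w.re - z.re| ≤ 2 * R * z.im ∧ θ * z.im ≤ w.im ∧ w.im ≤ z.im}

theorem convex_box (z : ℂ) (R θ : ℝ) : Convex ℝ (box z R θ) := by
  have e : box z R θ = (Complex.reCLM ⁻¹' Icc (z.re - 2 * R * z.im) (z.re + 2 * R * z.im)) ∩
      (Complex.imCLM ⁻¹' Icc (θ * z.im) z.im) := by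
    ext w
    simp only [box, mem_ofPred_eq, mem_inter_iff, mem_preimage, mem_Icc, Complex.reCLM_apply,
      Complex.imCLM_apply, abs_le]
    constructor
    · rintro ⟨⟨h1, h2⟩, h3, h4⟩
      exact ⟨⟨by linarith, by linarith⟩, h3, h4⟩
    · rintro ⟨⟨h1, h2⟩, h3, h4⟩
      exact ⟨⟨by linarith, by linarith⟩, h3, h4⟩
  rw [e]
  exact ((convex_Icc _ _).linear_preimage Complex.reCLM.toLinearMap).inter
    ((convex_Icc _ _).linear_preimage Complex.imCLM.toLinearMap)

/-- A nonnegative, almost affine function of `Re z`: nonnegativity at both lower corners, at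
horizontal distance `2 R Im z`, bounds the slope by about `λ(z) / (2 R Im z)`. At distance at most
`R Im z` at least half of `λ(z)` remains. -/
theorem lam_le_two_mul_lam (hA : ∀ᵐ ζ ∂A, 0 ≤ ζ.im) {z : ℂ} (hz : 0 < z.im) {R θ : ℝ}
    (hR : 1 ≤ R) (hθ : 0 < θ) (hθ1 : θ ≤ 1) {c : ℂ} {E : ℝ}
    (hE : ∀ w ∈ box z R θ, ‖cauchyF A w - c‖ ≤ E) {w : ℂ} (hw : |w.re - z.re| ≤ R * z.im)
    (hw' : w.im = θ * z.im) : lam A z ≤ 2 * lam A w + 13 * R * z.im * E := by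
  set y := z.im with hy
  have hRy : 0 ≤ R * y := by positivity
  have hS0 : ∀ u ∈ box z R θ, 0 < u.im := fun u hu => (by positivity : 0 < θ * y).trans_le hu.2.1
  have hzS : z ∈ box z R θ :=
    ⟨by rw [sub_self, abs_zero]; positivity, mul_le_of_le_one_left hz.le hθ1, le_rfl⟩
  have hE0 : 0 ≤ E := (norm_nonneg _).trans (hE z hzS)
  have hθy : θ * y ≤ y := mul_le_of_le_one_left hz.le hθ1
  have hwS : w ∈ box z R θ := ⟨hw.trans (by rw [← hy]; linarith), hw'.ge, hw'.trans_le hθy⟩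
  have hyR : y ≤ R * y := le_mul_of_one_le_left hz.le hR
  have hdist : ∀ u ∈ box z R θ, ‖u - z‖ ≤ |u.re - z.re| + y := by
    intro u hu
    refine (Complex.norm_le_abs_re_add_abs_im _).trans ?_
    rw [Complex.sub_re, Complex.sub_im]
    refine add_le_add_right ?_ _
    have := hS0 u hu
    have := hu.2.2
    rw [abs_le]
    constructor <;> linarith
  -- positivity at the two lower corners bounds the slope
  have corner : ∀ σ : ℝ, |σ| = 1 → 0 ≤ lam A z + c.im * (σ * (2 * R * y)) + E * (5 * R * y) := by
    intro σ hσ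
    set u : ℂ := ⟨z.re + σ * (2 * R * y), θ * y⟩ with hu
    have hure : |u.re - z.re| = 2 * R * y := by
      rw [hu]
      simp only [add_sub_cancel_left]
      rw [abs_mul, hσ, one_mul, abs_of_nonneg (by positivity)]
    have huS : u ∈ box z R θ := ⟨hure.le, le_rfl, hθy⟩
    have h1 := lam_nonneg hA (hS0 u huS)
    have h2 := (abs_le.1 (abs_lam_sub_le hA (convex_box z R θ) hS0 hE hzS huS)).2
    have h3 := hdist u huS
    have h4 : u.re - z.re = σ * (2 * R * y) := by simp [hu]
    have h5 : u.im = θ * y := rfl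
    rw [hure] at h3
    rw [h4, h5] at h2
    have h6 : ‖u - z‖ + z.im + θ * y ≤ 5 * R * y := by rw [← hy]; linarith
    have h7 := mul_le_mul_of_nonneg_left h6 hE0
    linarith
  have hc1 := corner 1 (by simp)
  have hc2 := corner (-1) (by simp)
  have h1 := (abs_le.1 (abs_lam_sub_le hA (convex_box z R θ) hS0 hE hzS hwS)).1
  have h3 := hdist w hwS
  -- The errors are `4RyE` at `w` and `5RyE` at a corner. Half of the latter enters through the
  -- slope, so the final constant is `2 (4 + 5/2) = 13`.
  have h6 : ‖w - z‖ + z.im + w.im ≤ 4 * R * y := by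
    rw [← hy, hw']; linarith
  have h7 := mul_le_mul_of_nonneg_left h6 hE0
  have hslope : -(lam A z / 2 + E * (5 * R * y) / 2) ≤ c.im * (w.re - z.re) := by
    have h8 : |c.im * (2 * R * y)| ≤ lam A z + E * (5 * R * y) := by
      rw [abs_le]; constructor <;> linarith
    have h9 : |c.im * (w.re - z.re)| ≤ |c.im * (2 * R * y)| / 2 := by
      rw [abs_mul, abs_mul, abs_of_nonneg (by positivity : 0 ≤ 2 * R * y)]
      have := mul_le_mul_of_nonneg_left hw (abs_nonneg c.im)
      linarith
    have := (abs_le.1 (h9.trans (div_le_div_of_nonneg_right h8 (by norm_num)))).1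
    linarith
  linarith

/-- If `F` is almost constant on the box of `z` and `A` lives below, then `H(z)` is small compared
with `P` on the lower edge of the box. -/
theorem posH_le_of_almost_const (hA : ∀ᵐ ζ ∂A, 0 ≤ ζ.im) {z : ℂ} (hz : 0 < z.im) {R θ : ℝ}
    (hR : 1 ≤ R) (hθ : 0 < θ) (hθ1 : θ ≤ 1) (hA' : ∀ᵐ ζ ∂A, ζ.im ≤ θ * z.im) {c : ℂ} {E : ℝ}
    (hE : ∀ w ∈ box z R θ, ‖cauchyF A w - c‖ ≤ E) {w : ℂ} (hw : |w.re - z.re| ≤ R * z.im)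
    (hw' : w.im = θ * z.im) : posH A z ≤ 3 * θ * posP A w + 7 * R * E := by
  have h1 := two_mul_im_mul_posH_le_lam hA hz
  have h2 := lam_le_two_mul_lam hA hz hR hθ hθ1 hE hw hw'
  have hw0 : 0 < w.im := by rw [hw']; positivity
  -- The source of the gain: at the lower height `θ Im z`, still above the measure, `λ` is only of
  -- size `θ Im z` times `P`.
  have h3 := lam_le_posP hA hw0 (by rwa [hw'])
  rw [hw'] at h3
  have hE0 : 0 ≤ E := (norm_nonneg _).trans (hE z ⟨by rw [sub_self, abs_zero]; positivity,
    mul_le_of_le_one_left hz.le hθ1, le_rfl⟩)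
  have h4 : 0 ≤ R * z.im * E := by positivity
  have h5 : 2 * z.im * posH A z ≤ 2 * z.im * (3 * θ * posP A w + 7 * R * E) := by nlinarith
  exact le_of_mul_le_mul_left h5 (by positivity)

end Measure

/-! ### Splitting by height and the dichotomy for `F` -/

/-- The points whose height is comparable with `y`. -/
def midSet (κ y : ℝ) : Set ℂ := {ζ | κ * y < ζ.im ∧ ζ.im < y / κ}

theorem measurableSet_midSet (κ y : ℝ) : MeasurableSet (midSet κ y) :=
  (measurableSet_lt measurable_const Complex.measurable_im).inter
    (measurableSet_lt Complex.measurable_im measurable_const)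

/-- A relative displacement `t ≤ 1/2` keeps `‖b‖ ≥ ‖a‖/2` and `‖a + b‖ ≤ 5‖a‖/2`, whence `10 = 4 ·
5/2`. -/
theorem norm_kernel_sub_le {a b : ℂ} {t : ℝ} (ha : a ≠ 0) (ht : t ≤ 1 / 2)
    (h : ‖a - b‖ ≤ t * ‖a‖) : ‖1 / b ^ 2 - 1 / a ^ 2‖ ≤ 10 * t * (1 / ‖a‖ ^ 2) := by
  have ha' : 0 < ‖a‖ := norm_pos_iff.2 ha
  have ht0 : 0 ≤ t := by
    by_contra h0
    have := norm_nonneg (a - b)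
    nlinarith
  have h1 : ‖a‖ / 2 ≤ ‖b‖ := by
    have := norm_sub_norm_le a b
    nlinarith
  have hb : b ≠ 0 := norm_pos_iff.1 (by linarith)
  have h2 : ‖a + b‖ ≤ 5 / 2 * ‖a‖ := by
    have e : a + b = 2 * a - (a - b) := by ring
    rw [e]
    refine (norm_sub_le _ _).trans ?_
    rw [norm_mul, Complex.norm_ofNat]
    nlinarith
  have e : 1 / b ^ 2 - 1 / a ^ 2 = (a - b) * (a + b) / (b ^ 2 * a ^ 2) := by
    field_simp
    ring
  rw [e, norm_div, norm_mul, norm_mul, norm_pow, norm_pow]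
  calc ‖a - b‖ * ‖a + b‖ / (‖b‖ ^ 2 * ‖a‖ ^ 2)
      ≤ (t * ‖a‖) * (5 / 2 * ‖a‖) / ((‖a‖ / 2) ^ 2 * ‖a‖ ^ 2) := by gcongr
    _ = 10 * t * (1 / ‖a‖ ^ 2) := by field_simp; ring

section Measure

variable {A : Measure ℂ}

theorem integral_eq_below_add_mid_add_above {E : Type*} [NormedAddCommGroup E] [NormedSpace ℝ E]
    {k : ℂ → E} (hk : Integrable k A) {κ y : ℝ} (hκ : 0 < κ) (hκ1 : κ < 1) (hy : 0 < y) :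
    ∫ ζ, k ζ ∂A = ∫ ζ in {ζ | ζ.im ≤ κ * y}, k ζ ∂A + ∫ ζ in midSet κ y, k ζ ∂A +
      ∫ ζ in {ζ | y / κ ≤ ζ.im}, k ζ ∂A := by
  have hb : MeasurableSet {ζ : ℂ | ζ.im ≤ κ * y} :=
    measurableSet_le Complex.measurable_im measurable_const
  have ha : MeasurableSet {ζ : ℂ | y / κ ≤ ζ.im} :=
    measurableSet_le measurable_const Complex.measurable_im
  have hlt : κ * y < y / κ := by
    rw [lt_div_iff₀ hκ]
    nlinarith [mul_lt_mul_of_pos_left hκ1 hκ]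
  rw [← integral_add_compl hb hk, ← integral_add_compl ha (hk.restrict (s := _ᶜ)),
    Measure.restrict_restrict ha, Measure.restrict_restrict ha.compl]
  have e1 : {ζ : ℂ | y / κ ≤ ζ.im} ∩ {ζ : ℂ | ζ.im ≤ κ * y}ᶜ = {ζ | y / κ ≤ ζ.im} := by
    ext ζ
    simp only [mem_inter_iff, mem_ofPred_eq, mem_compl_iff, not_le]
    exact ⟨fun h => h.1, fun h => ⟨h, hlt.trans_le h⟩⟩
  have e2 : {ζ : ℂ | y / κ ≤ ζ.im}ᶜ ∩ {ζ : ℂ | ζ.im ≤ κ * y}ᶜ = midSet κ y := by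
    ext ζ
    simp only [mem_inter_iff, mem_ofPred_eq, mem_compl_iff, not_le, midSet]
    exact and_comm
  rw [e1, e2]
  abel

variable [IsFiniteMeasure A]

theorem posP_restrict_le (hA : ∀ᵐ ζ ∂A, 0 ≤ ζ.im) {z : ℂ} (hz : 0 < z.im) (S : Set ℂ) :
    posP (A.restrict S) z ≤ posP A z :=
  setIntegral_le_integral (integrable_posP hA hz) (Eventually.of_forall fun _ => by positivity)

theorem posH_restrict_le (hA : ∀ᵐ ζ ∂A, 0 ≤ ζ.im) {z : ℂ} (hz : 0 < z.im) (S : Set ℂ) :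
    posH (A.restrict S) z ≤ posH A z :=
  setIntegral_le_integral (integrable_posH hA hz) (Eventually.of_forall fun _ => by positivity)

/-- The contribution of the measure far above is almost constant. -/
theorem norm_cauchyF_sub_le (hA : ∀ᵐ ζ ∂A, 0 ≤ ζ.im) {z w : ℂ} (hz : 0 < z.im) (hw : 0 < w.im)
    {κ c : ℝ} (hκ : 0 < κ) (hA' : ∀ᵐ ζ ∂A, z.im / κ ≤ ζ.im) (hc : ‖z - w‖ ≤ c * z.im)
    (hc0 : 0 ≤ c) (hcκ : c * κ ≤ 1 / 2) :
    ‖cauchyF A w - cauchyF A z‖ ≤ 10 * (c * κ) * posP A z := by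
  rw [cauchyF, cauchyF, ← integral_sub (integrable_cauchyF hA hw) (integrable_cauchyF hA hz),
    posP, ← integral_const_mul]
  refine (norm_integral_le_integral_norm _).trans (integral_mono_ae ?_ ?_ ?_)
  · exact ((integrable_cauchyF hA hw).sub (integrable_cauchyF hA hz)).norm
  · exact (integrable_posP hA hz).const_mul _
  · filter_upwards [hA, hA'] with ζ h1 h2
    refine norm_kernel_sub_le (sub_conj_ne_zero hz h1) hcκ ?_
    rw [show z - conj ζ - (w - conj ζ) = z - w by ring]
    refine hc.trans ?_
    rw [mul_assoc]
    refine mul_le_mul_of_nonneg_left ?_ hc0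
    -- A point `ζ` higher than `Im z / κ` is at distance at least `Im z / κ` from `conj z`, so the
    -- displacement `c * Im z` is at most the fraction `cκ` of `‖z - ζ̄‖`.
    have h3 := im_add_im_le_norm (z := z) (ζ := ζ)
    rw [div_le_iff₀ hκ] at h2
    nlinarith

/-- If `F` is not small on the box of `z`, then `F` may be divided out of the sub-mean value
property of `g F`. -/
theorem norm_mul_posP_le_of_large (hA : ∀ᵐ ζ ∂A, 0 ≤ ζ.im) {θ R ε : ℝ} (hθ : 0 < θ)
    (hθ1 : θ ≤ 1) (hR : 1 ≤ R) (hε : 0 < ε) (hε1 : ε ≤ 1) {g : ℂ → ℂ}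
    (hg : DifferentiableOn ℂ g {w | 0 < w.im}) {z : ℂ} (hz : 0 < z.im) {p : ℂ}
    (hp : p ∈ box z R θ) (hF : ε * ((1 + 8 * R / θ) ^ 2 * posP A z) ≤ ‖cauchyF A p‖)
    {n : ℕ} (hn : 24 * R / θ ≤ n) :
    ‖g z‖ * posP A z * volume.real (ball z (θ * z.im / 8)) ≤
      Real.exp (9 ^ (n + 1) * -Real.log ε) *
        ∫ w in ball z (θ * z.im / 8), ‖g w * cauchyF A w‖ := by
  set y := z.im with hy
  -- A disc of radius `4r` about a point of the box then stays above height `θy/2`, hence inside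
  -- `U`.
  set r := θ * y / 8 with hr
  have hr0 : 0 < r := by positivity
  have hP0 := posP_nonneg A z
  rcases hP0.eq_or_lt with h0 | hP
  · rw [← h0, mul_zero, zero_mul]
    exact mul_nonneg (Real.exp_nonneg _) (integral_nonneg fun _ => norm_nonneg _)
  -- The Harnack constant of `P` on `U`: points of `U` are within `4Ry` of `z` and higher than
  -- `θy/2`. Thus `‖F‖ ≤ P ≤ M` on `U`, and `F / M` is bounded by `1`, as the chain lemma requires.
  set C2 := (1 + 8 * R / θ) ^ 2 with hC2
  have hC2' : 1 ≤ C2 := one_le_pow₀ (le_add_of_nonneg_right (by positivity))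
  set M := C2 * posP A z with hM
  have hM0 : 0 < M := by positivity
  set U : Set ℂ := {w | |w.re - z.re| < 3 * R * y ∧ θ * y / 2 < w.im ∧ w.im < 2 * y} with hU
  have hU0 : ∀ w ∈ U, 0 < w.im := fun w hw => lt_trans (by positivity) hw.2.1
  have hRy : y ≤ R * y := le_mul_of_one_le_left hz.le hR
  have hθy : θ * y ≤ y := mul_le_of_le_one_left hz.le hθ1
  have hFU : ∀ w ∈ U, ‖cauchyF A w‖ ≤ M := by
    intro w hw
    refine (norm_cauchyF_le A w).trans ?_
    refine posP_le_mul_posP hA (hU0 w hw) hz ?_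
    refine (Complex.norm_le_abs_re_add_abs_im _).trans ?_
    rw [Complex.sub_re, Complex.sub_im]
    have h1 : |w.im - z.im| ≤ y := by
      rw [abs_le]
      have := hU0 w hw
      have := hw.2.2
      constructor <;> linarith
    have h2 : 4 * (R * y) ≤ 8 * R / θ * w.im := by
      rw [div_mul_eq_mul_div, le_div_iff₀ hθ]
      have := hw.2.1
      nlinarith
    have := hw.1
    linarith
  have hbox : ∀ u ∈ box z R θ, ball u (4 * r) ⊆ U := by
    intro u hu w hw
    have h1 := mem_ball_iff_norm.1 hw
    have h2 := (Complex.abs_re_le_norm (w - u)).trans_lt h1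
    have h3 := (Complex.abs_im_le_norm (w - u)).trans_lt h1
    rw [Complex.sub_re, abs_lt] at h2
    rw [Complex.sub_im, abs_lt] at h3
    obtain ⟨k1, k2, k3⟩ := hu
    rw [abs_le] at k1
    rw [← hy] at k1 k2 k3
    refine ⟨?_, ?_, ?_⟩
    · rw [abs_lt]; constructor <;> linarith
    · linarith
    · linarith
  have hzbox : z ∈ box z R θ :=
    ⟨by rw [sub_self, abs_zero]; positivity, hθy, le_rfl⟩
  have hUo : IsOpen U := by
    refine IsOpen.inter ?_ (IsOpen.inter ?_ ?_)
    · exact isOpen_lt (Complex.continuous_re.sub continuous_const).abs continuous_const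
    · exact isOpen_lt continuous_const Complex.continuous_im
    · exact isOpen_lt Complex.continuous_im continuous_const
  have hFd : DifferentiableOn ℂ (fun w => cauchyF A w / (M : ℂ)) U :=
    ((differentiableOn_cauchyF hA).mono hU0).div_const _
  have hn0 : (0 : ℝ) < n := lt_of_lt_of_le (by positivity) hn
  -- A chain of equal steps along the segment from `p` to `z`, which lies in the convex box. Its
  -- length is at most `3Ry`, so `n ≥ 24R/θ` makes each step at most `r`.
  set c : ℕ → ℂ := fun k => p + ((k / n : ℝ)) • (z - p) with hc
  have hcn : c n = z := by
    rw [hc]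
    simp only
    rw [div_self hn0.ne', one_smul]
    ring
  have hc0 : c 0 = p := by simp [hc]
  have key := norm_mul_volume_le_of_chain (F := fun w => cauchyF A w / (M : ℂ)) (g := g) (U := U)
    (r := r) (L := -Real.log ε) hr0 (hFd.analyticOnNhd hUo)
    ((hg.mono hU0).analyticOnNhd hUo) (fun w hw => ?_) (z := c) (n := n) (fun k hk => ?_)
    (fun k hk => ?_) (neg_nonneg.2 (Real.log_nonpos hε.le hε1)) ?_
  · rw [hcn] at key
    have e : ∫ w in ball z r, ‖g w * (cauchyF A w / (M : ℂ))‖ =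
        (∫ w in ball z r, ‖g w * cauchyF A w‖) / M := by
      rw [← integral_div]
      congr 1
      ext w
      rw [← mul_div_assoc, norm_div, Complex.norm_real, Real.norm_of_nonneg hM0.le]
    rw [e, ← mul_div_assoc, le_div_iff₀ hM0] at key
    refine le_trans ?_ key
    have h1 : posP A z ≤ M := le_mul_of_one_le_left hP0 hC2'
    calc ‖g z‖ * posP A z * volume.real (ball z r) =
        ‖g z‖ * volume.real (ball z r) * posP A z := by ring
      _ ≤ ‖g z‖ * volume.real (ball z r) * M := by gcongr
  · rw [norm_div, Complex.norm_real, Real.norm_of_nonneg hM0.le, div_le_one hM0]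
    exact hFU w hw
  · refine hbox _ ((convex_box z R θ).add_smul_sub_mem hp hzbox ⟨by positivity, ?_⟩)
    rw [div_le_one hn0]
    exact_mod_cast hk
  · rw [dist_eq_norm, hc]
    simp only
    have e : p + (((k + 1 : ℕ) : ℝ) / n) • (z - p) - (p + ((k : ℝ) / n) • (z - p)) =
        ((1 / n : ℝ)) • (z - p) := by
      rw [add_sub_add_left_eq_sub, ← sub_smul]
      congr 1
      push_cast
      ring
    rw [e, norm_smul, Real.norm_of_nonneg (by positivity), div_mul_eq_mul_div, one_mul,
      div_le_iff₀ hn0]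
    have h1 : ‖z - p‖ ≤ 3 * R * y := by
      refine (Complex.norm_le_abs_re_add_abs_im _).trans ?_
      rw [Complex.sub_re, Complex.sub_im, abs_sub_comm z.re]
      obtain ⟨k1, k2, k3⟩ := hp
      rw [← hy] at k1 k2 k3
      have : 0 < θ * y := by positivity
      have h2 : |y - p.im| ≤ y := by rw [abs_le]; constructor <;> linarith
      linarith
    refine h1.trans ?_
    rw [div_le_iff₀ hθ] at hn
    rw [hr]
    nlinarith
  · rw [neg_neg, Real.exp_log hε, hc0, norm_div, Complex.norm_real, Real.norm_of_nonneg hM0.le,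
      le_div_iff₀ hM0]
    exact hF

/-- If `F` is small on the box of `z`, then the part of the measure far below `z` has a small `H`
at `z`. -/
theorem posH_below_le_of_small (hA : ∀ᵐ ζ ∂A, 0 ≤ ζ.im) {θ R ε κ : ℝ} (hθ : 0 < θ)
    (hθ1 : θ ≤ 1) (hR : 1 ≤ R) (hκ : 0 < κ) (hκθ : κ ≤ θ) (hκ1 : κ < 1) (hκR : 3 * R * κ ≤ 1 / 2)
    {z : ℂ} (hz : 0 < z.im)
    (hF : ∀ p ∈ box z R θ, ‖cauchyF A p‖ ≤ ε * ((1 + 8 * R / θ) ^ 2 * posP A z))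
    {w : ℂ} (hw : |w.re - z.re| ≤ R * z.im) (hw' : w.im = θ * z.im) :
    posH (A.restrict {ζ | ζ.im ≤ κ * z.im}) z ≤ 3 * θ * posP A w +
      7 * R * ((ε * (1 + 8 * R / θ) ^ 2 + 30 * R * κ) * posP A z +
        (1 + 8 * R / θ) ^ 2 * posP (A.restrict (midSet κ z.im)) z) := by
  set y := z.im with hy
  have hb : MeasurableSet {ζ : ℂ | ζ.im ≤ κ * y} :=
    measurableSet_le Complex.measurable_im measurable_const
  have ha : MeasurableSet {ζ : ℂ | y / κ ≤ ζ.im} :=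
    measurableSet_le measurable_const Complex.measurable_im
  have hres : ∀ S : Set ℂ, ∀ᵐ ζ ∂(A.restrict S), 0 ≤ ζ.im := fun S => ae_restrict_of_ae hA
  have hw0 : 0 < w.im := by rw [hw']; positivity
  have hRy : y ≤ R * y := le_mul_of_one_le_left hz.le hR
  -- On the box `F_below = F - F_mid - F_above`. Here `F` is small by hypothesis, `F_mid` is bounded
  -- by `P` of the mid part, and `F_above` differs from its value at `z` by at most `30Rκ P(z)`. So
  -- `F_below` is compared with the constant `-F_above(z)`.
  have key := posH_le_of_almost_const (A := A.restrict {ζ | ζ.im ≤ κ * y}) (hres _) hz hR hθ hθ1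
    ((ae_restrict_mem hb).mono fun ζ hζ => le_trans hζ (by gcongr))
    (c := -cauchyF (A.restrict {ζ | y / κ ≤ ζ.im}) z)
    (E := (ε * (1 + 8 * R / θ) ^ 2 + 30 * R * κ) * posP A z +
        (1 + 8 * R / θ) ^ 2 * posP (A.restrict (midSet κ y)) z) (fun p hp => ?_) hw hw'
  · refine key.trans ?_
    have := posP_restrict_le hA hw0 {ζ | ζ.im ≤ κ * y}
    gcongr
  · have hp0 : 0 < p.im := (by positivity : 0 < θ * z.im).trans_le hp.2.1
    have hdist : ‖z - p‖ ≤ 3 * R * y := by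
      refine (Complex.norm_le_abs_re_add_abs_im _).trans ?_
      rw [Complex.sub_re, Complex.sub_im, abs_sub_comm z.re]
      obtain ⟨k1, k2, k3⟩ := hp
      rw [← hy] at k1 k2 k3
      have h2 : |z.im - p.im| ≤ y := by rw [abs_le]; constructor <;> linarith
      linarith
    have e := integral_eq_below_add_mid_add_above (integrable_cauchyF hA hp0) hκ hκ1 hz
    have e' : cauchyF (A.restrict {ζ | ζ.im ≤ κ * y}) p -
        -cauchyF (A.restrict {ζ | y / κ ≤ ζ.im}) z =
        cauchyF A p - cauchyF (A.restrict (midSet κ y)) p -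
          (cauchyF (A.restrict {ζ | y / κ ≤ ζ.im}) p -
            cauchyF (A.restrict {ζ | y / κ ≤ ζ.im}) z) := by
      simp only [cauchyF] at e ⊢
      rw [e]
      ring
    rw [e']
    have b1 := hF p hp
    have b2 : ‖cauchyF (A.restrict (midSet κ y)) p‖ ≤
        (1 + 8 * R / θ) ^ 2 * posP (A.restrict (midSet κ y)) z := by
      refine (norm_cauchyF_le _ p).trans (posP_le_mul_posP (hres _) hp0 hz ?_)
      rw [norm_sub_rev]
      refine hdist.trans ?_
      have h1 : y ≤ p.im / θ := by
        rw [le_div_iff₀ hθ, mul_comm]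
        exact hp.2.1
      calc 3 * R * y ≤ 8 * R * (p.im / θ) := by gcongr; norm_num
        _ = 8 * R / θ * p.im := by ring
    have b3 := norm_cauchyF_sub_le (A := A.restrict {ζ | y / κ ≤ ζ.im}) (hres _) hz hp0 hκ
      (ae_restrict_mem ha) hdist (by positivity) hκR
    have b4 := posP_restrict_le hA hz {ζ | y / κ ≤ ζ.im}
    have b5 : 10 * (3 * R * κ) * posP (A.restrict {ζ | y / κ ≤ ζ.im}) z ≤
        30 * R * κ * posP A z := by
      have : 0 ≤ R * κ := by positivity
      nlinarith
    refine (norm_sub_le _ _).trans ((add_le_add_left (norm_sub_le _ _) _).trans ?_)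
    linarith

end Measure

/-- The arithmetic behind the choice of `ε` and `κ` in the dichotomy: each of the two terms
contributes exactly `θ/2`. Here `9 R²` is the Harnack factor between `z` and the points of the lower
line within `R Im z`. -/
theorem seven_mul_eq {θ R c P : ℝ} (hR : R ≠ 0) (hc : c ≠ 0) :
    7 * R * ((θ / (126 * R ^ 3 * c) * c + 30 * R * (θ / (3780 * R ^ 4))) * (9 * R ^ 2 * P)) =
      θ * P := by
  field_simp
  ring

theorem seven_mul_le {R c P Q Q' K : ℝ} (hR : 0 ≤ R) (hc : 0 ≤ c) (hP : P ≤ 9 * R ^ 2 * Q)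
    (hQ : 0 ≤ Q) (hQ' : Q' = Q) (hK : 63 * R ^ 3 * c ≤ K) : 7 * R * (c * P) ≤ K * Q' := by
  subst hQ'
  calc 7 * R * (c * P) ≤ 7 * R * (c * (9 * R ^ 2 * Q')) := by gcongr
    _ = 63 * R ^ 3 * c * Q' := by ring
    _ ≤ _ := by gcongr

set_option maxHeartbeats 1000000 in
/-- Either `F` may be divided out of the sub-mean value property of `g F` at `z`, or the part of
the measure far below `z` has a small `H` at `z`. -/
theorem large_or_small {θ : ℝ} (hθ : 0 < θ) (hθ1 : θ ≤ 1 / 4) : ∃ κ, 0 < κ ∧ κ ≤ θ ∧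
    ∃ C, 0 ≤ C ∧ ∀ (A : Measure ℂ) [IsFiniteMeasure A], (∀ᵐ ζ ∂A, 0 ≤ ζ.im) →
      ∀ g : ℂ → ℂ, DifferentiableOn ℂ g {w | 0 < w.im} → ∀ z : ℂ, 0 < z.im →
      (‖g z‖ * posP A z * volume.real (ball z (θ * z.im / 8)) ≤
        C * ∫ w in ball z (θ * z.im / 8), ‖g w * cauchyF A w‖) ∨
      ∀ x : ℝ, posH (A.restrict {ζ | ζ.im ≤ κ * z.im}) z ≤
        9 * θ * (1 + |x| / z.im) ^ 3 * posP A ((z.re + x : ℝ) + (θ * z.im : ℝ) * Complex.I) +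
        C * posP (A.restrict (midSet κ z.im)) ((z.re + x : ℝ) + (θ * z.im : ℝ) * Complex.I) := by
  -- With this width the box argument serves `|x| ≤ R Im z`, while for larger `|x|` the factor `1 +
  -- |x| / Im z` already compensates for `θ`.
  set R := 1 / θ with hRd
  have hR : 4 ≤ R := by rw [hRd, le_div_iff₀ hθ]; linarith
  have hθR : θ * R = 1 := by rw [hRd]; field_simp
  set C2 := (1 + 8 * R / θ) ^ 2 with hC2
  have hC2' : 1 ≤ C2 := one_le_pow₀ (le_add_of_nonneg_right (by positivity))
  set ε := θ / (126 * R ^ 3 * C2) with hε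
  set κ := θ / (3780 * R ^ 4) with hκ
  have hR0 : 0 < R := by linarith
  have hε0 : 0 < ε := by positivity
  have hR3 : 1 ≤ R ^ 3 := one_le_pow₀ (by linarith)
  have hR4 : 1 ≤ R ^ 4 := one_le_pow₀ (by linarith)
  have hε1 : ε ≤ 1 := by
    rw [hε, div_le_one (by positivity)]
    nlinarith [mul_le_mul hR3 hC2' zero_le_one (by positivity)]
  have hκ0 : 0 < κ := by positivity
  have hκθ : κ ≤ θ := div_le_self hθ.le (by linarith)
  have hκR : 3 * R * κ ≤ 1 / 2 := by
    have : R * κ ≤ R * θ := by gcongr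
    have h2 : R * κ = 1 / (3780 * R ^ 4) := by
      rw [hκ, mul_div_assoc', mul_comm R θ, hθR]
    have h3 : 1 / (3780 * R ^ 4) ≤ 1 / 6 :=
      one_div_le_one_div_of_le (by norm_num) (by linarith)
    linarith
  obtain ⟨n, hn⟩ := exists_nat_ge (24 * R / θ)
  refine ⟨κ, hκ0, hκθ, max (Real.exp (9 ^ (n + 1) * -Real.log ε)) (63 * R ^ 3 * C2),
    le_max_of_le_left (Real.exp_nonneg _), fun A _ hA g hg z hz => ?_⟩
  -- The dichotomy: `F` is comparable with `P(z)` somewhere on the box, or small on all of it.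
  by_cases hcase : ∃ p ∈ box z R θ, ε * (C2 * posP A z) ≤ ‖cauchyF A p‖
  · obtain ⟨p, hp, hpF⟩ := hcase
    left
    refine (norm_mul_posP_le_of_large hA hθ (by linarith) (by linarith) hε0 hε1 hg hz hp hpF
      hn).trans ?_
    exact mul_le_mul_of_nonneg_right (le_max_left _ _) (integral_nonneg fun _ => norm_nonneg _)
  · right
    push Not at hcase
    intro x
    set w : ℂ := (z.re + x : ℝ) + (θ * z.im : ℝ) * Complex.I with hw
    have hwre : w.re = z.re + x := by simp [hw]
    have hwim : w.im = θ * z.im := by simp [hw]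
    have hw0 : 0 < w.im := by rw [hwim]; positivity
    set ω := |x| / z.im with hω
    have hω0 : 0 ≤ ω := by positivity
    have hzw : ‖z - w‖ ≤ (1 + ω) * z.im := by
      refine (Complex.norm_le_abs_re_add_abs_im _).trans ?_
      rw [Complex.sub_re, Complex.sub_im, hwre, hwim]
      have h1 : |z.re - (z.re + x)| = ω * z.im := by
        rw [sub_add_cancel_left, abs_neg, hω]
        field_simp
      have h2 : |z.im - θ * z.im| ≤ z.im := by
        have : 0 < θ * z.im := by positivity
        rw [abs_le]
        constructor <;> nlinarith
      linarith
    have hPzw : ∀ (A' : Measure ℂ) [IsFiniteMeasure A'], (∀ᵐ ζ ∂A', 0 ≤ ζ.im) →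
        posP A' z ≤ (2 + ω) ^ 2 * posP A' w := by
      intro A' _ hA'
      have := posP_le_mul_posP hA' hz hw0 hzw
      rwa [← add_assoc, one_add_one_eq_two] at this
    have hP := posP_nonneg A w
    have hPm := posP_nonneg (A.restrict (midSet κ z.im)) w
    have hPm' := posP_nonneg (A.restrict (midSet κ z.im)) z
    have hPz := posP_nonneg A z
    have hC1 : 63 * R ^ 3 * C2 ≤ max (Real.exp (9 ^ (n + 1) * -Real.log ε)) (63 * R ^ 3 * C2) :=
      le_max_right _ _
    rcases le_or_gt ω R with h | h
    · have hxle : |w.re - z.re| ≤ R * z.im := by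
        rw [hwre, add_sub_cancel_left]
        rwa [hω, div_le_iff₀ hz] at h
      have key := posH_below_le_of_small hA hθ (by linarith) (by linarith : (1 : ℝ) ≤ R) hκ0 hκθ
        (by linarith) hκR hz (fun p hp => (hcase p hp).le) hxle hwim
      have h1 := hPzw A hA
      have h2 := hPzw (A.restrict (midSet κ z.im)) (ae_restrict_of_ae hA)
      have h3 : (2 + ω) ^ 2 ≤ 9 * R ^ 2 := by
        have : 2 + ω ≤ 3 * R := by linarith
        calc (2 + ω) ^ 2 ≤ (3 * R) ^ 2 := by gcongr
          _ = 9 * R ^ 2 := by ring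
      have h4 : posP A z ≤ 9 * R ^ 2 * posP A w := h1.trans (by gcongr)
      have h5 : posP (A.restrict (midSet κ z.im)) z ≤
        9 * R ^ 2 * posP (A.restrict (midSet κ z.im)) w := h2.trans (by gcongr)
      have e1 : 7 * R * ((ε * C2 + 30 * R * κ) * (9 * R ^ 2 * posP A w)) = θ * posP A w := by
        exact seven_mul_eq hR0.ne' (by positivity)
      refine key.trans ?_
      have h6 : 7 * R * ((ε * C2 + 30 * R * κ) * posP A z) ≤ θ * posP A w := by
        rw [← e1]
        refine mul_le_mul_of_nonneg_left (mul_le_mul_of_nonneg_left h4 ?_) (by positivity)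
        positivity
      have h7 := seven_mul_le hR0.le (zero_le_one.trans hC2') h5 hPm rfl hC1
      have h8 : 4 * θ * posP A w ≤ 9 * θ * (1 + ω) ^ 3 * posP A w := by
        have : 1 ≤ (1 + ω) ^ 3 := one_le_pow₀ (by linarith)
        have h9 : 4 * θ ≤ 9 * θ * (1 + ω) ^ 3 := by nlinarith
        gcongr
      linarith
    · have h1 : posH (A.restrict {ζ | ζ.im ≤ κ * z.im}) z ≤ (2 + ω) ^ 2 * posP A w :=
        ((posH_restrict_le hA hz _).trans (posH_le_posP hA hz)).trans (hPzw A hA)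
      -- Far out on the line, `θω ≥ 1` turns the trivial Harnack bound into one with a factor `θ`,
      -- at the price of one more power of `1 + ω`.
      have h2 : (2 + ω) ^ 2 ≤ 9 * θ * (1 + ω) ^ 3 := by
        have h3 : 1 ≤ θ * ω := by rw [← hθR]; gcongr
        have h4 : 2 + ω ≤ 3 * (1 + ω) := by linarith
        calc (2 + ω) ^ 2 ≤ (3 * (1 + ω)) ^ 2 := by gcongr
          _ = 9 * (1 + ω) ^ 2 * 1 := by ring
          _ ≤ 9 * (1 + ω) ^ 2 * (θ * (1 + ω)) := by gcongr; nlinarith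
          _ = 9 * θ * (1 + ω) ^ 3 := by ring
      refine h1.trans ?_
      have h3 : (2 + ω) ^ 2 * posP A w ≤ 9 * θ * (1 + ω) ^ 3 * posP A w := by gcongr
      have h4 : 0 ≤ max (Real.exp (9 ^ (n + 1) * -Real.log ε)) (63 * R ^ 3 * C2) *
        posP (A.restrict (midSet κ z.im)) w := by
          refine mul_nonneg (le_max_of_le_left (Real.exp_nonneg _)) hPm
      linarith

/-! ### Cauchy–Schwarz, Schur's test and Fatou's lemma -/

section General

variable {α : Type*} [MeasurableSpace α] {μ : Measure α}

theorem sq_lintegral_mul_le {u v : α → ℝ≥0∞} (hu : AEMeasurable u μ) (hv : AEMeasurable v μ) :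
    (∫⁻ x, u x * v x ∂μ) ^ 2 ≤ (∫⁻ x, u x ^ 2 ∂μ) * ∫⁻ x, v x ^ 2 ∂μ := by
  have h := ENNReal.lintegral_mul_le_Lp_mul_Lq μ (p := 2) (q := 2)
    (Real.HolderConjugate.two_two) hu hv
  have e : ∀ x : ℝ≥0∞, (x ^ (1 / 2 : ℝ)) ^ 2 = x := by
    intro x
    rw [← ENNReal.rpow_natCast, ← ENNReal.rpow_mul]
    norm_num
  refine (pow_le_pow_left' h 2).trans (le_of_eq ?_)
  rw [mul_pow, e, e]
  simp only [ENNReal.rpow_ofNat]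

theorem sq_lintegral_mul_le_weight {w φ : α → ℝ≥0∞} (hw : Measurable w) (hφ : Measurable φ) :
    (∫⁻ x, w x * φ x ∂μ) ^ 2 ≤ (∫⁻ x, w x ∂μ) * ∫⁻ x, w x * φ x ^ 2 ∂μ := by
  have h := sq_lintegral_mul_le (μ := μ.withDensity w) (u := fun _ => 1) (v := φ)
    aemeasurable_const hφ.aemeasurable
  simp only [one_mul, one_pow] at h
  rw [lintegral_withDensity_eq_lintegral_mul _ hw hφ,
    lintegral_withDensity_eq_lintegral_mul _ hw (hφ.pow_const 2), lintegral_const,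
    withDensity_apply _ MeasurableSet.univ, Measure.restrict_univ, one_mul] at h
  exact h

/-- Schur's test for a positive kernel. -/
theorem schur_test {k : α → α → ℝ≥0∞} [SFinite μ] (hk : Measurable (Function.uncurry k))
    {c d : ℝ≥0∞} {a : α → ℝ≥0∞} (ha : Measurable a)
    (hrow : ∀ᵐ x ∂μ, ∫⁻ y, k x y ∂μ ≤ c) (hcol : ∀ᵐ y ∂μ, ∫⁻ x, k x y ∂μ ≤ d) :
    ∫⁻ x, (∫⁻ y, k x y * a y ∂μ) ^ 2 ∂μ ≤ c * d * ∫⁻ y, a y ^ 2 ∂μ := by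
  have hk1 : ∀ x, Measurable (k x) := fun x => hk.of_uncurry_left
  calc ∫⁻ x, (∫⁻ y, k x y * a y ∂μ) ^ 2 ∂μ ≤ ∫⁻ x, c * ∫⁻ y, k x y * a y ^ 2 ∂μ ∂μ := by
        refine lintegral_mono_ae ?_
        filter_upwards [hrow] with x hx
        exact (sq_lintegral_mul_le_weight (hk1 x) ha).trans (mul_le_mul_left hx _)
    _ = c * ∫⁻ y, (∫⁻ x, k x y ∂μ) * a y ^ 2 ∂μ := by
        have hm : Measurable (Function.uncurry fun x y => k x y * a y ^ 2) :=
          hk.mul ((ha.comp measurable_snd).pow_const 2)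
        rw [lintegral_const_mul _ (Measurable.lintegral_prod_right hm),
          lintegral_lintegral_swap hm.aemeasurable]
        congr 1
        refine lintegral_congr fun y => ?_
        rw [lintegral_mul_const _ hk.of_uncurry_right]
    _ ≤ c * ∫⁻ y, d * a y ^ 2 ∂μ := by
        refine mul_le_mul_right (lintegral_mono_ae ?_) _
        filter_upwards [hcol] with y hy
        exact mul_le_mul_left hy _
    _ = c * d * ∫⁻ y, a y ^ 2 ∂μ := by
        rw [lintegral_const_mul _ (ha.pow_const 2), mul_assoc]

theorem lintegral_le_of_tendsto {F : ℕ → α → ℝ≥0∞} {G : α → ℝ≥0∞} {c : ℝ≥0∞}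
    (hF : ∀ n, AEMeasurable (F n) μ) (hlim : ∀ᵐ x ∂μ, Tendsto (fun n => F n x) atTop (𝓝 (G x)))
    (hc : ∀ n, ∫⁻ x, F n x ∂μ ≤ c) : ∫⁻ x, G x ∂μ ≤ c := by
  calc ∫⁻ x, G x ∂μ = ∫⁻ x, liminf (fun n => F n x) atTop ∂μ :=
        lintegral_congr_ae (hlim.mono fun x hx => hx.liminf_eq.symm)
    _ ≤ liminf (fun n => ∫⁻ x, F n x ∂μ) atTop := lintegral_liminf_le' hF
    _ ≤ c := by
        refine (liminf_le_liminf (Eventually.of_forall hc)).trans ?_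
        rw [liminf_const]

end General

/-! ### Test densities, bounds for positive kernels and their duality -/

/-- The open upper half plane. -/
def upper : Set ℂ := {z | 0 < z.im}

theorem measurableSet_upper : MeasurableSet upper :=
  measurableSet_lt measurable_const Complex.measurable_im

theorem measurableSet_le_im (ε : ℝ) : MeasurableSet {z : ℂ | ε ≤ z.im} :=
  measurableSet_le measurable_const Complex.measurable_im

/-- Bounded measurable densities, compactly supported in the upper half plane. -/
structure IsTest (ε : ℝ) (a : ℂ → ℝ≥0) : Prop where
  meas : Measurable a
  bdd : ∃ N, ∀ ζ, a ζ ≤ N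
  supp : ∃ R : ℝ, ∀ ζ, a ζ ≠ 0 → ε ≤ ζ.im ∧ ‖ζ‖ ≤ R

theorem IsTest.mono {ε ε' : ℝ} {a b : ℂ → ℝ≥0} (h : IsTest ε a) (hb : Measurable b)
    (hab : ∀ ζ, b ζ ≤ a ζ) (hε : ε' ≤ ε) : IsTest ε' b := by
  obtain ⟨N, hN⟩ := h.bdd
  obtain ⟨R, hR⟩ := h.supp
  refine ⟨hb, ⟨N, fun ζ => (hab ζ).trans (hN ζ)⟩, R, fun ζ hζ => ?_⟩
  have := hR ζ (fun h0 => hζ (le_antisymm (h0 ▸ hab ζ) bot_le))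
  exact ⟨hε.trans this.1, this.2⟩

theorem IsTest.indicator {ε : ℝ} {a : ℂ → ℝ≥0} (h : IsTest ε a) {S : Set ℂ}
    (hS : MeasurableSet S) : IsTest ε (S.indicator a) :=
  h.mono (h.meas.indicator hS) (fun ζ => indicator_le_self' (fun _ _ => bot_le) ζ) le_rfl

theorem volume_support_lt_top (R : ℝ) : volume {ζ : ℂ | ‖ζ‖ ≤ R} < ∞ := by
  have : {ζ : ℂ | ‖ζ‖ ≤ R} = closedBall 0 R := by ext; simp
  rw [this]
  exact measure_closedBall_lt_top

theorem IsTest.lintegral_sq_lt_top {ε : ℝ} {a : ℂ → ℝ≥0} (h : IsTest ε a) :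
    ∫⁻ ζ, (a ζ : ℝ≥0∞) ^ 2 < ∞ := by
  obtain ⟨N, hN⟩ := h.bdd
  obtain ⟨R, hR⟩ := h.supp
  calc ∫⁻ ζ, (a ζ : ℝ≥0∞) ^ 2 ≤ ∫⁻ ζ, {ζ : ℂ | ‖ζ‖ ≤ R}.indicator (fun _ => (N : ℝ≥0∞) ^ 2) ζ := by
        refine lintegral_mono fun ζ => ?_
        by_cases h0 : a ζ = 0
        · simp [h0]
        · have h1 : ζ ∈ {ζ : ℂ | ‖ζ‖ ≤ R} := (hR ζ h0).2
          rw [indicator_of_mem h1]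
          gcongr
          exact hN ζ
    _ = N ^ 2 * volume {ζ : ℂ | ‖ζ‖ ≤ R} := by
        rw [lintegral_indicator_const]
        exact measurableSet_le measurable_norm measurable_const
    _ < ∞ := ENNReal.mul_lt_top (by finiteness) (volume_support_lt_top R)

/-- The positive integral operator with kernel `K` is bounded on `L²({Im z ≥ ε})`. -/
def KerBound (ε : ℝ) (K : ℂ → ℂ → ℝ≥0∞) (t : ℝ≥0∞) : Prop :=
  ∀ a, IsTest ε a → ∫⁻ z in {z : ℂ | ε ≤ z.im}, (∫⁻ ζ, K z ζ * a ζ) ^ 2 ≤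
    t * ∫⁻ ζ, (a ζ : ℝ≥0∞) ^ 2

/-- Closes the duality arguments: `x` is the squared norm of a truncated function, finite by
construction, so it may be cancelled. -/
theorem le_of_sq_le_mul {x t y : ℝ≥0∞} (hx : x ≠ ∞) (h : x ^ 2 ≤ t * (x * y)) : x ≤ t * y := by
  rcases eq_or_ne x 0 with h0 | h0
  · simp [h0]
  · rw [sq, ← mul_assoc, mul_comm t x, mul_assoc] at h
    exact (ENNReal.mul_le_mul_iff_right h0 hx).1 h

/-- Duality for positive kernels. -/
theorem KerBound.swap {ε : ℝ} {K : ℂ → ℂ → ℝ≥0∞} {t : ℝ≥0∞}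
    (hK : Measurable (Function.uncurry K)) (h : KerBound ε K t) :
    KerBound ε (fun z ζ => K ζ z) t := by
  intro b hb
  set v : ℂ → ℝ≥0∞ := fun z => ∫⁻ ζ, K ζ z * b ζ with hv
  have hbm : Measurable fun ζ => (b ζ : ℝ≥0∞) := hb.meas.coe_nnreal_ennreal
  have hKb : Measurable (Function.uncurry fun z ζ => K ζ z * b ζ) :=
    (hK.comp measurable_swap).mul (hbm.comp measurable_snd)
  have hvm : Measurable v := Measurable.lintegral_prod_right hKb
  -- truncations of `v`
  set S : ℕ → Set ℂ := fun n => {z | ε ≤ z.im ∧ ‖z‖ ≤ n} with hS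
  have hSm : ∀ n, MeasurableSet (S n) := fun n =>
    (measurableSet_le_im ε).inter (measurableSet_le measurable_norm measurable_const)
  set a : ℕ → ℂ → ℝ≥0 := fun n => (S n).indicator fun z => (min (v z) n).toNNReal with ha
  have hat : ∀ n, IsTest ε (a n) := by
    intro n
    refine ⟨((hvm.min measurable_const).ennreal_toNNReal).indicator (hSm n), ⟨n, fun ζ => ?_⟩,
      n, fun ζ hζ => ?_⟩
    · refine indicator_apply_le' (fun z => ?_) (fun _ => bot_le)
      rw [← ENNReal.coe_le_coe, ENNReal.coe_toNNReal, ENNReal.coe_natCast]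
      · exact min_le_right _ _
      · exact ne_top_of_le_ne_top (ENNReal.natCast_ne_top n) (min_le_right _ _)
    · have h1 : ζ ∈ S n := mem_of_indicator_ne_zero hζ
      exact h1
  have hac : ∀ n z, (a n z : ℝ≥0∞) = (S n).indicator (fun z => min (v z) n) z := by
    intro n z
    by_cases hz : z ∈ S n
    · simp only [ha, indicator_of_mem hz]
      rw [ENNReal.coe_toNNReal]
      exact ne_top_of_le_ne_top (ENNReal.natCast_ne_top n) (min_le_right _ _)
    · simp only [ha, indicator_of_notMem hz, ENNReal.coe_zero]
  have hav : ∀ n z, (a n z : ℝ≥0∞) ≤ v z := by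
    intro n z
    rw [hac]
    exact indicator_le' (fun _ _ => min_le_left _ _) (fun _ _ => bot_le) z
  -- Testing against the truncation `a n ≤ v`: `∫ a² ≤ ∫ a v = ∫ b (K a)`, and Cauchy–Schwarz with
  -- the bound for `K` leaves a factor `∫ a²` to cancel.
  have hbound : ∀ n, ∫⁻ z, (a n z : ℝ≥0∞) ^ 2 ≤ t * ∫⁻ ζ, (b ζ : ℝ≥0∞) ^ 2 := by
    intro n
    have ham : Measurable fun ζ => (a n ζ : ℝ≥0∞) := (hat n).meas.coe_nnreal_ennreal
    refine le_of_sq_le_mul (hat n).lintegral_sq_lt_top.ne ?_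
    have e : ∫⁻ z, (a n z : ℝ≥0∞) * v z =
        ∫⁻ ζ in {z : ℂ | ε ≤ z.im}, b ζ * ∫⁻ z, K ζ z * a n z := by
      have e1 : ∫⁻ z, (a n z : ℝ≥0∞) * v z = ∫⁻ z, ∫⁻ ζ, b ζ * (K ζ z * a n z) := by
        refine lintegral_congr fun z => ?_
        rw [hv, ← lintegral_const_mul _ hKb.of_uncurry_left]
        refine lintegral_congr fun ζ => ?_
        ring
      have hKa : Measurable (Function.uncurry fun ζ z => K ζ z * a n z) :=
        hK.mul (ham.comp measurable_snd)
      have hm : Measurable (Function.uncurry fun z ζ => (b ζ : ℝ≥0∞) * (K ζ z * a n z)) :=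
        (hbm.comp measurable_snd).mul (hKa.comp measurable_swap)
      rw [e1, lintegral_lintegral_swap hm.aemeasurable, ← lintegral_indicator
        (measurableSet_le_im ε)]
      refine lintegral_congr fun ζ => ?_
      rw [lintegral_const_mul _ hKa.of_uncurry_left]
      by_cases hζ : ζ ∈ {z : ℂ | ε ≤ z.im}
      · rw [indicator_of_mem hζ]
      · rw [indicator_of_notMem hζ]
        have : b ζ = 0 := by
          by_contra h0
          obtain ⟨R, hR⟩ := hb.supp
          exact hζ (hR ζ h0).1
        rw [this, ENNReal.coe_zero, zero_mul]
    calc (∫⁻ z, (a n z : ℝ≥0∞) ^ 2) ^ 2 ≤ (∫⁻ z, (a n z : ℝ≥0∞) * v z) ^ 2 := by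
          gcongr with z
          rw [sq]
          gcongr
          exact hav n z
      _ ≤ (∫⁻ ζ in {z : ℂ | ε ≤ z.im}, (b ζ : ℝ≥0∞) ^ 2) *
          ∫⁻ ζ in {z : ℂ | ε ≤ z.im}, (∫⁻ z, K ζ z * a n z) ^ 2 := by
          rw [e]
          refine sq_lintegral_mul_le hbm.aemeasurable ?_
          exact (Measurable.lintegral_prod_right (hK.mul (ham.comp measurable_snd))).aemeasurable
      _ ≤ (∫⁻ ζ, (b ζ : ℝ≥0∞) ^ 2) * (t * ∫⁻ z, (a n z : ℝ≥0∞) ^ 2) :=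
          mul_le_mul' (setLIntegral_le_lintegral _ _) (h _ (hat n))
      _ = _ := by ring
  refine lintegral_le_of_tendsto (F := fun n z => (a n z : ℝ≥0∞) ^ 2)
    (fun n => (((hat n).meas.coe_nnreal_ennreal).pow_const 2).aemeasurable) ?_
    (fun n => (setLIntegral_le_lintegral _ _).trans (hbound n))
  filter_upwards [ae_restrict_mem (measurableSet_le_im ε)] with z hz
  refine ENNReal.Tendsto.pow ?_
  have h1 : Tendsto (fun n : ℕ => min (v z) (n : ℝ≥0∞)) atTop (𝓝 (min (v z) ∞)) :=
    tendsto_const_nhds.min ENNReal.tendsto_nat_nhds_top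
  rw [min_eq_left le_top] at h1
  refine h1.congr' ?_
  obtain ⟨n, hn⟩ := exists_nat_ge ‖z‖
  filter_upwards [eventually_ge_atTop n] with m hm
  rw [hac, indicator_of_mem]
  exact ⟨hz, hn.trans (by exact_mod_cast hm)⟩

/-! ### The mean value property for area integrals -/

theorem polar_eq_circleMap (z : ℂ) (ρ θ : ℝ) :
    z + ρ * (Real.cos θ + Real.sin θ * Complex.I) = circleMap z ρ θ := by
  rw [circleMap, Complex.exp_mul_I, Complex.ofReal_cos, Complex.ofReal_sin]

theorem setIntegral_ball_eq {h : ℂ → ℂ} {z : ℂ} {r : ℝ} (hc : ContinuousOn h (closedBall z r)) :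
    ∫ w in ball z r, h w =
      ∫ ρ in Ioo 0 r, (2 * Real.pi * ρ : ℝ) • Real.circleAverage h z ρ := by
  classical
  set G : ℂ → ℂ := (ball z r).indicator h with hG
  have hGm : Measurable G := by
    rw [hG, ← piecewise_eq_indicator]
    exact (hc.mono ball_subset_closedBall).measurable_piecewise continuous_zero.continuousOn
      measurableSet_ball
  obtain ⟨K, hK⟩ := (isCompact_closedBall z r).exists_bound_of_continuousOn hc
  have hGb : ∀ w, ‖G w‖ ≤ max K 0 := by
    intro w
    by_cases hw : w ∈ ball z r
    · rw [hG, indicator_of_mem hw]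
      exact (hK w (ball_subset_closedBall hw)).trans (le_max_left _ _)
    · rw [hG, indicator_of_notMem hw, norm_zero]
      exact le_max_right _ _
  have hmem : ∀ ρ : ℝ, 0 < ρ → ∀ θ : ℝ, circleMap z ρ θ ∈ ball z r ↔ ρ < r := by
    intro ρ hρ0 θ
    rw [mem_ball, dist_eq_norm, circleMap_sub_center, norm_circleMap_zero, abs_of_pos hρ0]
  have e1 : ∫ w in ball z r, h w = ∫ w, G (z + w) := by
    rw [integral_add_left_eq_self, hG, integral_indicator measurableSet_ball]
  have hm : Measurable fun p : ℝ × ℝ => p.1 • G (circleMap z p.1 p.2) := by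
    refine measurable_fst.smul (hGm.comp ?_)
    simp only [circleMap]
    fun_prop
  have hsupp : ∀ p ∈ Ioi (0 : ℝ) ×ˢ Ioo (-Real.pi) Real.pi,
      p.1 • G (circleMap z p.1 p.2) =
        (Ioo 0 r ×ˢ Ioo (-Real.pi) Real.pi).indicator
          (fun p : ℝ × ℝ => p.1 • G (circleMap z p.1 p.2)) p := by
    intro p hp
    by_cases h1 : p.1 < r
    · rw [indicator_of_mem]
      exact ⟨⟨hp.1, h1⟩, hp.2⟩
    · rw [indicator_of_notMem (fun h2 => h1 h2.1.2), hG, indicator_of_notMem, smul_zero]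
      exact fun h2 => h1 ((hmem _ hp.1 _).1 h2)
  have hint : IntegrableOn (fun p : ℝ × ℝ => p.1 • G (circleMap z p.1 p.2))
      (Ioo 0 r ×ˢ Ioo (-Real.pi) Real.pi) (volume.prod volume) := by
    refine Measure.integrableOn_of_bounded (M := r * max K 0) ?_ hm.aestronglyMeasurable ?_
    · rw [Measure.prod_prod]
      exact (ENNReal.mul_lt_top measure_Ioo_lt_top measure_Ioo_lt_top).ne
    · filter_upwards [ae_restrict_mem (measurableSet_Ioo.prod measurableSet_Ioo)] with p hp
      rw [norm_smul, Real.norm_of_nonneg hp.1.1.le]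
      exact mul_le_mul hp.1.2.le (hGb _) (norm_nonneg _) (hp.1.1.trans hp.1.2).le
  rw [e1, ← Complex.integral_comp_polarCoord_symm, polarCoord_target]
  simp only [Complex.polarCoord_symm_apply, polar_eq_circleMap]
  rw [setIntegral_congr_fun (measurableSet_Ioi.prod measurableSet_Ioo) hsupp,
    setIntegral_indicator (measurableSet_Ioo.prod measurableSet_Ioo), Set.prod_inter_prod,
    inter_self, inter_eq_right.2 Ioo_subset_Ioi_self, Measure.volume_eq_prod,
    setIntegral_prod _ hint]
  refine setIntegral_congr_fun measurableSet_Ioo fun ρ hρ => ?_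
  have hper : Function.Periodic (fun θ : ℝ => h (circleMap z ρ θ)) (2 * Real.pi) := by
    intro θ
    simp only [periodic_circleMap z ρ θ]
  have h2 := hper.intervalIntegral_add_eq (-Real.pi) 0
  have e2 : -Real.pi + 2 * Real.pi = Real.pi := by ring
  rw [e2, zero_add] at h2
  simp only [hG, indicator_of_mem ((hmem ρ hρ.1 _).2 hρ.2)]
  rw [integral_smul, ← integral_Ioc_eq_integral_Ioo,
    ← intervalIntegral.integral_of_le (by linarith [Real.pi_pos]), h2, Real.circleAverage,
    smul_smul]
  congr 1
  have := Real.pi_pos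
  field_simp

/-- The mean value property over discs. -/
theorem setIntegral_ball_eq_of_differentiableOn {h : ℂ → ℂ} {z : ℂ} {r : ℝ} (hr : 0 ≤ r)
    {U : Set ℂ} (hU : closedBall z r ⊆ U) (hh : DifferentiableOn ℂ h U) :
    ∫ w in ball z r, h w = volume.real (ball z r) • h z := by
  have hc : ContinuousOn h (closedBall z r) := (hh.mono hU).continuousOn
  have key : ∫ w in ball z r, h w = ∫ ρ in Ioo 0 r, (2 * Real.pi * ρ : ℝ) • h z := by
    rw [setIntegral_ball_eq hc]
    refine setIntegral_congr_fun measurableSet_Ioo fun ρ hρ => ?_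
    have hd : DiffContOnCl ℂ h (ball z |ρ|) := by
      refine (hh.mono ?_).diffContOnCl
      refine Subset.trans closure_ball_subset_closedBall (Subset.trans ?_ hU)
      rw [abs_of_pos hρ.1]
      exact closedBall_subset_closedBall hρ.2.le
    simp only [hd.circleAverage]
  rw [key, integral_smul_const]
  congr 1
  rw [← integral_Ioc_eq_integral_Ioo, ← intervalIntegral.integral_of_le hr,
    intervalIntegral.integral_const_mul, integral_id, measureReal_def, Complex.volume_ball]
  simp
  rw [ENNReal.toReal_ofReal hr]
  ring

/-! ### Weighted measures and the identity relating `P`, `F` and `H` -/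

/-- The measure `‖f‖ a dζ`. -/
def wt (f : ℂ → ℂ) (a : ℂ → ℝ≥0) : Measure ℂ :=
  volume.withDensity fun ζ => ((‖f ζ‖₊ * a ζ : ℝ≥0) : ℝ≥0∞)

/-- The kernel `1 / ‖z - conj ζ‖²`. -/
def kerP (z ζ : ℂ) : ℝ≥0∞ := ENNReal.ofReal (1 / ‖z - conj ζ‖ ^ 2)

/-- The kernel `(Im z + Im ζ)² / ‖z - conj ζ‖⁴`. -/
def kerH (z ζ : ℂ) : ℝ≥0∞ := ENNReal.ofReal ((z.im + ζ.im) ^ 2 / ‖z - conj ζ‖ ^ 4)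

theorem kerP_comm (z ζ : ℂ) : kerP z ζ = kerP ζ z := by
  rw [kerP, kerP, norm_sub_conj_comm]

theorem kerH_comm (z ζ : ℂ) : kerH z ζ = kerH ζ z := by
  rw [kerH, kerH, norm_sub_conj_comm, add_comm]

theorem measurable_norm_sub_conj : Measurable fun p : ℂ × ℂ => ‖p.1 - conj p.2‖ :=
  (measurable_fst.sub (Complex.continuous_conj.measurable.comp measurable_snd)).norm

theorem measurable_kerP : Measurable (Function.uncurry kerP) :=
  ENNReal.measurable_ofReal.comp (measurable_const.div (measurable_norm_sub_conj.pow_const 2))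

theorem measurable_kerH : Measurable (Function.uncurry kerH) := by
  refine ENNReal.measurable_ofReal.comp (Measurable.div ?_ (measurable_norm_sub_conj.pow_const 4))
  exact ((Complex.measurable_im.comp measurable_fst).add
    (Complex.measurable_im.comp measurable_snd)).pow_const 2

theorem kerH_le_kerP {z ζ : ℂ} (hz : 0 ≤ z.im) (hζ : 0 ≤ ζ.im) : kerH z ζ ≤ kerP z ζ := by
  refine ENNReal.ofReal_le_ofReal ?_
  rcases eq_or_ne ‖z - conj ζ‖ 0 with h | h
  · simp [h]
  · have h1 := im_add_im_le_norm (z := z) (ζ := ζ)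
    have h2 : 0 < ‖z - conj ζ‖ := lt_of_le_of_ne (norm_nonneg _) h.symm
    rw [div_le_div_iff₀ (by positivity) (by positivity)]
    have h3 : (z.im + ζ.im) ^ 2 ≤ ‖z - conj ζ‖ ^ 2 := by gcongr
    calc (z.im + ζ.im) ^ 2 * ‖z - conj ζ‖ ^ 2 ≤ ‖z - conj ζ‖ ^ 2 * ‖z - conj ζ‖ ^ 2 := by gcongr
      _ = 1 * ‖z - conj ζ‖ ^ 4 := by ring

section Weighted

variable {f : ℂ → ℂ} {a : ℂ → ℝ≥0} {ε : ℝ}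

theorem measurable_density (hf : Measurable f) (ha : Measurable a) :
    Measurable fun ζ => (‖f ζ‖₊ * a ζ : ℝ≥0) :=
  hf.nnnorm.mul ha

theorem wt_restrict (f : ℂ → ℂ) (a : ℂ → ℝ≥0) {S : Set ℂ} (hS : MeasurableSet S) :
    (wt f a).restrict S = wt f (S.indicator a) := by
  rw [wt, restrict_withDensity hS, ← withDensity_indicator hS, wt]
  congr 1
  ext ζ
  by_cases h : ζ ∈ S <;> simp [h]

theorem wt_ae (hf : Measurable f) (ha : IsTest ε a) : ∀ᵐ ζ ∂(wt f a), ε ≤ ζ.im := by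
  rw [wt, ae_withDensity_iff (measurable_density hf ha.meas).coe_nnreal_ennreal]
  refine Eventually.of_forall fun ζ h => ?_
  obtain ⟨R, hR⟩ := ha.supp
  refine (hR ζ fun h0 => h ?_).1
  simp [h0]

theorem wt_ae_nonneg (hf : Measurable f) (ha : IsTest ε a) (hε : 0 ≤ ε) :
    ∀ᵐ ζ ∂(wt f a), 0 ≤ ζ.im :=
  (wt_ae hf ha).mono fun _ h => hε.trans h

theorem isCompact_supp (ε R : ℝ) : IsCompact {ζ : ℂ | ε ≤ ζ.im ∧ ‖ζ‖ ≤ R} := by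
  have : {ζ : ℂ | ε ≤ ζ.im ∧ ‖ζ‖ ≤ R} = {ζ | ε ≤ ζ.im} ∩ closedBall 0 R := by
    ext; simp
  rw [this]
  exact (isCompact_closedBall _ _).inter_left (isClosed_le continuous_const Complex.continuous_im)

theorem isFiniteMeasure_wt (hf : DifferentiableOn ℂ f upper) (ha : IsTest ε a) (hε : 0 < ε) :
    IsFiniteMeasure (wt f a) := by
  obtain ⟨N, hN⟩ := ha.bdd
  obtain ⟨R, hR⟩ := ha.supp
  have hsub : {ζ : ℂ | ε ≤ ζ.im ∧ ‖ζ‖ ≤ R} ⊆ upper := fun ζ h => hε.trans_le h.1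
  obtain ⟨M, hM⟩ := (isCompact_supp ε R).exists_bound_of_continuousOn (hf.continuousOn.mono hsub)
  refine isFiniteMeasure_withDensity (ne_of_lt ?_)
  calc ∫⁻ ζ, ((‖f ζ‖₊ * a ζ : ℝ≥0) : ℝ≥0∞)
      ≤ ∫⁻ ζ, {ζ : ℂ | ‖ζ‖ ≤ R}.indicator (fun _ => ENNReal.ofReal M * N) ζ := by
        refine lintegral_mono fun ζ => ?_
        by_cases h0 : a ζ = 0
        · simp [h0]
        · have h1 : ζ ∈ {ζ : ℂ | ‖ζ‖ ≤ R} := (hR ζ h0).2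
          rw [indicator_of_mem h1, ENNReal.coe_mul]
          gcongr
          · rw [← enorm_eq_nnnorm, ← ofReal_norm]
            exact ENNReal.ofReal_le_ofReal (hM ζ (hR ζ h0))
          · exact hN ζ
    _ = ENNReal.ofReal M * N * volume {ζ : ℂ | ‖ζ‖ ≤ R} :=
        lintegral_indicator_const (measurableSet_le measurable_norm measurable_const) _
    _ < ∞ := ENNReal.mul_lt_top (by finiteness) (volume_support_lt_top R)

theorem lintegral_wt (hf : Measurable f) (ha : Measurable a) {k : ℂ → ℝ≥0∞} (hk : Measurable k) :
    ∫⁻ ζ, k ζ ∂(wt f a) = ∫⁻ ζ, k ζ * ‖f ζ‖ₑ * a ζ := by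
  rw [wt, lintegral_withDensity_eq_lintegral_mul _
    (measurable_density hf ha).coe_nnreal_ennreal hk]
  refine lintegral_congr fun ζ => ?_
  rw [Pi.mul_apply, ENNReal.coe_mul, enorm_eq_nnnorm]
  ring

theorem ofReal_posP (hf : Measurable f) (hf' : DifferentiableOn ℂ f upper) (ha : IsTest ε a)
    (hε : 0 < ε) {z : ℂ} (hz : 0 < z.im) :
    ENNReal.ofReal (posP (wt f a) z) = ∫⁻ ζ, kerP z ζ * ‖f ζ‖ₑ * a ζ := by
  have := isFiniteMeasure_wt hf' ha hε
  rw [posP, ofReal_integral_eq_lintegral_ofReal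
    (integrable_posP (wt_ae_nonneg hf ha hε.le) hz) (Eventually.of_forall fun _ => by positivity),
    ← lintegral_wt hf ha.meas (measurable_kerP.of_uncurry_left (x := z))]
  rfl

theorem ofReal_posH (hf : Measurable f) (hf' : DifferentiableOn ℂ f upper) (ha : IsTest ε a)
    (hε : 0 < ε) {z : ℂ} (hz : 0 < z.im) :
    ENNReal.ofReal (posH (wt f a) z) = ∫⁻ ζ, kerH z ζ * ‖f ζ‖ₑ * a ζ := by
  have := isFiniteMeasure_wt hf' ha hε
  rw [posH, ofReal_integral_eq_lintegral_ofReal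
    (integrable_posH (wt_ae_nonneg hf ha hε.le) hz) (Eventually.of_forall fun _ => by positivity),
    ← lintegral_wt hf ha.meas (measurable_kerH.of_uncurry_left (x := z))]
  rfl

/-- For `ξ = z - ζ̄` one has `Re ξ⁻² = (Re² ξ - Im² ξ) / |ξ|⁴ = |ξ|⁻² - 2 Im² ξ / |ξ|⁴`. Integration
gives `P = Re F + 2H`: the positive and the analytic kernel differ only by `H`. -/
theorem posP_le_norm_cauchyF_add (hf : Measurable f) (hf' : DifferentiableOn ℂ f upper)
    (ha : IsTest ε a) (hε : 0 < ε) {z : ℂ} (hz : 0 < z.im) :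
    posP (wt f a) z ≤ ‖cauchyF (wt f a) z‖ + 2 * posH (wt f a) z := by
  have := isFiniteMeasure_wt hf' ha hε
  have hA := wt_ae_nonneg hf ha hε.le
  have h1 : posP (wt f a) z = (cauchyF (wt f a) z).re + 2 * posH (wt f a) z := by
    have e : (cauchyF (wt f a) z).re = ∫ ζ, (1 / (z - conj ζ) ^ 2).re ∂(wt f a) :=
      (integral_re (integrable_cauchyF hA hz)).symm
    have i1 : Integrable (fun ζ => (1 / (z - conj ζ) ^ 2).re) (wt f a) :=
      (integrable_cauchyF hA hz).re
    rw [e, posP, posH, ← integral_const_mul,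
      ← integral_add i1 ((integrable_posH hA hz).const_mul 2)]
    refine integral_congr_ae ?_
    filter_upwards [hA] with ζ hζ
    have h0 : 0 < ‖z - conj ζ‖ := norm_pos_iff.2 (sub_conj_ne_zero hz hζ)
    have e := norm_sub_conj_sq z ζ
    rw [re_one_div_sub_conj_sq, mul_div_assoc', ← add_div,
      div_eq_div_iff (by positivity) (by positivity)]
    have e4 : ‖z - conj ζ‖ ^ 4 = ‖z - conj ζ‖ ^ 2 * ‖z - conj ζ‖ ^ 2 := by ring
    rw [e4]
    nth_rewrite 1 [e]
    ring
  rw [h1]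
  gcongr
  exact Complex.re_le_norm _

end Weighted

/-! ### The analytic operator on the half plane and the two-point condition -/

/-- The analytic operator `a ↦ g(z) ∫ conj (f ζ) a(ζ) / (z - conj ζ)² dζ` is bounded on `L²` of the
upper half plane, with squared norm at most `B`. -/
def CauchyBound (f g : ℂ → ℂ) (B : ℝ≥0∞) : Prop :=
  ∀ α : ℂ → ℂ, Measurable α → (∃ N, ∀ ζ, ‖α ζ‖ ≤ N) →
    (∃ ε > 0, ∃ R, ∀ ζ, α ζ ≠ 0 → ε ≤ ζ.im ∧ ‖ζ‖ ≤ R) →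
    ∫⁻ z in upper, ‖g z * ∫ ζ, conj (f ζ) * α ζ / (z - conj ζ) ^ 2‖ₑ ^ 2 ≤
      B * ∫⁻ ζ, ‖α ζ‖ₑ ^ 2

/-- The phase of `f` is moved into the test function: `|f| a = f̄ · (a f / |f|)`. Thus the potential
of a positive measure is the analytic operator applied to a function of modulus at most `a`. -/
theorem cauchyF_wt {f : ℂ → ℂ} {a : ℂ → ℝ≥0} (hf : Measurable f) (ha : Measurable a) (z : ℂ) :
    cauchyF (wt f a) z =
      ∫ ζ, conj (f ζ) * ((a ζ : ℝ) * (f ζ / (‖f ζ‖ : ℂ))) / (z - conj ζ) ^ 2 := by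
  rw [cauchyF, wt, integral_withDensity_eq_integral_smul (measurable_density hf ha)]
  congr 1
  ext ζ
  rw [NNReal.smul_def, Complex.real_smul]
  have h : conj (f ζ) * (f ζ / (‖f ζ‖ : ℂ)) = (‖f ζ‖ : ℂ) := by
    rcases eq_or_ne (f ζ) 0 with h0 | h0
    · simp [h0]
    · have h1 : (‖f ζ‖ : ℂ) ≠ 0 := by simpa using h0
      rw [mul_div_assoc', mul_comm, Complex.mul_conj, Complex.normSq_eq_norm_sq,
        div_eq_iff h1]
      push_cast
      ring
  have e : conj (f ζ) * ((a ζ : ℝ) * (f ζ / (‖f ζ‖ : ℂ))) = (‖f ζ‖ : ℂ) * (a ζ : ℝ) := by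
    calc conj (f ζ) * ((a ζ : ℝ) * (f ζ / (‖f ζ‖ : ℂ))) =
        conj (f ζ) * (f ζ / (‖f ζ‖ : ℂ)) * (a ζ : ℝ) := by ring
      _ = _ := by rw [h]
  rw [e]
  push_cast
  simp [div_eq_mul_inv]

theorem CauchyBound.lintegral_le {f g : ℂ → ℂ} {B : ℝ≥0∞} (h : CauchyBound f g B) {a : ℂ → ℝ≥0}
    {ε : ℝ} (hf : Measurable f) (ha : IsTest ε a) (hε : 0 < ε) :
    ∫⁻ z in upper, ‖g z * cauchyF (wt f a) z‖ₑ ^ 2 ≤ B * ∫⁻ ζ, (a ζ : ℝ≥0∞) ^ 2 := by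
  obtain ⟨N, hN⟩ := ha.bdd
  obtain ⟨R, hR⟩ := ha.supp
  have hle : ∀ ζ, ‖((a ζ : ℝ) * (f ζ / (‖f ζ‖ : ℂ)) : ℂ)‖ ≤ a ζ := by
    intro ζ
    rw [norm_mul, norm_div, Complex.norm_real, Complex.norm_real, norm_norm,
      Real.norm_of_nonneg (a ζ).coe_nonneg]
    exact mul_le_of_le_one_right (a ζ).coe_nonneg (div_self_le_one _)
  have key := h (fun ζ => (a ζ : ℝ) * (f ζ / (‖f ζ‖ : ℂ))) ?_ ⟨N, fun ζ => (hle ζ).trans (hN ζ)⟩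
    ⟨ε, hε, R, fun ζ hζ => hR ζ fun h0 => hζ ?_⟩
  · simp only [cauchyF_wt hf ha.meas]
    refine key.trans ?_
    gcongr with ζ
    rw [← ofReal_norm, ← ENNReal.ofReal_coe_nnreal]
    exact ENNReal.ofReal_le_ofReal (hle ζ)
  · have h1 : Measurable fun ζ => ((a ζ : ℝ) : ℂ) :=
      Complex.measurable_ofReal.comp ha.meas.coe_nnreal_real
    exact h1.mul (hf.div (Complex.measurable_ofReal.comp hf.norm))
  · simp [h0]

theorem half_im_le_im_of_mem_closedBall {c : ℂ} {r : ℝ} (hr : r ≤ c.im / 2) :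
    ∀ ζ ∈ closedBall c r, c.im / 2 ≤ ζ.im := by
  intro ζ hζ
  have h1 := (Complex.abs_im_le_norm (ζ - c)).trans (mem_closedBall_iff_norm.1 hζ)
  rw [Complex.sub_im, abs_le] at h1
  linarith

/-- The two-point necessary condition. -/
theorem CauchyBound.pointwise {f g : ℂ → ℂ} {B : ℝ≥0∞} (h : CauchyBound f g B)
    (hf : DifferentiableOn ℂ f upper) (hg : DifferentiableOn ℂ g upper) {z ζ : ℂ} (hz : 0 < z.im)
    (hζ : 0 < ζ.im) :
    ‖g z‖ₑ ^ 2 * ‖f ζ‖ₑ ^ 2 * ENNReal.ofReal ((z.im * ζ.im) ^ 2) ≤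
      2 * B * ENNReal.ofReal (‖z - conj ζ‖ ^ 4) := by
  set r := ζ.im / 2 with hr
  have hr0 : 0 < r := by positivity
  set s := z.im / 2 with hs
  have hs0 : 0 < s := by positivity
  have hζb := half_im_le_im_of_mem_closedBall (c := ζ) (le_refl (ζ.im / 2))
  have hzb := half_im_le_im_of_mem_closedBall (c := z) (le_refl (z.im / 2))
  rw [← hr] at hζb
  rw [← hs] at hzb
  -- For this test function the inner integral is exact: the integrand is the conjugate of an
  -- analytic function on the disc, so the mean value property gives the area times its value at
  -- `ζ`. The sub-mean value property of `‖G‖²` about `z` then localizes the outer variable.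
  set α : ℂ → ℂ := (ball ζ r).indicator 1 with hα
  have hint : ∀ w, 0 < w.im → ∫ η, conj (f η) * α η / (w - conj η) ^ 2 =
      volume.real (ball ζ r) * (conj (f ζ) / (w - conj ζ) ^ 2) := by
    intro w hw
    have e1 : ∫ η, conj (f η) * α η / (w - conj η) ^ 2 =
        ∫ η in ball ζ r, conj (f η / (conj w - η) ^ 2) := by
      rw [← integral_indicator measurableSet_ball]
      congr 1
      ext η
      by_cases hη : η ∈ ball ζ r
      · rw [hα, indicator_of_mem hη, indicator_of_mem hη]
        simp
      · rw [hα, indicator_of_notMem hη, indicator_of_notMem hη]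
        simp
    have hne : ∀ η : ℂ, 0 < η.im → conj w - η ≠ 0 := by
      intro η hη h0
      have := congrArg Complex.im h0
      simp at this
      linarith
    rw [e1, integral_conj, setIntegral_ball_eq_of_differentiableOn (U := upper) hr0.le
      (fun η hη => hr0.trans_le (hζb η hη)) ?_]
    · rw [Complex.real_smul, map_mul, Complex.conj_ofReal]
      simp
    · refine hf.div ?_ fun η hη => pow_ne_zero 2 (hne η hη)
      exact ((differentiableOn_const _).sub differentiableOn_id).pow 2
  have key := h α (measurable_one.indicator measurableSet_ball) ⟨1, fun η => ?_⟩
    ⟨r, hr0, ‖ζ‖ + r, fun η hη => ?_⟩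
  · have e2 : ∫⁻ η, ‖α η‖ₑ ^ 2 = volume (ball ζ r) := by
      rw [← lintegral_indicator_one measurableSet_ball]
      refine lintegral_congr fun η => ?_
      by_cases hη : η ∈ ball ζ r
      · rw [hα, indicator_of_mem hη, indicator_of_mem hη]
        simp
      · rw [hα, indicator_of_notMem hη, indicator_of_notMem hη]
        simp
    rw [e2] at key
    set G : ℂ → ℂ := fun w => g w * (volume.real (ball ζ r) * (conj (f ζ) / (w - conj ζ) ^ 2))
      with hG
    have hGd : DifferentiableOn ℂ G upper := by
      refine hg.mul ((differentiableOn_const _).mul ?_)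
      refine (differentiableOn_const _).div ?_ fun η hη =>
        pow_ne_zero 2 (sub_conj_ne_zero hη hζ.le)
      exact (differentiableOn_id.sub (differentiableOn_const _)).pow 2
    have hsub : ball z s ⊆ upper := fun η hη => hs0.trans_le (hzb η (ball_subset_closedBall hη))
    have k1 := enorm_sq_mul_volume_le (hGd.mono hsub)
    have k2 : ∫⁻ w in ball z s, ‖G w‖ₑ ^ 2 ≤ B * volume (ball ζ r) := by
      refine (lintegral_mono_set hsub).trans (le_trans (le_of_eq ?_) key)
      refine setLIntegral_congr_fun measurableSet_upper fun w hw => ?_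
      simp only [hG, hint w hw]
    have k3 := k1.trans k2
    have hq : 0 < ‖z - conj ζ‖ := norm_pos_iff.2 (sub_conj_ne_zero hz hζ.le)
    have hV : volume.real (ball ζ r) = Real.pi * r ^ 2 := by
      rw [measureReal_def, Complex.volume_ball]
      simp [ENNReal.toReal_ofReal hr0.le, mul_comm]
    have hV' : volume (ball ζ r) = ENNReal.ofReal (Real.pi * r ^ 2) := by
      rw [← hV, measureReal_def, ENNReal.ofReal_toReal measure_ball_lt_top.ne]
    have hW' : volume (ball z s) = ENNReal.ofReal (Real.pi * s ^ 2) := by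
      rw [Complex.volume_ball, ENNReal.ofReal_mul Real.pi_pos.le, ENNReal.ofReal_pow hs0.le,
        mul_comm]
      congr 1
      rw [← ENNReal.ofReal_coe_nnreal, NNReal.coe_real_pi]
    have hG' : ‖G z‖ₑ ^ 2 = ‖g z‖ₑ ^ 2 * ‖f ζ‖ₑ ^ 2 *
        ENNReal.ofReal ((Real.pi * r ^ 2) ^ 2 / ‖z - conj ζ‖ ^ 4) := by
      rw [hG, hV]
      simp only [← ofReal_norm]
      rw [← ENNReal.ofReal_pow (norm_nonneg _), ← ENNReal.ofReal_pow (norm_nonneg _),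
        ← ENNReal.ofReal_pow (norm_nonneg _), ← ENNReal.ofReal_mul (by positivity),
        ← ENNReal.ofReal_mul (by positivity)]
      congr 1
      rw [norm_mul, norm_mul, norm_div, RCLike.norm_conj, norm_pow, Complex.norm_real,
        Real.norm_of_nonneg (by positivity)]
      ring
    rw [hG', hW', hV', mul_assoc, ← ENNReal.ofReal_mul (by positivity)] at k3
    have hD : 0 < ‖z - conj ζ‖ ^ 4 / (Real.pi * r ^ 2) * (16 / Real.pi ^ 2 * 1) := by
      have := Real.pi_pos
      positivity
    have k4 := mul_le_mul_left k3
      (ENNReal.ofReal (‖z - conj ζ‖ ^ 4 / (Real.pi * r ^ 2) * (16 / Real.pi ^ 2)))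
    rw [mul_assoc, mul_assoc B, ← ENNReal.ofReal_mul (by positivity),
      ← ENNReal.ofReal_mul (by positivity)] at k4
    have hpi := Real.pi_pos
    have e3 : (Real.pi * r ^ 2) ^ 2 / ‖z - conj ζ‖ ^ 4 * (Real.pi * s ^ 2) *
        (‖z - conj ζ‖ ^ 4 / (Real.pi * r ^ 2) * (16 / Real.pi ^ 2)) = (z.im * ζ.im) ^ 2 := by
      rw [hr, hs]
      field_simp
      norm_num
    have e4 : Real.pi * r ^ 2 * (‖z - conj ζ‖ ^ 4 / (Real.pi * r ^ 2) * (16 / Real.pi ^ 2)) =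
        16 / Real.pi ^ 2 * ‖z - conj ζ‖ ^ 4 := by
      field_simp
    rw [e3, e4] at k4
    refine k4.trans ?_
    -- The radii are half the heights, so the areas contribute `π² (Im z)² (Im ζ)² / 16`.
    have h16 : 16 / Real.pi ^ 2 ≤ 2 := by
      rw [div_le_iff₀ (by positivity)]
      nlinarith [Real.pi_gt_three]
    rw [mul_comm 2 B, mul_assoc]
    gcongr
    rw [ENNReal.ofReal_mul (by positivity)]
    gcongr
    rw [← ENNReal.ofReal_ofNat 2]
    exact ENNReal.ofReal_le_ofReal h16
  · by_cases hη : η ∈ ball ζ r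
    · rw [hα, indicator_of_mem hη]
      simp
    · rw [hα, indicator_of_notMem hη]
      simp
  · have h1 : η ∈ ball ζ r := mem_of_indicator_ne_zero hη
    refine ⟨hζb η (ball_subset_closedBall h1), ?_⟩
    have h2 := mem_ball_iff_norm.1 h1
    have h3 := norm_sub_norm_le η ζ
    linarith

/-! ### The contribution of comparable heights -/

theorem lintegral_eq_lintegral_re_im {F : ℂ → ℝ≥0∞} (hF : Measurable F) :
    ∫⁻ z, F z = ∫⁻ y : ℝ, ∫⁻ x : ℝ, F (x + y * Complex.I) := by
  rw [← (Complex.volume_preserving_equiv_real_prod.symm).lintegral_comp_emb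
    Complex.measurableEquivRealProd.symm.measurableEmbedding, Measure.volume_eq_prod,
    lintegral_prod_symm]
  · refine lintegral_congr fun y => lintegral_congr fun x => ?_
    congr 1
    rw [Complex.measurableEquivRealProd_symm_apply, Complex.mk_eq_add_mul_I]
  · exact (hF.comp Complex.measurableEquivRealProd.symm.measurable).aemeasurable

theorem lintegral_inv_sq_add_sq {δ : ℝ} (hδ : 0 < δ) (t : ℝ) :
    ∫⁻ x : ℝ, ENNReal.ofReal (1 / ((x - t) ^ 2 + δ ^ 2)) = ENNReal.ofReal (Real.pi / δ) := by
  rw [lintegral_sub_right_eq_self (fun x : ℝ => ENNReal.ofReal (1 / (x ^ 2 + δ ^ 2))) t,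
    ← integral_inv_sq_add_sq hδ, ofReal_integral_eq_lintegral_ofReal
      (integrable_inv_sq_add_sq hδ) (Eventually.of_forall fun _ => by positivity)]
  simp only [one_div]

theorem mem_midSet_comm {κ : ℝ} (hκ : 0 < κ) {z ζ : ℂ} :
    ζ ∈ midSet κ z.im ↔ z ∈ midSet κ ζ.im := by
  simp only [midSet, mem_ofPred_eq, lt_div_iff₀ hκ, mul_comm κ]
  exact and_comm

theorem im_pos_of_mem_midSet {κ : ℝ} (hκ : 0 < κ) (hκ1 : κ < 1) {y : ℝ} {ζ : ℂ}
    (h : ζ ∈ midSet κ y) : 0 < y ∧ 0 < ζ.im := by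
  obtain ⟨h1, h2⟩ := h
  rw [lt_div_iff₀ hκ] at h2
  have hy : 0 < y := by
    by_contra h0
    have h3 : κ * (κ * y) < y := by nlinarith
    have h4 : κ * κ < 1 := by nlinarith
    nlinarith
  exact ⟨hy, lt_trans (by positivity) h1⟩

/-- The integral over the horizontal line at height `η` is `π / (Im z + η) ≤ π / Im z`, and the
admissible `η` fill an interval of length at most `Im z / κ`. By symmetry this is both the row and
the column condition in Schur's test. -/
theorem lintegral_kerP_midSet_le {κ : ℝ} (hκ : 0 < κ) (hκ1 : κ < 1) (z : ℂ) :
    ∫⁻ ζ, (midSet κ z.im).indicator (kerP z) ζ ≤ ENNReal.ofReal (Real.pi / κ) := by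
  rcases le_or_gt z.im 0 with hz | hz
  · have : midSet κ z.im = ∅ := by
      ext ζ
      simp only [mem_empty_iff_false, iff_false]
      exact fun h => absurd (im_pos_of_mem_midSet hκ hκ1 h).1 (not_lt.2 hz)
    simp [this]
  · rw [lintegral_eq_lintegral_re_im]
    · calc _ ≤ ∫⁻ η : ℝ, (Ioo (κ * z.im) (z.im / κ)).indicator
            (fun _ => ENNReal.ofReal (Real.pi / z.im)) η := by
            refine lintegral_mono fun η => ?_
            by_cases hη : η ∈ Ioo (κ * z.im) (z.im / κ)
            · rw [indicator_of_mem hη]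
              have hη0 : 0 < η := lt_trans (by positivity) hη.1
              have hδ : 0 < z.im + η := by positivity
              calc _ = ∫⁻ x : ℝ, ENNReal.ofReal (1 / ((x - z.re) ^ 2 + (z.im + η) ^ 2)) := by
                    refine lintegral_congr fun x => ?_
                    rw [indicator_of_mem (by simpa [midSet] using hη), kerP, norm_sub_conj_sq]
                    congr 3
                    · simp
                      ring
                    · simp
                _ = ENNReal.ofReal (Real.pi / (z.im + η)) := lintegral_inv_sq_add_sq hδ _
                _ ≤ _ := by
                  refine ENNReal.ofReal_le_ofReal ?_
                  have := Real.pi_pos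
                  gcongr
                  linarith
            · rw [indicator_of_notMem hη]
              refine le_of_eq ?_
              rw [← lintegral_zero (μ := (volume : Measure ℝ))]
              refine lintegral_congr fun x => indicator_of_notMem (fun h => hη ?_) _
              simpa [midSet] using h
        _ ≤ ENNReal.ofReal (Real.pi / κ) := by
            rw [lintegral_indicator_const measurableSet_Ioo, Real.volume_Ioo,
              ← ENNReal.ofReal_mul (by positivity)]
            refine ENNReal.ofReal_le_ofReal ?_
            have := Real.pi_pos
            calc Real.pi / z.im * (z.im / κ - κ * z.im) ≤ Real.pi / z.im * (z.im / κ) := by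
                  gcongr
                  have : 0 < κ * z.im := by positivity
                  linarith
              _ = Real.pi / κ := by field_simp
    · exact (measurable_kerP.of_uncurry_left (x := z)).indicator (measurableSet_midSet _ _)

theorem measurableSet_mid_prod (κ : ℝ) : MeasurableSet {p : ℂ × ℂ | p.2 ∈ midSet κ p.1.im} := by
  have e : {p : ℂ × ℂ | p.2 ∈ midSet κ p.1.im} =
      {p | κ * p.1.im < p.2.im} ∩ {p | p.2.im < p.1.im / κ} := rfl
  rw [e]
  refine MeasurableSet.inter (measurableSet_lt ?_ ?_) (measurableSet_lt ?_ ?_)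
  · exact measurable_const.mul (Complex.measurable_im.comp measurable_fst)
  · exact Complex.measurable_im.comp measurable_snd
  · exact Complex.measurable_im.comp measurable_snd
  · exact (Complex.measurable_im.comp measurable_fst).div_const _

theorem measurable_indicator_mid {k : ℂ → ℂ → ℝ≥0∞} (hk : Measurable (Function.uncurry k)) (κ : ℝ) :
    Measurable (Function.uncurry fun z ζ : ℂ => (midSet κ z.im).indicator (k z) ζ) := by
  convert hk.indicator (measurableSet_mid_prod κ) using 1
  ext p
  simp [indicator, Function.uncurry]

theorem lintegral_sq_kerP_midSet_le {κ : ℝ} (hκ : 0 < κ) (hκ1 : κ < 1) {a : ℂ → ℝ≥0∞}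
    (ha : Measurable a) :
    ∫⁻ z, (∫⁻ ζ, (midSet κ z.im).indicator (kerP z) ζ * a ζ) ^ 2 ≤
      ENNReal.ofReal (Real.pi / κ) ^ 2 * ∫⁻ ζ, a ζ ^ 2 := by
  rw [sq (ENNReal.ofReal _)]
  refine schur_test (measurable_indicator_mid measurable_kerP κ) ha
    (Eventually.of_forall fun z => lintegral_kerP_midSet_le hκ hκ1 z)
    (Eventually.of_forall fun ζ => ?_)
  refine le_trans (le_of_eq ?_) (lintegral_kerP_midSet_le hκ hκ1 ζ)
  refine lintegral_congr fun z => ?_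
  by_cases h : ζ ∈ midSet κ z.im
  · rw [indicator_of_mem h, indicator_of_mem ((mem_midSet_comm hκ).1 h), kerP_comm]
  · rw [indicator_of_notMem h, indicator_of_notMem (fun h' => h ((mem_midSet_comm hκ).2 h'))]

/-- A consequence of the two-point condition at points of comparable height. -/
theorem CauchyBound.kerH_le {f g : ℂ → ℂ} {B β : ℝ≥0∞} (h : CauchyBound f g B)
    (hβ : β ^ 2 = 2 * B)
    (hf : DifferentiableOn ℂ f upper) (hg : DifferentiableOn ℂ g upper) {κ : ℝ} (hκ : 0 < κ)
    (hκ1 : κ < 1) {z ζ : ℂ} (hζ : ζ ∈ midSet κ z.im) :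
    ‖g z‖ₑ * kerH z ζ * ‖f ζ‖ₑ ≤ β * ENNReal.ofReal (4 / κ) * kerP z ζ := by
  obtain ⟨hz0, hζ0⟩ := im_pos_of_mem_midSet hκ hκ1 hζ
  obtain ⟨h1, h2⟩ := hζ
  rw [lt_div_iff₀ hκ] at h2
  have hq : 0 < ‖z - conj ζ‖ := norm_pos_iff.2 (sub_conj_ne_zero hz0 hζ0.le)
  have key := h.pointwise hf hg hz0 hζ0
  have k2 : ‖g z‖ₑ * ‖f ζ‖ₑ * ENNReal.ofReal (z.im * ζ.im) ≤
      β * ENNReal.ofReal (‖z - conj ζ‖ ^ 2) := by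
    rw [← ENNReal.pow_le_pow_left_iff two_ne_zero, mul_pow, mul_pow, mul_pow,
      ← ENNReal.ofReal_pow (by positivity), ← ENNReal.ofReal_pow (by positivity), hβ]
    convert key using 3
    ring
  -- For comparable heights each of `y²`, `η²`, `yη` is at most `yη/κ`, hence `(y + η)² ≤ 4yη/κ`.
  have hk : kerH z ζ ≤ ENNReal.ofReal (z.im * ζ.im) *
      ENNReal.ofReal (4 / κ / ‖z - conj ζ‖ ^ 4) := by
    rw [kerH, ← ENNReal.ofReal_mul (by positivity)]
    refine ENNReal.ofReal_le_ofReal ?_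
    rw [mul_div_assoc']
    gcongr
    rw [mul_div_assoc', le_div_iff₀ hκ]
    nlinarith [mul_pos hz0 hζ0, mul_lt_mul_of_pos_left h1 hz0, mul_lt_mul_of_pos_left h2 hζ0]
  calc ‖g z‖ₑ * kerH z ζ * ‖f ζ‖ₑ
      ≤ ‖g z‖ₑ * (ENNReal.ofReal (z.im * ζ.im) *
      ENNReal.ofReal (4 / κ / ‖z - conj ζ‖ ^ 4)) * ‖f ζ‖ₑ := by gcongr
    _ = ‖g z‖ₑ * ‖f ζ‖ₑ * ENNReal.ofReal (z.im * ζ.im) *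
      ENNReal.ofReal (4 / κ / ‖z - conj ζ‖ ^ 4) := by ring
    _ ≤ β * ENNReal.ofReal (‖z - conj ζ‖ ^ 2) * ENNReal.ofReal (4 / κ / ‖z - conj ζ‖ ^ 4) := by
      gcongr
    _ = β * ENNReal.ofReal (4 / κ) * kerP z ζ := by
      rw [mul_assoc, mul_assoc, kerP, ← ENNReal.ofReal_mul (by positivity),
        ← ENNReal.ofReal_mul (by positivity)]
      congr 2
      field_simp

/-- Horizontal strips at the scale `b`. -/
def strip (b : ℝ) (n : ℤ) : Set ℂ := {z | b ^ n ≤ z.im ∧ z.im < b ^ (n + 1)}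

theorem measurableSet_strip (b : ℝ) (n : ℤ) : MeasurableSet (strip b n) :=
  (measurableSet_le measurable_const Complex.measurable_im).inter
    (measurableSet_lt Complex.measurable_im measurable_const)

theorem iUnion_strip {b : ℝ} (hb : 1 < b) : ⋃ n, strip b n = upper := by
  ext z
  simp only [mem_iUnion, strip, mem_ofPred_eq, upper]
  constructor
  · rintro ⟨n, h, -⟩
    exact lt_of_lt_of_le (zpow_pos (by linarith) n) h
  · intro h
    exact exists_mem_Ico_zpow h hb

theorem pairwise_disjoint_strip {b : ℝ} (hb : 1 < b) : Pairwise (Function.onFun Disjoint (strip b)) := by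
  intro m n hmn
  rw [Function.onFun, Set.disjoint_left]
  rintro z ⟨h1, h2⟩ ⟨h3, h4⟩
  have hlt1 := (zpow_lt_zpow_iff_right₀ hb).1 (h1.trans_lt h4)
  have hlt2 := (zpow_lt_zpow_iff_right₀ hb).1 (h3.trans_lt h2)
  omega

theorem tsum_lintegral_strip {b : ℝ} (hb : 1 < b) (F : ℂ → ℝ≥0∞) (k : ℤ) :
    ∑' n, ∫⁻ z in strip b (n + k), F z = ∫⁻ z in upper, F z := by
  have h := (Equiv.addRight k).tsum_eq (fun n => ∫⁻ z in strip b n, F z)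
  simp only [Equiv.coe_addRight] at h
  rw [h, ← iUnion_strip hb,
    lintegral_iUnion (measurableSet_strip b) (pairwise_disjoint_strip hb)]

/-- The kernel `k` with weights `f` and `g`. -/
def weighted (f g : ℂ → ℂ) (k : ℂ → ℂ → ℝ≥0∞) (z ζ : ℂ) : ℝ≥0∞ := ‖g z‖ₑ * k z ζ * ‖f ζ‖ₑ

theorem measurable_weighted {f g : ℂ → ℂ} {k : ℂ → ℂ → ℝ≥0∞} (hf : Measurable f)
    (hg : Measurable g) (hk : Measurable (Function.uncurry k)) :
    Measurable (Function.uncurry (weighted f g k)) :=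
  ((hg.enorm.comp measurable_fst).mul hk).mul (hf.enorm.comp measurable_snd)

theorem enorm_mul_lintegral_eq {f : ℂ → ℂ} (g : ℂ → ℂ) {k : ℂ → ℂ → ℝ≥0∞} {a : ℂ → ℝ≥0}
    (hf : Measurable f) (hk : Measurable (Function.uncurry k)) (ha : Measurable a) (z : ℂ) :
    ‖g z‖ₑ * ∫⁻ ζ, k z ζ * ‖f ζ‖ₑ * a ζ = ∫⁻ ζ, weighted f g k z ζ * a ζ := by
  rw [← lintegral_const_mul]
  · refine lintegral_congr fun ζ => ?_
    rw [weighted]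
    ring
  · exact (hk.of_uncurry_left.mul hf.enorm).mul ha.coe_nnreal_ennreal

theorem ENNReal.sq_add_le (x y : ℝ≥0∞) : (x + y) ^ 2 ≤ 2 * (x ^ 2 + y ^ 2) := by
  have := ENNReal.rpow_add_le_mul_rpow_add_rpow x y (p := 2) (by norm_num)
  norm_num at this
  exact_mod_cast this

/-- From `P ≤ |F| + 2H`: when the density lives at heights comparable with `Im z`, the two-point
condition replaces the weighted kernel `H` by a multiple of the unweighted kernel `P`. -/
theorem mid_pointwise {f g : ℂ → ℂ} {B β : ℝ≥0∞} (hfm : Measurable f)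
    (hf : DifferentiableOn ℂ f upper) (hg : DifferentiableOn ℂ g upper)
    (h : CauchyBound f g B) (hβ : β ^ 2 = 2 * B) {ε : ℝ} (hε : 0 < ε) {a : ℂ → ℝ≥0}
    (ha : IsTest ε a) {κ : ℝ} (hκ : 0 < κ) (hκ1 : κ < 1) {z : ℂ} (hz : 0 < z.im)
    (hsupp : ∀ ζ, a ζ ≠ 0 → ζ ∈ midSet κ z.im) :
    (∫⁻ ζ, weighted f g kerP z ζ * a ζ) ^ 2 ≤ 2 * ‖g z * cauchyF (wt f a) z‖ₑ ^ 2 +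
      8 * (β * ENNReal.ofReal (4 / κ)) ^ 2 *
        (∫⁻ ζ, (midSet κ z.im).indicator (kerP z) ζ * a ζ) ^ 2 := by
  have h1 : ∫⁻ ζ, weighted f g kerP z ζ * a ζ ≤ ‖g z * cauchyF (wt f a) z‖ₑ +
      2 * ∫⁻ ζ, weighted f g kerH z ζ * a ζ := by
    rw [← enorm_mul_lintegral_eq g hfm measurable_kerP ha.meas,
      ← enorm_mul_lintegral_eq g hfm measurable_kerH ha.meas, ← ofReal_posP hfm hf ha hε hz,
      ← ofReal_posH hfm hf ha hε hz, enorm_mul]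
    have h2 := ENNReal.ofReal_le_ofReal (posP_le_norm_cauchyF_add hfm hf ha hε hz)
    rw [ENNReal.ofReal_add (norm_nonneg _) (mul_nonneg zero_le_two (posH_nonneg _ _)),
      ofReal_norm, ENNReal.ofReal_mul zero_le_two, ENNReal.ofReal_ofNat] at h2
    refine (mul_le_mul_right h2 _).trans (le_of_eq ?_)
    ring
  have h2 : ∫⁻ ζ, weighted f g kerH z ζ * a ζ ≤ β * ENNReal.ofReal (4 / κ) *
      ∫⁻ ζ, (midSet κ z.im).indicator (kerP z) ζ * a ζ := by
    rw [← lintegral_const_mul]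
    · refine lintegral_mono fun ζ => ?_
      by_cases h0 : a ζ = 0
      · simp [h0]
      · have hm := hsupp ζ h0
        rw [indicator_of_mem hm, ← mul_assoc]
        gcongr
        exact h.kerH_le hβ hf hg hκ hκ1 hm
    · refine Measurable.mul ?_ ha.meas.coe_nnreal_ennreal
      exact measurable_kerP.of_uncurry_left.indicator (measurableSet_midSet _ _)
  calc _ ≤ (‖g z * cauchyF (wt f a) z‖ₑ + 2 * (β * ENNReal.ofReal (4 / κ) *
      ∫⁻ ζ, (midSet κ z.im).indicator (kerP z) ζ * a ζ)) ^ 2 := by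
        gcongr
        exact h1.trans (by gcongr)
    _ ≤ _ := (ENNReal.sq_add_le _ _).trans (le_of_eq (by ring))

/-- The part of the positive operator with comparable heights is bounded. -/
theorem mid_bound {κ : ℝ} (hκ : 0 < κ) (hκ1 : κ < 1) : ∃ C : ℝ≥0∞, C ≠ ∞ ∧
    ∀ (f g : ℂ → ℂ) (B : ℝ≥0∞), Measurable f → DifferentiableOn ℂ f upper → Measurable g →
      DifferentiableOn ℂ g upper → CauchyBound f g B → ∀ (ε : ℝ), 0 < ε →
      KerBound ε (fun z ζ => (midSet κ z.im).indicator (weighted f g kerP z) ζ) (C * B) := by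
  -- Replacing the mid set of `z` by a union of strips loosens comparability from `κ` to `κ²`.
  set κ' := κ ^ 2 with hκ'
  have hκ0' : 0 < κ' := by positivity
  have hκ1' : κ' < 1 := pow_lt_one₀ hκ.le hκ1 two_ne_zero
  set b := 1 / κ with hb
  have hb1 : 1 < b := by rwa [hb, lt_div_iff₀ hκ, one_mul]
  have hb0 : 0 < b := by positivity
  set D : ℝ≥0∞ := ENNReal.ofReal (4 / κ') ^ 2 * ENNReal.ofReal (Real.pi / κ') ^ 2 with hD
  refine ⟨6 + 16 * D, by rw [hD]; finiteness, fun f g B hfm hf hgm hg h ε hε a ha => ?_⟩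
  set β : ℝ≥0∞ := (2 * B) ^ (1 / 2 : ℝ) with hβd
  have hβ : β ^ 2 = 2 * B := by
    rw [hβd, ← ENNReal.rpow_natCast, ← ENNReal.rpow_mul]
    norm_num
  -- The bound for `g F` applies to one fixed density, so the mid set, which varies with `z`, is
  -- replaced on the strip `n` by three adjacent strips. They contain every mid set with parameter
  -- `κ` and lie in every mid set with parameter `κ²`.
  set M : ℤ → Set ℂ := fun n => {ζ | b ^ (n - 1) ≤ ζ.im ∧ ζ.im < b ^ (n + 2)} with hM
  have hMm : ∀ n, MeasurableSet (M n) := fun n =>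
    (measurableSet_le measurable_const Complex.measurable_im).inter
    (measurableSet_lt Complex.measurable_im measurable_const)
  have han : ∀ n, IsTest ε ((M n).indicator a) := fun n => ha.indicator (hMm n)
  have hbz : ∀ n : ℤ, b ^ (n - 1) = κ * b ^ n := by
    intro n
    rw [zpow_sub_one₀ hb0.ne', hb, one_div, inv_inv, mul_comm]
  have hbz' : ∀ n : ℤ, b ^ n = κ * b ^ (n + 1) := by
    intro n
    have := hbz (n + 1)
    rwa [add_sub_cancel_right] at this
  set Q : ℂ → ℝ≥0∞ := fun z => (∫⁻ ζ, (midSet κ' z.im).indicator (kerP z) ζ * a ζ) ^ 2 with hQ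
  have hQm : Measurable Q := by
    refine Measurable.pow_const ?_ 2
    exact Measurable.lintegral_prod_right ((measurable_indicator_mid measurable_kerP κ').mul
      (ha.meas.coe_nnreal_ennreal.comp measurable_snd))
  have hpt : ∀ n, ∀ z ∈ strip b n,
      (∫⁻ ζ, (midSet κ z.im).indicator (weighted f g kerP z) ζ * a ζ) ^ 2 ≤
        2 * ‖g z * cauchyF (wt f ((M n).indicator a)) z‖ₑ ^ 2 +
          8 * (β * ENNReal.ofReal (4 / κ')) ^ 2 * Q z := by
    rintro n z ⟨hz1, hz2⟩
    have hbn : 0 < b ^ n := zpow_pos hb0 n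
    have hz0 : 0 < z.im := hbn.trans_le hz1
    have hmid : midSet κ z.im ⊆ M n := by
      rintro ζ ⟨h1, h2⟩
      rw [lt_div_iff₀ hκ] at h2
      refine ⟨?_, ?_⟩
      · rw [hbz]
        exact (mul_le_mul_of_nonneg_left hz1 hκ.le).trans h1.le
      · have h3 := hbz' (n + 1)
        rw [add_assoc, one_add_one_eq_two] at h3
        rw [h3] at hz2
        have := h2.trans hz2
        rw [mul_comm] at this
        exact lt_of_mul_lt_mul_left this hκ.le
    have hmid' : ∀ ζ, (M n).indicator a ζ ≠ 0 → ζ ∈ midSet κ' z.im := by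
      intro ζ hζ
      obtain ⟨h1, h2⟩ : ζ ∈ M n := mem_of_indicator_ne_zero hζ
      have h3 := hbz' (n + 1)
      rw [add_assoc, one_add_one_eq_two] at h3
      refine ⟨lt_of_lt_of_le ?_ h1, ?_⟩
      · rw [hbz, hbz' n, hκ', sq, mul_assoc]
        gcongr
      · refine h2.trans_le ?_
        rw [le_div_iff₀ hκ0', hκ']
        calc b ^ (n + 2) * κ ^ 2 = κ * (κ * b ^ (n + 2)) := by ring
          _ = b ^ n := by rw [← h3, ← hbz']
          _ ≤ z.im := hz1
    refine le_trans ?_ ((mid_pointwise hfm hf hg h hβ hε (han n) hκ0' hκ1' hz0 hmid').trans ?_)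
    · refine pow_le_pow_left' (lintegral_mono fun ζ => ?_) 2
      by_cases h1 : ζ ∈ midSet κ z.im
      · rw [indicator_of_mem h1, indicator_of_mem (hmid h1)]
      · rw [indicator_of_notMem h1, zero_mul]
        exact zero_le
    · simp only [hQ]
      gcongr with ζ
      exact indicator_le_self' (fun _ _ => zero_le) ζ
  have hstep : ∀ n, ∫⁻ z in strip b n,
      (∫⁻ ζ, (midSet κ z.im).indicator (weighted f g kerP z) ζ * a ζ) ^ 2 ≤
        2 * (B * ((∫⁻ z in strip b (n + -1), (a z : ℝ≥0∞) ^ 2) +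
          (∫⁻ z in strip b (n + 0), (a z : ℝ≥0∞) ^ 2) +
            ∫⁻ z in strip b (n + 1), (a z : ℝ≥0∞) ^ 2)) +
          8 * (β * ENNReal.ofReal (4 / κ')) ^ 2 * ∫⁻ z in strip b (n + 0), Q z := by
    intro n
    have hMsub : M n ⊆ (strip b (n + -1) ∪ strip b (n + 0)) ∪ strip b (n + 1) := by
      rintro z ⟨h1, h2⟩
      simp only [strip, mem_union, mem_ofPred_eq, add_zero, neg_add_cancel_right]
      rw [← sub_eq_add_neg, add_assoc n 1 1, one_add_one_eq_two]
      rcases lt_or_ge z.im (b ^ n) with h3 | h3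
      · exact Or.inl (Or.inl ⟨h1, h3⟩)
      rcases lt_or_ge z.im (b ^ (n + 1)) with h4 | h4
      · exact Or.inl (Or.inr ⟨h3, h4⟩)
      · exact Or.inr ⟨h4, h2⟩
    have hMa : ∫⁻ z, (((M n).indicator a z : ℝ≥0) : ℝ≥0∞) ^ 2 ≤
        (∫⁻ z in strip b (n + -1), (a z : ℝ≥0∞) ^ 2) +
          (∫⁻ z in strip b (n + 0), (a z : ℝ≥0∞) ^ 2) +
            ∫⁻ z in strip b (n + 1), (a z : ℝ≥0∞) ^ 2 := by
      calc _ = ∫⁻ z in M n, (a z : ℝ≥0∞) ^ 2 := by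
            rw [← lintegral_indicator (hMm n)]
            refine lintegral_congr fun z => ?_
            by_cases hz : z ∈ M n <;> simp [hz]
        _ ≤ _ := (lintegral_mono_set hMsub).trans ((lintegral_union_le _ _ _).trans
            (add_le_add_left (lintegral_union_le _ _ _) _))
    have hcross : ∫⁻ z in strip b n, ‖g z * cauchyF (wt f ((M n).indicator a)) z‖ₑ ^ 2 ≤
        B * ∫⁻ z, (((M n).indicator a z : ℝ≥0) : ℝ≥0∞) ^ 2 := by
      refine le_trans (lintegral_mono_set ?_) (h.lintegral_le hfm (han n) hε)
      rw [← iUnion_strip hb1]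
      exact subset_iUnion _ n
    calc _ ≤ ∫⁻ z in strip b n, (2 * ‖g z * cauchyF (wt f ((M n).indicator a)) z‖ₑ ^ 2 +
          8 * (β * ENNReal.ofReal (4 / κ')) ^ 2 * Q z) :=
          setLIntegral_mono' (measurableSet_strip b n) (hpt n)
      _ = 2 * (∫⁻ z in strip b n, ‖g z * cauchyF (wt f ((M n).indicator a)) z‖ₑ ^ 2) +
          8 * (β * ENNReal.ofReal (4 / κ')) ^ 2 * ∫⁻ z in strip b n, Q z := by
          rw [lintegral_add_right _ (hQm.const_mul _), lintegral_const_mul' _ _ (by norm_num),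
            lintegral_const_mul _ hQm]
      _ ≤ _ := by
          rw [add_zero] at hMa ⊢
          gcongr
          exact hcross.trans (by gcongr)
  calc _ ≤ ∫⁻ z in upper, (∫⁻ ζ, (midSet κ z.im).indicator (weighted f g kerP z) ζ * a ζ) ^ 2 :=
        lintegral_mono_set fun z hz => hε.trans_le hz
    _ ≤ ∑' n, (2 * (B * ((∫⁻ z in strip b (n + -1), (a z : ℝ≥0∞) ^ 2) +
          (∫⁻ z in strip b (n + 0), (a z : ℝ≥0∞) ^ 2) +
            ∫⁻ z in strip b (n + 1), (a z : ℝ≥0∞) ^ 2)) +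
          8 * (β * ENNReal.ofReal (4 / κ')) ^ 2 * ∫⁻ z in strip b (n + 0), Q z) := by
        rw [← tsum_lintegral_strip hb1 _ 0]
        simp only [add_zero] at hstep ⊢
        exact ENNReal.tsum_le_tsum hstep
    -- Each strip is adjacent to or equal to three strips, so summation counts the density three
    -- times.
    _ = 2 * (B * (3 * ∫⁻ z in upper, (a z : ℝ≥0∞) ^ 2)) +
        8 * (β * ENNReal.ofReal (4 / κ')) ^ 2 * ∫⁻ z in upper, Q z := by
        rw [ENNReal.tsum_add, ENNReal.tsum_mul_left, ENNReal.tsum_mul_left, ENNReal.tsum_mul_left,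
          ENNReal.tsum_add, ENNReal.tsum_add, tsum_lintegral_strip hb1, tsum_lintegral_strip hb1,
          tsum_lintegral_strip hb1, tsum_lintegral_strip hb1]
        ring
    _ ≤ 2 * (B * (3 * ∫⁻ z, (a z : ℝ≥0∞) ^ 2)) +
        8 * (β * ENNReal.ofReal (4 / κ')) ^ 2 *
          (ENNReal.ofReal (Real.pi / κ') ^ 2 * ∫⁻ ζ, (a ζ : ℝ≥0∞) ^ 2) := by
        gcongr
        · exact Measure.restrict_le_self
        · exact (setLIntegral_le_lintegral _ _).trans
            (lintegral_sq_kerP_midSet_le hκ0' hκ1' ha.meas.coe_nnreal_ennreal)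
    _ = _ := by
        rw [mul_pow, hβ, hD]
        ring

/-! ### Averages over discs and along horizontal lines -/

/-- Averages over discs of radius comparable with the height. -/
theorem lintegral_average_le {φ : ℂ → ℝ≥0∞} (hφ : Measurable φ) {c : ℝ} (hc : 0 < c)
    (hc1 : c ≤ 1 / 2) :
    ∫⁻ z in upper, (volume (ball z (c * z.im)))⁻¹ * ∫⁻ w in ball z (c * z.im), φ w ≤
      16 * ∫⁻ w in upper, φ w := by
  set E : Set (ℂ × ℂ) := {p | p.1 ∈ upper ∧ p.2 ∈ ball p.1 (c * p.1.im)} with hE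
  have hEm : MeasurableSet E := by
    refine (measurableSet_upper.preimage measurable_fst).inter ?_
    refine measurableSet_lt (measurable_snd.dist measurable_fst) ?_
    exact measurable_const.mul (Complex.measurable_im.comp measurable_fst)
  have hV : ∀ z : ℂ, ∀ r : ℝ, volume (ball z r) = ENNReal.ofReal r ^ 2 * NNReal.pi :=
    fun z r => Complex.volume_ball z r
  have hVm : Measurable fun z : ℂ => (volume (ball z (c * z.im)))⁻¹ := by
    simp only [hV]
    exact (((ENNReal.measurable_ofReal.comp
      (measurable_const.mul Complex.measurable_im)).pow_const 2).mul_const _).inv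
  have hm : Measurable (Function.uncurry fun z w =>
      E.indicator (fun p => (volume (ball p.1 (c * p.1.im)))⁻¹ * φ p.2) (z, w)) :=
    ((hVm.comp measurable_fst).mul (hφ.comp measurable_snd)).indicator hEm
  calc ∫⁻ z in upper, (volume (ball z (c * z.im)))⁻¹ * ∫⁻ w in ball z (c * z.im), φ w
      = ∫⁻ z, ∫⁻ w, E.indicator (fun p => (volume (ball p.1 (c * p.1.im)))⁻¹ * φ p.2) (z, w) := by
        rw [← lintegral_indicator measurableSet_upper]
        refine lintegral_congr fun z => ?_
        by_cases hz : z ∈ upper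
        · rw [indicator_of_mem hz, ← lintegral_indicator measurableSet_ball,
            ← lintegral_const_mul _ (hφ.indicator measurableSet_ball)]
          refine lintegral_congr fun w => ?_
          by_cases hw : w ∈ ball z (c * z.im)
          · rw [indicator_of_mem hw, indicator_of_mem (show (z, w) ∈ E from ⟨hz, hw⟩)]
          · rw [indicator_of_notMem hw, indicator_of_notMem (fun h : (z, w) ∈ E => hw h.2),
              mul_zero]
        · rw [indicator_of_notMem hz, ← lintegral_zero (μ := (volume : Measure ℂ))]
          exact lintegral_congr fun w => (indicator_of_notMem (fun h : (z, w) ∈ E => hz h.1) _).symm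
    _ = ∫⁻ w, ∫⁻ z, E.indicator (fun p => (volume (ball p.1 (c * p.1.im)))⁻¹ * φ p.2) (z, w) :=
        lintegral_lintegral_swap hm.aemeasurable
    _ ≤ ∫⁻ w, upper.indicator (fun w => 16 * φ w) w := by
        refine lintegral_mono fun w => ?_
        -- After Fubini, `z` ranges over a disc of radius `2c Im w` about `w`, while the discs
        -- averaged over have radius at least `c Im w / 2`. The ratio of areas is `16`.
        have hmem : ∀ z, (z, w) ∈ E → 0 < w.im ∧ w.im / 2 ≤ z.im ∧ z ∈ ball w (2 * c * w.im) := by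
          rintro z ⟨h1, h2⟩
          have h1 : 0 < z.im := h1
          have h3 := mem_ball_iff_norm.1 h2
          have h4 := (Complex.abs_im_le_norm (w - z)).trans_lt h3
          rw [Complex.sub_im, abs_lt] at h4
          have h5 : c * z.im ≤ 1 / 2 * z.im := by gcongr
          refine ⟨by linarith, by linarith, ?_⟩
          rw [mem_ball_iff_norm, norm_sub_rev]
          simp only at h3 h4
          have h6 : z.im ≤ 2 * w.im := by linarith
          calc ‖w - z‖ < c * z.im := h3
            _ ≤ c * (2 * w.im) := by gcongr
            _ = _ := by ring
        by_cases hw : w ∈ upper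
        · have hw0 : 0 < w.im := hw
          rw [indicator_of_mem hw]
          calc _ ≤ ∫⁻ z, (ball w (2 * c * w.im)).indicator
                (fun _ => (volume (ball w (c * (w.im / 2))))⁻¹ * φ w) z := by
                refine lintegral_mono fun z => ?_
                by_cases hz : (z, w) ∈ E
                · obtain ⟨-, h2, h3⟩ := hmem z hz
                  rw [indicator_of_mem hz, indicator_of_mem h3]
                  simp only [hV]
                  gcongr
                · rw [indicator_of_notMem hz]
                  exact zero_le
            _ = 16 * φ w := by
                rw [lintegral_indicator_const measurableSet_ball, mul_right_comm]
                congr 1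
                have e : volume (ball w (2 * c * w.im)) =
                    16 * volume (ball w (c * (w.im / 2))) := by
                  rw [hV, hV, show 2 * c * w.im = 4 * (c * (w.im / 2)) by ring,
                    ENNReal.ofReal_mul (by norm_num), ENNReal.ofReal_ofNat]
                  ring
                rw [e, mul_left_comm, ENNReal.inv_mul_cancel, mul_one]
                · exact (measure_ball_pos _ _ (by positivity)).ne'
                · exact measure_ball_lt_top.ne
        · rw [indicator_of_notMem hw, ← lintegral_zero (μ := (volume : Measure ℂ))]
          exact lintegral_mono fun z =>
            (indicator_of_notMem (fun h : (z, w) ∈ E => hw (hmem z h).1) _).le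
    _ = _ := by
        rw [lintegral_indicator measurableSet_upper, lintegral_const_mul' _ _ (by norm_num)]

/-- A dominating multiple of the Poisson kernel. -/
def lineKer (δ x : ℝ) : ℝ≥0∞ := ENNReal.ofReal (64 * δ / Real.pi * (1 / (x ^ 2 + δ ^ 2)))

theorem lintegral_lineKer {δ : ℝ} (hδ : 0 < δ) : ∫⁻ x, lineKer δ x = 64 := by
  have h := lintegral_inv_sq_add_sq hδ 0
  simp only [sub_zero] at h
  have h0 : 0 ≤ 64 * δ / Real.pi := by have := Real.pi_pos; positivity
  simp only [lineKer, ENNReal.ofReal_mul h0]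
  rw [lintegral_const_mul' _ _ ENNReal.ofReal_ne_top, h, ← ENNReal.ofReal_mul h0]
  have : 64 * δ / Real.pi * (Real.pi / δ) = 64 := by
    have := Real.pi_pos
    field_simp
  rw [this, ENNReal.ofReal_ofNat]

theorem measurable_lineKer : Measurable (Function.uncurry lineKer) := by
  unfold lineKer Function.uncurry
  fun_prop

/-- The decay of the modified kernel absorbs the cubic growth: `(1 + |x|/y)³ ≤ (1 + |x|/δ)⁴ ≤ 4 (x²
+ δ²)² / δ⁴`, which leaves `4 · 16 = 64` times the Poisson kernel. -/
theorem line_weight_le {δ y : ℝ} (hδ : 0 < δ) (hδy : δ ≤ y) (x : ℝ) :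
    16 * δ ^ 5 / (Real.pi * (x ^ 2 + δ ^ 2) ^ 3) * (1 + |x| / y) ^ 3 ≤
      64 * δ / Real.pi * (1 / (x ^ 2 + δ ^ 2)) := by
  have hpi := Real.pi_pos
  have hx := abs_nonneg x
  have h1 : (1 + |x| / y) ^ 3 ≤ 4 * (x ^ 2 + δ ^ 2) ^ 2 / δ ^ 4 := by
    have h2 : |x| / y ≤ |x| / δ := by gcongr
    have h3 : 1 ≤ 1 + |x| / δ := le_add_of_nonneg_right (by positivity)
    have h4 : (1 + |x| / δ) ^ 2 ≤ 2 * (x ^ 2 + δ ^ 2) / δ ^ 2 := by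
      rw [one_add_div hδ.ne', div_pow, ← sq_abs x]
      gcongr
      nlinarith [sq_nonneg (δ - |x|)]
    have h5 : 0 ≤ 1 + |x| / y := add_nonneg zero_le_one (div_nonneg hx (hδ.le.trans hδy))
    calc (1 + |x| / y) ^ 3 ≤ (1 + |x| / δ) ^ 3 := by gcongr
      _ ≤ (1 + |x| / δ) ^ 4 := pow_le_pow_right₀ h3 (by norm_num)
      _ = ((1 + |x| / δ) ^ 2) ^ 2 := by ring
      _ ≤ (2 * (x ^ 2 + δ ^ 2) / δ ^ 2) ^ 2 := by gcongr
      _ = _ := by ring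
  have hs : 0 < x ^ 2 + δ ^ 2 := by positivity
  calc _ ≤ 16 * δ ^ 5 / (Real.pi * (x ^ 2 + δ ^ 2) ^ 3) * (4 * (x ^ 2 + δ ^ 2) ^ 2 / δ ^ 4) := by
        gcongr
    _ = _ := by
        field_simp
        norm_num

theorem lintegral_comp_mul_left {G : ℝ → ℝ≥0∞} (hG : Measurable G) {θ : ℝ} (hθ : 0 < θ) :
    ∫⁻ y, G (θ * y) = ENNReal.ofReal θ⁻¹ * ∫⁻ y, G y := by
  have h := Real.map_volume_mul_left hθ.ne'
  rw [abs_of_pos (inv_pos.2 hθ)] at h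
  rw [← lintegral_map hG (measurable_const_mul θ), h, lintegral_smul_measure, smul_eq_mul]

/-- The averages along lower horizontal lines are bounded on `L²`. -/
theorem lintegral_line_sq_le {ψ : ℂ → ℝ≥0∞} (hψ : Measurable ψ) {θ ε : ℝ} (hθ : 0 < θ)
    (hθ1 : θ < 1) (hε : 0 < ε) :
    ∫⁻ z in {z : ℂ | ε ≤ θ * z.im}, (∫⁻ x : ℝ, lineKer ((1 - θ) * z.im) x *
      ψ ((z.re + x : ℝ) + (θ * z.im : ℝ) * Complex.I)) ^ 2 ≤
      64 ^ 2 * ENNReal.ofReal θ⁻¹ * ∫⁻ w in {w : ℂ | ε ≤ w.im}, ψ w ^ 2 := by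
  set Ψ : ℂ → ℝ≥0∞ := {w : ℂ | ε ≤ w.im}.indicator (fun w => ψ w ^ 2) with hΨ
  have hΨm : Measurable Ψ := (hψ.pow_const 2).indicator (measurableSet_le_im ε)
  have hset : MeasurableSet {z : ℂ | ε ≤ θ * z.im} :=
    measurableSet_le measurable_const (measurable_const.mul Complex.measurable_im)
  have hjoint : Measurable fun p : ℂ × ℝ => lineKer ((1 - θ) * p.1.im) p.2 *
      Ψ ((p.1.re + p.2 : ℝ) + (θ * p.1.im : ℝ) * Complex.I) := by
    refine (measurable_lineKer.comp (Measurable.prodMk ?_ measurable_snd)).mul (hΨm.comp ?_)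
    · fun_prop
    · fun_prop
  set J : ℂ → ℝ≥0∞ := fun z => {z : ℂ | ε ≤ θ * z.im}.indicator (fun z =>
    ∫⁻ x : ℝ, lineKer ((1 - θ) * z.im) x *
      Ψ ((z.re + x : ℝ) + (θ * z.im : ℝ) * Complex.I)) z with hJ
  have hJm : Measurable J := (Measurable.lintegral_prod_right hjoint).indicator hset
  have hΨi : ∀ {z : ℂ}, ε ≤ θ * z.im → ∀ x : ℝ,
      Ψ ((z.re + x : ℝ) + (θ * z.im : ℝ) * Complex.I) =
        ψ ((z.re + x : ℝ) + (θ * z.im : ℝ) * Complex.I) ^ 2 := by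
    intro z hz x
    rw [hΨ, indicator_of_mem]
    simpa using hz
  have hδ : ∀ {y : ℝ}, ε ≤ θ * y → 0 < (1 - θ) * y := by
    intro y hy
    have : 0 < y := by
      by_contra h
      nlinarith
    exact mul_pos (by linarith) this
  -- Cauchy–Schwarz against a kernel of mass `64`. Translation invariance of the horizontal integral
  -- then gives a second `64`, and the substitution `y ↦ θy` gives the factor `θ⁻¹`.
  calc _ ≤ ∫⁻ z in {z : ℂ | ε ≤ θ * z.im}, 64 * J z := by
        refine setLIntegral_mono' hset fun z hz => ?_
        refine (sq_lintegral_mul_le_weight ?_ ?_).trans ?_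
        · exact measurable_lineKer.of_uncurry_left
        · exact hψ.comp (by fun_prop)
        rw [lintegral_lineKer (hδ hz), hJ]
        simp only [indicator_of_mem hz, hΨi hz]
        exact le_rfl
    _ ≤ 64 * ∫⁻ z, J z := by
        rw [lintegral_const_mul _ hJm]
        gcongr
        exact Measure.restrict_le_self
    _ ≤ 64 * ∫⁻ y : ℝ, 64 * ∫⁻ x : ℝ, Ψ (x + (θ * y : ℝ) * Complex.I) := by
        rw [lintegral_eq_lintegral_re_im hJm]
        gcongr with y
        rcases le_or_gt ε (θ * y) with hy | hy
        · have e : ∀ x : ℝ, J (x + y * Complex.I) = ∫⁻ x' : ℝ, lineKer ((1 - θ) * y) x' *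
              Ψ ((x + x' : ℝ) + (θ * y : ℝ) * Complex.I) := by
            intro x
            rw [hJ]
            simp only
            rw [indicator_of_mem (by simpa using hy)]
            simp
          simp only [e]
          have hm2 : Measurable (Function.uncurry fun x x' : ℝ => lineKer ((1 - θ) * y) x' *
              Ψ ((x + x' : ℝ) + (θ * y : ℝ) * Complex.I)) := by
            refine Measurable.mul ?_ (hΨm.comp (by fun_prop))
            exact measurable_lineKer.of_uncurry_left.comp measurable_snd
          rw [lintegral_lintegral_swap hm2.aemeasurable]
          have hm3 : Measurable fun x : ℝ => Ψ (x + (θ * y : ℝ) * Complex.I) :=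
            hΨm.comp (by fun_prop)
          have e2 : ∀ x' : ℝ, ∫⁻ x : ℝ, lineKer ((1 - θ) * y) x' *
              Ψ ((x + x' : ℝ) + (θ * y : ℝ) * Complex.I) = lineKer ((1 - θ) * y) x' *
                ∫⁻ x : ℝ, Ψ (x + (θ * y : ℝ) * Complex.I) := by
            intro x'
            have hm5 : Measurable fun x : ℝ => Ψ ((x + x' : ℝ) + (θ * y : ℝ) * Complex.I) :=
              hΨm.comp (by fun_prop)
            rw [lintegral_const_mul _ hm5,
              lintegral_add_right_eq_self (fun x : ℝ => Ψ (x + (θ * y : ℝ) * Complex.I)) x']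
          simp only [e2]
          rw [lintegral_mul_const _ measurable_lineKer.of_uncurry_left, lintegral_lineKer (hδ hy)]
        · have e : ∀ x : ℝ, J (x + y * Complex.I) = 0 := by
            intro x
            rw [hJ]
            refine indicator_of_notMem ?_ _
            simpa using hy
          simp [e]
    _ = _ := by
        have hm4 : Measurable fun y : ℝ => ∫⁻ x : ℝ, Ψ (x + y * Complex.I) := by
          refine Measurable.lintegral_prod_right (f := fun y x : ℝ => Ψ (x + y * Complex.I)) ?_
          exact hΨm.comp (by fun_prop)
        rw [lintegral_const_mul' _ _ (by norm_num),
          lintegral_comp_mul_left (G := fun y : ℝ => ∫⁻ x : ℝ, Ψ (x + y * Complex.I)) hm4 hθ,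
          ← lintegral_eq_lintegral_re_im hΨm, hΨ, lintegral_indicator (measurableSet_le_im ε)]
        ring

/-! ### The contribution from far below -/

section Below

variable {f g : ℂ → ℂ} {a : ℂ → ℝ≥0} {ε : ℝ}

theorem weighted_indicator_eq (f g : ℂ → ℂ) (k : ℂ → ℂ → ℝ≥0∞) (a : ℂ → ℝ≥0) (S : Set ℂ)
    (z ζ : ℂ) : S.indicator (weighted f g k z) ζ * a ζ =
      weighted f g k z ζ * ((S.indicator a ζ : ℝ≥0) : ℝ≥0∞) := by
  by_cases h : ζ ∈ S <;> simp [h]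

theorem measurableSet_im_le (c : ℝ) : MeasurableSet {ζ : ℂ | ζ.im ≤ c} :=
  measurableSet_le Complex.measurable_im measurable_const

theorem lintegral_weighted_kerP (hfm : Measurable f) (hf : DifferentiableOn ℂ f upper)
    (ha : IsTest ε a) (hε : 0 < ε) {S : Set ℂ} (hS : MeasurableSet S) {z : ℂ} (hz : 0 < z.im) :
    ∫⁻ ζ, S.indicator (weighted f g kerP z) ζ * a ζ =
      ‖g z‖ₑ * ENNReal.ofReal (posP ((wt f a).restrict S) z) := by
  rw [wt_restrict f a hS, ofReal_posP hfm hf (ha.indicator hS) hε hz,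
    enorm_mul_lintegral_eq g hfm measurable_kerP (ha.indicator hS).meas]
  exact lintegral_congr fun ζ => weighted_indicator_eq f g kerP a S z ζ

theorem lintegral_weighted_kerH (hfm : Measurable f) (hf : DifferentiableOn ℂ f upper)
    (ha : IsTest ε a) (hε : 0 < ε) {S : Set ℂ} (hS : MeasurableSet S) {z : ℂ} (hz : 0 < z.im) :
    ∫⁻ ζ, S.indicator (weighted f g kerH z) ζ * a ζ =
      ‖g z‖ₑ * ENNReal.ofReal (posH ((wt f a).restrict S) z) := by
  rw [wt_restrict f a hS, ofReal_posH hfm hf (ha.indicator hS) hε hz,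
    enorm_mul_lintegral_eq g hfm measurable_kerH (ha.indicator hS).meas]
  exact lintegral_congr fun ζ => weighted_indicator_eq f g kerH a S z ζ

/-- Transfers the mid set of `z` to a point at height `y = θ Im z`, at the price of replacing `κ` by
`κθ`. -/
theorem midSet_div_subset {κ θ y : ℝ} (hκ : 0 < κ) (hθ : 0 < θ) (hθ1 : θ ≤ 1) (hy : 0 ≤ y) :
    midSet κ (y / θ) ⊆ midSet (κ * θ) y := by
  rintro ζ ⟨h1, h2⟩
  refine ⟨lt_of_le_of_lt ?_ h1, h2.trans_eq ?_⟩
  · rw [mul_assoc]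
    gcongr
    rw [le_div_iff₀ hθ]
    nlinarith [mul_le_of_le_one_right hy hθ1, mul_le_of_le_one_left hθ.le hθ1]
  · rw [div_div, mul_comm κ]

/-- The square of a pointwise estimate by an average. -/
theorem sq_le_of_mul_volume_le {X C r : ℝ} {h : ℂ → ℂ} {z : ℂ} (hr : 0 < r) (hX : 0 ≤ X)
    (hC : 0 ≤ C) (hm : AEMeasurable (fun w => ‖h w‖ₑ) (volume.restrict (ball z r)))
    (hle : X * volume.real (ball z r) ≤ C * ∫ w in ball z r, ‖h w‖) :
    ENNReal.ofReal X ^ 2 ≤ ENNReal.ofReal C ^ 2 *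
      ((volume (ball z r))⁻¹ * ∫⁻ w in ball z r, ‖h w‖ₑ ^ 2) := by
  set V := volume (ball z r) with hV
  have hV0 : V ≠ 0 := (measure_ball_pos _ _ hr).ne'
  have hV1 : V ≠ ∞ := measure_ball_lt_top.ne
  have h1 : ENNReal.ofReal X * V ≤ ENNReal.ofReal C * ∫⁻ w in ball z r, ‖h w‖ₑ := by
    have h2 := ENNReal.ofReal_le_ofReal hle
    rw [ENNReal.ofReal_mul hX, ENNReal.ofReal_mul hC, measureReal_def,
      ENNReal.ofReal_toReal hV1] at h2
    refine h2.trans ?_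
    gcongr
    have h3 := enorm_integral_le_lintegral_enorm (μ := volume.restrict (ball z r))
      (fun w => ‖h w‖)
    rw [Real.enorm_eq_ofReal (integral_nonneg fun _ => norm_nonneg _)] at h3
    simpa only [enorm_norm] using h3
  have h2 : (∫⁻ w in ball z r, ‖h w‖ₑ) ^ 2 ≤ V * ∫⁻ w in ball z r, ‖h w‖ₑ ^ 2 := by
    have := sq_lintegral_mul_le (μ := volume.restrict (ball z r)) (u := fun _ => 1)
      aemeasurable_const hm
    simpa only [one_mul, one_pow, lintegral_const, Measure.restrict_apply_univ] using this
  have h3 : ENNReal.ofReal X ^ 2 * V * V ≤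
      ENNReal.ofReal C ^ 2 * (∫⁻ w in ball z r, ‖h w‖ₑ ^ 2) * V := by
    calc ENNReal.ofReal X ^ 2 * V * V = (ENNReal.ofReal X * V) ^ 2 := by ring
      _ ≤ (ENNReal.ofReal C * ∫⁻ w in ball z r, ‖h w‖ₑ) ^ 2 := by gcongr
      _ = ENNReal.ofReal C ^ 2 * (∫⁻ w in ball z r, ‖h w‖ₑ) ^ 2 := by ring
      _ ≤ ENNReal.ofReal C ^ 2 * (V * ∫⁻ w in ball z r, ‖h w‖ₑ ^ 2) := by gcongr
      _ = _ := by ring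
  have h4 := (ENNReal.mul_le_mul_iff_left hV0 hV1).1 h3
  rw [mul_comm V⁻¹, ← mul_assoc, ← div_eq_mul_inv,
    ENNReal.le_div_iff_mul_le (Or.inl hV0) (Or.inl hV1)]
  exact h4

/-- The number `H(z)` is constant along the line, so it may be moved inside the Poisson-type
integral for `|g(z)|` and estimated by `h x` separately at each point `w`. There `|g(w)| P(w)` is
again the weighted positive operator, and `line_weight_le` absorbs the cubic factor. -/
theorem below_pointwise_line (hfm : Measurable f) (hf : DifferentiableOn ℂ f upper)
    (hg : DifferentiableOn ℂ g upper) (hgb : ∀ s > 0, ∃ K, ∀ w : ℂ, s ≤ w.im → ‖g w‖ ≤ K)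
    (ha : IsTest ε a) (hε : 0 < ε) {κ θ C : ℝ} (hκ : 0 < κ) (hθ : 0 < θ) (hθ1 : θ < 1)
    (hC : 0 ≤ C) {z : ℂ} (hz : 0 < z.im)
    (h : ∀ x : ℝ, posH ((wt f a).restrict {ζ | ζ.im ≤ κ * z.im}) z ≤
        9 * θ * (1 + |x| / z.im) ^ 3 *
          posP (wt f a) ((z.re + x : ℝ) + (θ * z.im : ℝ) * Complex.I) +
        C * posP ((wt f a).restrict (midSet κ z.im))
          ((z.re + x : ℝ) + (θ * z.im : ℝ) * Complex.I)) :
    ‖g z‖ₑ * ENNReal.ofReal (posH ((wt f a).restrict {ζ | ζ.im ≤ κ * z.im}) z) ≤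
      ∫⁻ x : ℝ, lineKer ((1 - θ) * z.im) x * (fun w =>
        ENNReal.ofReal (9 * θ) * (∫⁻ ζ, weighted f g kerP w ζ * a ζ) +
        ENNReal.ofReal C * ∫⁻ ζ, (midSet (κ * θ) w.im).indicator (weighted f g kerP w) ζ * a ζ)
        ((z.re + x : ℝ) + (θ * z.im : ℝ) * Complex.I) := by
  have hs : 0 < θ * z.im := mul_pos hθ hz
  have hs1 : θ * z.im < z.im := mul_lt_of_lt_one_left hz hθ1
  obtain ⟨K, hK⟩ := hgb _ hs
  have hδ : 0 < (1 - θ) * z.im := mul_pos (by linarith) hz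
  have hδy : (1 - θ) * z.im ≤ z.im := mul_le_of_le_one_left hz.le (by linarith)
  have key := norm_le_lintegral_line hs hs1 hg hK
  rw [show z.im - θ * z.im = (1 - θ) * z.im by ring] at key
  set δ := (1 - θ) * z.im with hδd
  set H := posH ((wt f a).restrict {ζ | ζ.im ≤ κ * z.im}) z with hH
  calc ‖g z‖ₑ * ENNReal.ofReal H ≤ (∫⁻ x : ℝ, ENNReal.ofReal (16 * δ ^ 5 / (Real.pi *
      (x ^ 2 + δ ^ 2) ^ 3)) * ‖g ((z.re + x : ℝ) + (θ * z.im : ℝ) * Complex.I)‖ₑ) *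
        ENNReal.ofReal H := by gcongr
    _ = ∫⁻ x : ℝ, ENNReal.ofReal (16 * δ ^ 5 / (Real.pi *
      (x ^ 2 + δ ^ 2) ^ 3)) * ‖g ((z.re + x : ℝ) + (θ * z.im : ℝ) * Complex.I)‖ₑ *
        ENNReal.ofReal H := (lintegral_mul_const' _ _ ENNReal.ofReal_ne_top).symm
    _ ≤ _ := by
      refine lintegral_mono fun x => ?_
      set w : ℂ := (z.re + x : ℝ) + (θ * z.im : ℝ) * Complex.I with hw
      have hwim : w.im = θ * z.im := by simp [hw]
      have hw0 : 0 < w.im := by rw [hwim]; exact hs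
      have e1 := lintegral_weighted_kerP (g := g) hfm hf ha hε MeasurableSet.univ hw0
      simp only [indicator_univ, Measure.restrict_univ] at e1
      have e2 := lintegral_weighted_kerP (g := g) hfm hf ha hε (measurableSet_midSet κ z.im) hw0
      have e3 : ∫⁻ ζ, (midSet κ z.im).indicator (weighted f g kerP w) ζ * a ζ ≤
          ∫⁻ ζ, (midSet (κ * θ) w.im).indicator (weighted f g kerP w) ζ * a ζ := by
        gcongr with ζ
        have hsub := midSet_div_subset hκ hθ hθ1.le hw0.le
        rw [show w.im / θ = z.im by rw [hwim, mul_div_cancel_left₀ _ hθ.ne']] at hsub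
        exact hsub
      simp only
      rw [e1]
      refine le_trans ?_ (mul_le_mul_right (add_le_add_right (mul_le_mul_right e3 _) _) _)
      rw [e2]
      set P := posP (wt f a) w with hP
      set Pm := posP ((wt f a).restrict (midSet κ z.im)) w with hPm
      have hP0 : 0 ≤ P := posP_nonneg _ _
      have hPm0 : 0 ≤ Pm := posP_nonneg _ _
      have hpi := Real.pi_pos
      set p := 16 * δ ^ 5 / (Real.pi * (x ^ 2 + δ ^ 2) ^ 3) with hp
      have hp0 : 0 ≤ p := by positivity
      set W := 64 * δ / Real.pi * (1 / (x ^ 2 + δ ^ 2)) with hW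
      have hW0 : 0 ≤ W := by positivity
      have hpW : p * (1 + |x| / z.im) ^ 3 ≤ W := line_weight_le hδ hδy x
      have h1 : 1 ≤ (1 + |x| / z.im) ^ 3 :=
        one_le_pow₀ (le_add_of_nonneg_right (by positivity))
      have hreal : p * H ≤ W * (9 * θ * P + C * Pm) := by
        calc p * H ≤ p * (9 * θ * (1 + |x| / z.im) ^ 3 * P + C * Pm) := by
              gcongr
              exact h x
          _ ≤ p * (9 * θ * (1 + |x| / z.im) ^ 3 * P + (1 + |x| / z.im) ^ 3 * (C * Pm)) := by
              have h2 : C * Pm ≤ (1 + |x| / z.im) ^ 3 * (C * Pm) :=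
                le_mul_of_one_le_left (mul_nonneg hC hPm0) h1
              exact mul_le_mul_of_nonneg_left (by linarith) hp0
          _ = p * (1 + |x| / z.im) ^ 3 * (9 * θ * P + C * Pm) := by ring
          _ ≤ _ := by gcongr
      calc ENNReal.ofReal p * ‖g w‖ₑ * ENNReal.ofReal H = ENNReal.ofReal (p * H) * ‖g w‖ₑ := by
            rw [ENNReal.ofReal_mul hp0]
            ring
        _ ≤ ENNReal.ofReal (W * (9 * θ * P + C * Pm)) * ‖g w‖ₑ := by gcongr
        _ = _ := by
            rw [ENNReal.ofReal_mul hW0, ENNReal.ofReal_add (by positivity) (by positivity),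
              ENNReal.ofReal_mul (p := 9 * θ) (by positivity), ENNReal.ofReal_mul hC, lineKer]
            ring

end Below

/-- The part of the operator with kernel `H` that comes from below is bounded, with a small
constant in terms of a bound of the full operator. -/
theorem below_bound : ∃ K : ℝ≥0∞, K ≠ ∞ ∧ ∀ θ : ℝ, 0 < θ → θ ≤ 1 / 4 → ∃ κ : ℝ, 0 < κ ∧ κ ≤ θ ∧
    ∃ C : ℝ≥0∞, C ≠ ∞ ∧ ∀ (f g : ℂ → ℂ) (B : ℝ≥0∞), Measurable f → DifferentiableOn ℂ f upper →
      Measurable g → DifferentiableOn ℂ g upper →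
      (∀ s > 0, ∃ K, ∀ w : ℂ, s ≤ w.im → ‖g w‖ ≤ K) → CauchyBound f g B →
      ∀ (ε : ℝ) (t : ℝ≥0∞), 0 < ε → KerBound ε (weighted f g kerP) t →
      KerBound ε (fun z ζ => {ζ : ℂ | ζ.im ≤ κ * z.im}.indicator (weighted f g kerH z) ζ)
        (K * ENNReal.ofReal θ * t + C * B) := by
  -- Here `64²` comes from the line averages, `2` from squaring a sum, and `81` from `θ⁻¹ (9θ)² =
  -- 81θ`. The surviving power of `θ` is what makes absorption possible.
  refine ⟨64 ^ 2 * (2 * 81), by finiteness, fun θ hθ hθ1 => ?_⟩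
  obtain ⟨κ, hκ, hκθ, C, hC, hdich⟩ := large_or_small hθ hθ1
  obtain ⟨Cm, hCm, hmid⟩ := mid_bound (mul_pos hκ hθ)
    (by nlinarith [mul_le_mul hκθ hθ1 hθ.le hθ.le] : κ * θ < 1)
  refine ⟨κ, hκ, hκθ, ENNReal.ofReal C ^ 2 * 16 + 64 ^ 2 * ENNReal.ofReal θ⁻¹ *
    (2 * (ENNReal.ofReal C ^ 2 * Cm)), by finiteness,
    fun f g B hfm hf hgm hg hgb h ε t hε ht a ha => ?_⟩
  have hfin := isFiniteMeasure_wt hf ha hε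
  have hA := wt_ae_nonneg hfm ha hε.le
  set A := wt f a with hAd
  have hacoe : Measurable fun ζ => (a ζ : ℝ≥0∞) := ha.meas.coe_nnreal_ennreal
  -- the three functions that occur in the pointwise estimates
  have hcont : ContinuousOn (fun w => ‖g w * cauchyF A w‖ₑ ^ 2) upper :=
    ENNReal.continuous_pow 2 |>.comp_continuousOn
      (hg.continuousOn.mul (differentiableOn_cauchyF hA).continuousOn).enorm
  set φ : ℂ → ℝ≥0∞ := upper.indicator fun w => ‖g w * cauchyF A w‖ₑ ^ 2 with hφ
  have hφm : Measurable φ := by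
    classical
    rw [hφ, ← piecewise_eq_indicator]
    exact hcont.measurable_piecewise continuous_zero.continuousOn measurableSet_upper
  set I1 : ℂ → ℝ≥0∞ := fun w => ∫⁻ ζ, weighted f g kerP w ζ * a ζ with hI1
  set I2 : ℂ → ℝ≥0∞ := fun w =>
    ∫⁻ ζ, (midSet (κ * θ) w.im).indicator (weighted f g kerP w) ζ * a ζ with hI2
  have hI1m : Measurable I1 := Measurable.lintegral_prod_right
    ((measurable_weighted hfm hgm measurable_kerP).mul (hacoe.comp measurable_snd))
  have hI2m : Measurable I2 := Measurable.lintegral_prod_right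
    ((measurable_indicator_mid (measurable_weighted hfm hgm measurable_kerP) _).mul
      (hacoe.comp measurable_snd))
  set ψ : ℂ → ℝ≥0∞ := fun w => ENNReal.ofReal (9 * θ) * I1 w + ENNReal.ofReal C * I2 w with hψ
  have hψm : Measurable ψ := (hI1m.const_mul _).add (hI2m.const_mul _)
  set c := θ / 8 with hc
  have hc0 : 0 < c := by positivity
  -- `T1` dominates at points where `F` can be divided out, and `T2` at points where `F` is small on
  -- the box.
  set T1 : ℂ → ℝ≥0∞ := fun z => ENNReal.ofReal C ^ 2 *
    ((volume (ball z (c * z.im)))⁻¹ * ∫⁻ w in ball z (c * z.im), φ w) with hT1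
  set T2 : ℂ → ℝ≥0∞ := {z : ℂ | ε ≤ θ * z.im}.indicator fun z => (∫⁻ x : ℝ,
    lineKer ((1 - θ) * z.im) x * ψ ((z.re + x : ℝ) + (θ * z.im : ℝ) * Complex.I)) ^ 2 with hT2
  have hset : MeasurableSet {z : ℂ | ε ≤ θ * z.im} :=
    measurableSet_le measurable_const (measurable_const.mul Complex.measurable_im)
  have hT2m : Measurable T2 := by
    refine Measurable.indicator (Measurable.pow_const ?_ 2) hset
    refine Measurable.lintegral_prod_right (f := fun (z : ℂ) (x : ℝ) =>
      lineKer ((1 - θ) * z.im) x * ψ ((z.re + x : ℝ) + (θ * z.im : ℝ) * Complex.I)) ?_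
    refine (measurable_lineKer.comp (Measurable.prodMk ?_ measurable_snd)).mul (hψm.comp ?_)
    · fun_prop
    · fun_prop
  have hpt : ∀ z ∈ {z : ℂ | ε ≤ z.im}, (∫⁻ ζ,
      {ζ : ℂ | ζ.im ≤ κ * z.im}.indicator (weighted f g kerH z) ζ * a ζ) ^ 2 ≤ T1 z + T2 z := by
    intro z hz
    have hz0 : 0 < z.im := hε.trans_le hz
    rw [lintegral_weighted_kerH hfm hf ha hε (measurableSet_im_le _) hz0, ← hAd]
    rcases hdich A hA g hg z hz0 with h1 | h1
    · refine le_trans ?_ le_self_add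
      have hr : 0 < θ * z.im / 8 := by positivity
      have hsub : ball z (θ * z.im / 8) ⊆ upper := by
        intro w hw
        refine lt_of_lt_of_le (half_pos hz0) (half_im_le_im_of_mem_closedBall (c := z) ?_ w
          (ball_subset_closedBall hw))
        nlinarith
      have hm : AEMeasurable (fun w => ‖g w * cauchyF A w‖ₑ)
          (volume.restrict (ball z (θ * z.im / 8))) :=
        ((hg.continuousOn.mul (differentiableOn_cauchyF hA).continuousOn).enorm.mono
          hsub).aemeasurable measurableSet_ball
      have h2 := sq_le_of_mul_volume_le hr (mul_nonneg (norm_nonneg _) (posP_nonneg A z)) hC hm h1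
      have h3 : posH (A.restrict {ζ | ζ.im ≤ κ * z.im}) z ≤ posP A z :=
        (posH_restrict_le hA hz0 _).trans (posH_le_posP hA hz0)
      calc _ ≤ ENNReal.ofReal (‖g z‖ * posP A z) ^ 2 := by
            rw [ENNReal.ofReal_mul (norm_nonneg _), ofReal_norm]
            gcongr
        _ ≤ _ := h2
        _ = T1 z := by
            rw [hT1]
            simp only
            rw [show c * z.im = θ * z.im / 8 by rw [hc]; ring]
            congr 2
            refine setLIntegral_congr_fun measurableSet_ball fun w hw => ?_
            rw [hφ, indicator_of_mem (hsub hw)]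
    · refine le_trans ?_ le_add_self
      rcases le_or_gt ε (θ * z.im) with h2 | h2
      · have h2' : z ∈ {z : ℂ | ε ≤ θ * z.im} := h2
        rw [hT2, indicator_of_mem h2']
        gcongr
        exact below_pointwise_line hfm hf hg hgb ha hε hκ hθ (by linarith) hC hz0 h1
      -- If the lower line lies below height `ε`, then, as `κ ≤ θ`, the density has no mass at
      -- heights up to `κ Im z`.
      · have h3 : A.restrict {ζ | ζ.im ≤ κ * z.im} = 0 := by
          rw [Measure.restrict_eq_zero, ← compl_compl {ζ : ℂ | ζ.im ≤ κ * z.im}]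
          refine (wt_ae hfm ha).mono fun ζ hζ => ?_
          simp only [mem_ofPred_eq, not_le]
          refine lt_of_lt_of_le (lt_of_le_of_lt ?_ h2) hζ
          gcongr
        rw [h3, posH]
        simp
  calc _ ≤ ∫⁻ z in {z : ℂ | ε ≤ z.im}, (T1 z + T2 z) :=
        setLIntegral_mono' (measurableSet_le_im ε) hpt
    _ = (∫⁻ z in {z : ℂ | ε ≤ z.im}, T1 z) + ∫⁻ z in {z : ℂ | ε ≤ z.im}, T2 z :=
        lintegral_add_right _ hT2m
    _ ≤ ENNReal.ofReal C ^ 2 * (16 * (B * ∫⁻ ζ, (a ζ : ℝ≥0∞) ^ 2)) +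
        64 ^ 2 * ENNReal.ofReal θ⁻¹ * (2 * (ENNReal.ofReal (9 * θ) ^ 2 *
          (t * ∫⁻ ζ, (a ζ : ℝ≥0∞) ^ 2) +
          ENNReal.ofReal C ^ 2 * (Cm * B * ∫⁻ ζ, (a ζ : ℝ≥0∞) ^ 2))) := by
        refine add_le_add ?_ ?_
        · calc ∫⁻ z in {z : ℂ | ε ≤ z.im}, T1 z ≤ ∫⁻ z in upper, T1 z :=
                lintegral_mono_set fun z hz => hε.trans_le hz
            _ = ENNReal.ofReal C ^ 2 * ∫⁻ z in upper, (volume (ball z (c * z.im)))⁻¹ *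
                  ∫⁻ w in ball z (c * z.im), φ w :=
                lintegral_const_mul' _ _ (by finiteness)
            _ ≤ ENNReal.ofReal C ^ 2 * (16 * ∫⁻ w in upper, φ w) := by
                gcongr
                exact lintegral_average_le hφm hc0 (by rw [hc]; linarith)
            _ ≤ _ := by
                gcongr
                refine le_trans (le_of_eq ?_) (h.lintegral_le hfm ha hε)
                refine setLIntegral_congr_fun measurableSet_upper fun w hw => ?_
                rw [hφ, indicator_of_mem hw]
        · calc ∫⁻ z in {z : ℂ | ε ≤ z.im}, T2 z ≤ ∫⁻ z, T2 z := setLIntegral_le_lintegral _ _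
            _ ≤ 64 ^ 2 * ENNReal.ofReal θ⁻¹ * ∫⁻ w in {w : ℂ | ε ≤ w.im}, ψ w ^ 2 := by
                rw [hT2, lintegral_indicator hset]
                exact lintegral_line_sq_le hψm hθ (by linarith) hε
            _ ≤ 64 ^ 2 * ENNReal.ofReal θ⁻¹ * ∫⁻ w in {w : ℂ | ε ≤ w.im},
                  2 * (ENNReal.ofReal (9 * θ) ^ 2 * I1 w ^ 2 +
                    ENNReal.ofReal C ^ 2 * I2 w ^ 2) := by
                gcongr with w
                refine (ENNReal.sq_add_le _ _).trans (le_of_eq ?_)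
                rw [mul_pow, mul_pow]
            _ = 64 ^ 2 * ENNReal.ofReal θ⁻¹ * (2 * (ENNReal.ofReal (9 * θ) ^ 2 *
                  (∫⁻ w in {w : ℂ | ε ≤ w.im}, I1 w ^ 2) +
                    ENNReal.ofReal C ^ 2 * ∫⁻ w in {w : ℂ | ε ≤ w.im}, I2 w ^ 2)) := by
                rw [lintegral_const_mul' _ _ (by norm_num),
                  lintegral_add_left ((hI1m.pow_const 2).const_mul _),
                  lintegral_const_mul _ (hI1m.pow_const 2),
                  lintegral_const_mul _ (hI2m.pow_const 2)]
            _ ≤ _ := by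
                gcongr
                · exact ht a ha
                · exact hmid f g B hfm hf hgm hg h ε hε a ha
    _ = _ := by
        have e : ENNReal.ofReal θ⁻¹ * ENNReal.ofReal (9 * θ) ^ 2 = 81 * ENNReal.ofReal θ := by
          rw [← ENNReal.ofReal_pow (by positivity), ← ENNReal.ofReal_mul (by positivity),
            show θ⁻¹ * (9 * θ) ^ 2 = 81 * θ by field_simp; norm_num,
            ENNReal.ofReal_mul (by norm_num), ENNReal.ofReal_ofNat]
        calc _ = (∫⁻ ζ, (a ζ : ℝ≥0∞) ^ 2) * (ENNReal.ofReal C ^ 2 * 16 * B + 64 ^ 2 *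
            (2 * ((ENNReal.ofReal θ⁻¹ * ENNReal.ofReal (9 * θ) ^ 2) * t)) +
            64 ^ 2 * ENNReal.ofReal θ⁻¹ * (2 * (ENNReal.ofReal C ^ 2 * Cm)) * B) := by ring
          _ = _ := by
            rw [e]
            ring

/-! ### Absorption and iteration -/

theorem exists_small_mul_le {K : ℝ≥0∞} (hK : K ≠ ∞) {δ : ℝ} (hδ : 0 < δ) :
    ∃ θ : ℝ, 0 < θ ∧ θ ≤ 1 / 4 ∧ K * ENNReal.ofReal θ ≤ ENNReal.ofReal δ := by
  have hK0 : 0 ≤ K.toReal := ENNReal.toReal_nonneg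
  refine ⟨min (1 / 4) (δ / (K.toReal + 1)), by positivity, min_le_left _ _, ?_⟩
  nth_rewrite 1 [← ENNReal.ofReal_toReal hK]
  rw [← ENNReal.ofReal_mul hK0]
  refine ENNReal.ofReal_le_ofReal ?_
  calc K.toReal * min (1 / 4) (δ / (K.toReal + 1)) ≤ (K.toReal + 1) * (δ / (K.toReal + 1)) := by
        gcongr
        · linarith
        · exact min_le_right _ _
    _ = δ := by field_simp

/-- Follows from `P ≤ |F| + 2H`. At comparable heights `H` is simply replaced by `P`, which
`mid_bound` controls, so the kernel `H` matters only far below and far above. -/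
theorem lintegral_weighted_le_add {f g : ℂ → ℂ} {ε κ : ℝ} {a : ℂ → ℝ≥0}
    (hfm : Measurable f) (hf : DifferentiableOn ℂ f upper) (hgm : Measurable g)
    (ha : IsTest ε a) (hε : 0 < ε) {z : ℂ} (hz : 0 < z.im) :
    ∫⁻ ζ, weighted f g kerP z ζ * a ζ ≤ ‖g z * cauchyF (wt f a) z‖ₑ +
      2 * ((∫⁻ ζ, {ζ : ℂ | ζ.im ≤ κ * z.im}.indicator (weighted f g kerH z) ζ * a ζ) +
        (∫⁻ ζ, (midSet κ z.im).indicator (weighted f g kerP z) ζ * a ζ) +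
        ∫⁻ ζ, {ζ : ℂ | z.im / κ ≤ ζ.im}.indicator (weighted f g kerH z) ζ * a ζ) := by
  have h1 : ∫⁻ ζ, weighted f g kerP z ζ * a ζ ≤ ‖g z * cauchyF (wt f a) z‖ₑ +
      2 * ∫⁻ ζ, weighted f g kerH z ζ * a ζ := by
    rw [← enorm_mul_lintegral_eq g hfm measurable_kerP ha.meas,
      ← enorm_mul_lintegral_eq g hfm measurable_kerH ha.meas, ← ofReal_posP hfm hf ha hε hz,
      ← ofReal_posH hfm hf ha hε hz, enorm_mul]
    have h2 := ENNReal.ofReal_le_ofReal (posP_le_norm_cauchyF_add hfm hf ha hε hz)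
    rw [ENNReal.ofReal_add (norm_nonneg _) (mul_nonneg zero_le_two (posH_nonneg _ _)),
      ofReal_norm, ENNReal.ofReal_mul zero_le_two, ENNReal.ofReal_ofNat] at h2
    refine (mul_le_mul_right h2 _).trans (le_of_eq ?_)
    ring
  refine h1.trans ?_
  have hacoe : Measurable fun ζ => (a ζ : ℝ≥0∞) := ha.meas.coe_nnreal_ennreal
  have hwH := (measurable_weighted hfm hgm measurable_kerH).of_uncurry_left (x := z)
  have hwP := (measurable_weighted hfm hgm measurable_kerP).of_uncurry_left (x := z)
  have hm1 : Measurable fun ζ =>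
      {ζ : ℂ | ζ.im ≤ κ * z.im}.indicator (weighted f g kerH z) ζ * a ζ :=
    (hwH.indicator (measurableSet_im_le _)).mul hacoe
  have hm2 : Measurable fun ζ => (midSet κ z.im).indicator (weighted f g kerP z) ζ * a ζ :=
    (hwP.indicator (measurableSet_midSet _ _)).mul hacoe
  have hm3 : Measurable fun ζ =>
      {ζ : ℂ | ζ.im ≤ κ * z.im}.indicator (weighted f g kerH z) ζ * a ζ +
        (midSet κ z.im).indicator (weighted f g kerP z) ζ * a ζ := hm1.add hm2
  rw [← lintegral_add_left hm1, ← lintegral_add_left hm3]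
  gcongr with ζ
  rw [← add_mul, ← add_mul]
  by_cases h0 : a ζ = 0
  · simp [h0]
  obtain ⟨R, hR⟩ := ha.supp
  have hζ : 0 ≤ ζ.im := hε.le.trans (hR ζ h0).1
  gcongr
  by_cases hb : ζ ∈ {ζ : ℂ | ζ.im ≤ κ * z.im}
  · rw [indicator_of_mem hb, add_assoc]
    exact le_self_add
  by_cases hc : ζ ∈ {ζ : ℂ | z.im / κ ≤ ζ.im}
  · rw [indicator_of_mem hc]
    exact le_add_self
  · have hm : ζ ∈ midSet κ z.im := ⟨not_le.1 hb, not_le.1 hc⟩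
    rw [indicator_of_notMem hb, indicator_of_notMem hc, indicator_of_mem hm, zero_add, add_zero,
      weighted, weighted]
    gcongr
    exact kerH_le_kerP hz.le hζ

theorem ENNReal.sq_four_le (u v w x : ℝ≥0∞) :
    (u + 2 * (v + w + x)) ^ 2 ≤ 4 * u ^ 2 + 16 * v ^ 2 + 16 * w ^ 2 + 16 * x ^ 2 := by
  calc (u + 2 * (v + w + x)) ^ 2 = ((u + 2 * v) + (2 * w + 2 * x)) ^ 2 := by ring
    _ ≤ 2 * ((u + 2 * v) ^ 2 + (2 * w + 2 * x) ^ 2) := ENNReal.sq_add_le _ _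
    _ ≤ 2 * (2 * (u ^ 2 + (2 * v) ^ 2) + 2 * ((2 * w) ^ 2 + (2 * x) ^ 2)) := by
        gcongr <;> exact ENNReal.sq_add_le _ _
    _ = _ := by ring

theorem measurableSet_below (κ : ℝ) : MeasurableSet {p : ℂ × ℂ | p.2.im ≤ κ * p.1.im} :=
  measurableSet_le (Complex.measurable_im.comp measurable_snd)
    (measurable_const.mul (Complex.measurable_im.comp measurable_fst))

theorem measurable_below {k : ℂ → ℂ → ℝ≥0∞} (hk : Measurable (Function.uncurry k)) (κ : ℝ) :
    Measurable (Function.uncurry fun z ζ : ℂ => {ζ : ℂ | ζ.im ≤ κ * z.im}.indicator (k z) ζ) := by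
  convert hk.indicator (measurableSet_below κ) using 1
  ext p
  simp [indicator, Function.uncurry]

/-- The absorption step: any bound of the positive operator may be improved. -/
theorem exists_kerBound_step : ∃ M : ℝ≥0∞, M ≠ ∞ ∧ ∀ (f g : ℂ → ℂ) (B : ℝ≥0∞),
    Measurable f → DifferentiableOn ℂ f upper → Measurable g → DifferentiableOn ℂ g upper →
      (∀ s > 0, ∃ K, ∀ w : ℂ, s ≤ w.im → ‖f w‖ ≤ K) →
      (∀ s > 0, ∃ K, ∀ w : ℂ, s ≤ w.im → ‖g w‖ ≤ K) → CauchyBound f g B → CauchyBound g f B →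
      ∀ (ε : ℝ) (t : ℝ≥0∞), 0 < ε → KerBound ε (weighted f g kerP) t →
        KerBound ε (weighted g f kerP) t → KerBound ε (weighted f g kerP) (t / 2 + M * B) := by
  obtain ⟨K, hK, hbelow⟩ := below_bound
  -- The below and above parts each enter with the factor `16`, so `32 · (1/64) = 1/2`.
  obtain ⟨θ, hθ, hθ1, hKθ⟩ := exists_small_mul_le hK (δ := 1 / 64) (by norm_num)
  obtain ⟨κ, hκ, hκθ, C, hC, hb⟩ := hbelow θ hθ hθ1
  obtain ⟨Cm, hCm, hmid⟩ := mid_bound hκ (by linarith : κ < 1)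
  refine ⟨4 + 32 * C + 16 * Cm, by finiteness, ?_⟩
  intro f g B hfm hf hgm hg hfb hgb h h' ε t hε ht ht' a ha
  have hacoe : Measurable fun ζ => (a ζ : ℝ≥0∞) := ha.meas.coe_nnreal_ennreal
  have b1 := hb f g B hfm hf hgm hg hgb h ε t hε ht a ha
  have b2 := hmid f g B hfm hf hgm hg h ε hε a ha
  -- The above part for `(f, g)` is the transpose of the below part for `(g, f)`. This is why both
  -- analytic operators must be bounded.
  have b3 := (hb g f B hgm hg hfm hf hfb h' ε t hε ht').swap
    (measurable_below (measurable_weighted hgm hfm measurable_kerH) κ) a ha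
  have b0 := h.lintegral_le hfm ha hε
  have e3 : ∀ z ζ : ℂ, {w : ℂ | w.im ≤ κ * ζ.im}.indicator (weighted g f kerH ζ) z =
      {w : ℂ | z.im / κ ≤ w.im}.indicator (weighted f g kerH z) ζ := by
    intro z ζ
    have hiff : z ∈ {w : ℂ | w.im ≤ κ * ζ.im} ↔ ζ ∈ {w : ℂ | z.im / κ ≤ w.im} := by
      simp only [mem_ofPred_eq, div_le_iff₀' hκ]
    by_cases hz : z ∈ {w : ℂ | w.im ≤ κ * ζ.im}
    · rw [indicator_of_mem hz, indicator_of_mem (hiff.1 hz), weighted, weighted, kerH_comm]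
      ring
    · rw [indicator_of_notMem hz, indicator_of_notMem (fun h => hz (hiff.2 h))]
  simp only [e3] at b3
  set Xb : ℂ → ℝ≥0∞ := fun z =>
    ∫⁻ ζ, {ζ : ℂ | ζ.im ≤ κ * z.im}.indicator (weighted f g kerH z) ζ * a ζ with hXb
  set Xm : ℂ → ℝ≥0∞ := fun z =>
    ∫⁻ ζ, (midSet κ z.im).indicator (weighted f g kerP z) ζ * a ζ with hXm
  set Xa : ℂ → ℝ≥0∞ := fun z =>
    ∫⁻ ζ, {ζ : ℂ | z.im / κ ≤ ζ.im}.indicator (weighted f g kerH z) ζ * a ζ with hXa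
  have hXbm : Measurable Xb := Measurable.lintegral_prod_right
    ((measurable_below (measurable_weighted hfm hgm measurable_kerH) κ).mul
      (hacoe.comp measurable_snd))
  have hXmm : Measurable Xm := Measurable.lintegral_prod_right
    ((measurable_indicator_mid (measurable_weighted hfm hgm measurable_kerP) κ).mul
      (hacoe.comp measurable_snd))
  have hXam : Measurable Xa := by
    have := (measurable_below (measurable_weighted hgm hfm measurable_kerH) κ).comp measurable_swap
    refine Measurable.lintegral_prod_right (f := fun z ζ =>
      {ζ : ℂ | z.im / κ ≤ ζ.im}.indicator (weighted f g kerH z) ζ * a ζ) ?_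
    simp only [← e3]
    exact this.mul (hacoe.comp measurable_snd)
  set N := ∫⁻ ζ, (a ζ : ℝ≥0∞) ^ 2 with hN
  calc ∫⁻ z in {z : ℂ | ε ≤ z.im}, (∫⁻ ζ, weighted f g kerP z ζ * a ζ) ^ 2
      ≤ ∫⁻ z in {z : ℂ | ε ≤ z.im}, (4 * ‖g z * cauchyF (wt f a) z‖ₑ ^ 2 + 16 * Xb z ^ 2 +
          16 * Xm z ^ 2 + 16 * Xa z ^ 2) := by
        refine setLIntegral_mono' (measurableSet_le_im ε) fun z hz => ?_
        refine le_trans ?_ (ENNReal.sq_four_le _ _ _ _)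
        gcongr
        exact lintegral_weighted_le_add hfm hf hgm ha hε (hε.trans_le hz)
    _ = 4 * (∫⁻ z in {z : ℂ | ε ≤ z.im}, ‖g z * cauchyF (wt f a) z‖ₑ ^ 2) +
          16 * (∫⁻ z in {z : ℂ | ε ≤ z.im}, Xb z ^ 2) +
          16 * (∫⁻ z in {z : ℂ | ε ≤ z.im}, Xm z ^ 2) +
          16 * ∫⁻ z in {z : ℂ | ε ≤ z.im}, Xa z ^ 2 := by
        rw [lintegral_add_right _ ((hXam.pow_const 2).const_mul _),
          lintegral_add_right _ ((hXmm.pow_const 2).const_mul _),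
          lintegral_add_right _ ((hXbm.pow_const 2).const_mul _),
          lintegral_const_mul' _ _ (by norm_num), lintegral_const_mul' _ _ (by norm_num),
          lintegral_const_mul' _ _ (by norm_num), lintegral_const_mul' _ _ (by norm_num)]
    _ ≤ 4 * (B * N) + 16 * ((K * ENNReal.ofReal θ * t + C * B) * N) + 16 * (Cm * B * N) +
          16 * ((K * ENNReal.ofReal θ * t + C * B) * N) := by
        gcongr
        exact (lintegral_mono_set fun z hz => hε.trans_le hz).trans b0
    _ = (32 * (K * ENNReal.ofReal θ) * t + (4 + 32 * C + 16 * Cm) * B) * N := by ring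
    _ ≤ (32 * ENNReal.ofReal (1 / 64) * t + (4 + 32 * C + 16 * Cm) * B) * N := by gcongr
    _ = _ := by
        congr 2
        rw [show (32 : ℝ≥0∞) = ENNReal.ofReal 32 by norm_num, ← ENNReal.ofReal_mul (by norm_num),
          show (32 : ℝ) * (1 / 64) = 2⁻¹ by norm_num, ENNReal.ofReal_inv_of_pos (by norm_num),
          ENNReal.ofReal_ofNat, ENNReal.div_eq_inv_mul]

/-- The sub-mean value property over discs of radius `s`, all contained in the half plane. The
Poisson-type formula needs such bounds, but they do not enter the final constant. -/
theorem enorm_le_of_lintegral_sq {g : ℂ → ℂ} (hg : DifferentiableOn ℂ g upper)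
    (hg2 : ∫⁻ w in upper, ‖g w‖ₑ ^ 2 ≠ ∞) (s : ℝ) (hs : 0 < s) :
    ∃ K, ∀ w : ℂ, s ≤ w.im → ‖g w‖ ≤ K := by
  set V := volume (ball (0 : ℂ) s) with hV
  have hV0 : V ≠ 0 := (measure_ball_pos _ _ hs).ne'
  have hV1 : V ≠ ∞ := measure_ball_lt_top.ne
  set I := ∫⁻ w in upper, ‖g w‖ₑ ^ 2 with hI
  have hfin : I / V ≠ ∞ := ENNReal.div_ne_top hg2 hV0
  refine ⟨Real.sqrt (I / V).toReal, fun w hw => Real.le_sqrt_of_sq_le ?_⟩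
  have hsub : ball w s ⊆ upper := by
    intro ζ hζ
    have h1 := (Complex.abs_im_le_norm (ζ - w)).trans_lt (mem_ball_iff_norm.1 hζ)
    rw [Complex.sub_im, abs_lt] at h1
    have : 0 < ζ.im := by linarith
    exact this
  have h1 := (enorm_sq_mul_volume_le (hg.mono hsub)).trans (lintegral_mono_set hsub)
  rw [show volume (ball w s) = V by rw [hV, Complex.volume_ball, Complex.volume_ball],
    ← ENNReal.le_div_iff_mul_le (Or.inl hV0) (Or.inl hV1)] at h1
  have h2 := ENNReal.toReal_mono hfin h1
  rwa [ENNReal.toReal_pow, toReal_enorm] at h2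

/-- An a priori bound. -/
theorem kerBound_of_lintegral_sq {f g : ℂ → ℂ} (hfm : Measurable f) (hgm : Measurable g)
    {ε : ℝ} (hε : 0 < ε) : KerBound ε (weighted f g kerP) (ENNReal.ofReal (1 / ε ^ 2) ^ 2 *
      (∫⁻ w in upper, ‖f w‖ₑ ^ 2) * ∫⁻ w in upper, ‖g w‖ₑ ^ 2) := by
  intro a ha
  have hacoe : Measurable fun ζ => (a ζ : ℝ≥0∞) := ha.meas.coe_nnreal_ennreal
  obtain ⟨R, hR⟩ := ha.supp
  set c := ENNReal.ofReal (1 / ε ^ 2) with hc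
  set F := ∫⁻ w in upper, ‖f w‖ₑ ^ 2 with hF
  set N := ∫⁻ ζ, (a ζ : ℝ≥0∞) ^ 2 with hN
  have h1 : (∫⁻ ζ, ‖f ζ‖ₑ * a ζ) ^ 2 ≤ F * N := by
    have e : ∫⁻ ζ, ‖f ζ‖ₑ * a ζ = ∫⁻ ζ in upper, ‖f ζ‖ₑ * a ζ := by
      rw [← lintegral_indicator measurableSet_upper]
      refine lintegral_congr fun ζ => ?_
      by_cases hζ : ζ ∈ upper
      · rw [indicator_of_mem hζ]
      · rw [indicator_of_notMem hζ]
        have : a ζ = 0 := by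
          by_contra h0
          exact hζ (hε.trans_le (hR ζ h0).1)
        simp [this]
    rw [e]
    refine (sq_lintegral_mul_le hfm.enorm.aemeasurable hacoe.aemeasurable).trans ?_
    gcongr
    exact setLIntegral_le_lintegral _ _
  calc _ ≤ ∫⁻ z in {z : ℂ | ε ≤ z.im}, c ^ 2 * (F * N) * ‖g z‖ₑ ^ 2 := by
        refine setLIntegral_mono' (measurableSet_le_im ε) fun z hz => ?_
        have hz : ε ≤ z.im := hz
        have hk : ∀ ζ, weighted f g kerP z ζ * a ζ ≤ (‖g z‖ₑ * c) * (‖f ζ‖ₑ * a ζ) := by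
          intro ζ
          by_cases h0 : a ζ = 0
          · simp [h0]
          rw [← mul_assoc, weighted]
          -- On the truncated half plane `‖z - ζ̄‖ ≥ Im z + Im ζ ≥ ε`, so the operator is dominated
          -- by one of rank one.
          have h4 : kerP z ζ ≤ c := by
            refine ENNReal.ofReal_le_ofReal ?_
            have h2 := im_add_im_le_norm (z := z) (ζ := ζ)
            have h3 := (hR ζ h0).1
            gcongr
            linarith
          gcongr
        have hm : Measurable fun ζ => ‖f ζ‖ₑ * a ζ := hfm.enorm.mul hacoe
        calc _ ≤ (∫⁻ ζ, (‖g z‖ₑ * c) * (‖f ζ‖ₑ * a ζ)) ^ 2 :=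
              pow_le_pow_left' (lintegral_mono hk) 2
          _ = ‖g z‖ₑ ^ 2 * c ^ 2 * (∫⁻ ζ, ‖f ζ‖ₑ * a ζ) ^ 2 := by
              rw [lintegral_const_mul _ hm]
              ring
          _ ≤ ‖g z‖ₑ ^ 2 * c ^ 2 * (F * N) := by gcongr
          _ = _ := by ring
    _ ≤ ∫⁻ z in upper, c ^ 2 * (F * N) * ‖g z‖ₑ ^ 2 :=
        lintegral_mono_set fun z hz => hε.trans_le hz
    _ = _ := by
        rw [lintegral_const_mul _ (hgm.enorm.pow_const 2)]
        ring

theorem tendsto_div_two_pow (t : ℝ≥0∞) (ht : t ≠ ∞) :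
    Tendsto (fun n : ℕ => t / 2 ^ n) atTop (𝓝 0) := by
  have h : Tendsto (fun n : ℕ => t * (2⁻¹ : ℝ≥0∞) ^ n) atTop (𝓝 (t * 0)) :=
    ENNReal.Tendsto.const_mul
      (ENNReal.tendsto_pow_atTop_nhds_zero_of_lt_one ENNReal.one_half_lt_one) (Or.inr ht)
  simpa [div_eq_mul_inv, ENNReal.inv_pow] using h

theorem ENNReal.half_step (t m : ℝ≥0∞) (n : ℕ) :
    (t / 2 ^ n + 2 * m) / 2 + m = t / 2 ^ (n + 1) + 2 * m := by
  have h1 : 2 * m / 2 = m := by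
    rw [mul_comm, mul_div_assoc, ENNReal.div_self two_ne_zero ENNReal.ofNat_ne_top, mul_one]
  have h2 : t / 2 ^ n / 2 = t / 2 ^ (n + 1) := by
    rw [pow_succ, div_eq_mul_inv, div_eq_mul_inv, div_eq_mul_inv, mul_assoc,
      ENNReal.mul_inv (Or.inr ENNReal.ofNat_ne_top) (Or.inr two_ne_zero)]
  rw [ENNReal.add_div, h1, h2, add_assoc, ← two_mul]

/-- The positive operator on the half plane is bounded, for square integrable symbols. -/
theorem exists_kerBound : ∃ M : ℝ≥0∞, M ≠ ∞ ∧ ∀ (f g : ℂ → ℂ) (B : ℝ≥0∞),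
    Measurable f → DifferentiableOn ℂ f upper → Measurable g → DifferentiableOn ℂ g upper →
      ∫⁻ w in upper, ‖f w‖ₑ ^ 2 ≠ ∞ → ∫⁻ w in upper, ‖g w‖ₑ ^ 2 ≠ ∞ →
      CauchyBound f g B → CauchyBound g f B →
      ∀ ε : ℝ, 0 < ε → KerBound ε (weighted f g kerP) (M * B) := by
  obtain ⟨M, hM, hstep⟩ := exists_kerBound_step
  refine ⟨2 * M, by finiteness, fun f g B hfm hf hgm hg hf2 hg2 h h' ε hε => ?_⟩
  have hfb := enorm_le_of_lintegral_sq hf hf2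
  have hgb := enorm_le_of_lintegral_sq hg hg2
  set t₀ := ENNReal.ofReal (1 / ε ^ 2) ^ 2 *
      (∫⁻ w in upper, ‖f w‖ₑ ^ 2) * ∫⁻ w in upper, ‖g w‖ₑ ^ 2 with ht₀
  have ht₀' : t₀ ≠ ∞ := by
    rw [ht₀]
    finiteness
  -- The number `2MB` is the fixed point of `t ↦ t/2 + MB`. The two operators are improved together,
  -- as each step uses both bounds. The initial `t₀` depends on `ε`, `f` and `g` but is finite, and
  -- it disappears in the limit.
  have hn : ∀ n : ℕ, KerBound ε (weighted f g kerP) (t₀ / 2 ^ n + 2 * M * B) ∧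
      KerBound ε (weighted g f kerP) (t₀ / 2 ^ n + 2 * M * B) := by
    have hmono : ∀ {F G : ℂ → ℂ} {t t' : ℝ≥0∞}, t ≤ t' → KerBound ε (weighted F G kerP) t →
        KerBound ε (weighted F G kerP) t' := fun htt hk a ha =>
      (hk a ha).trans (mul_le_mul_left htt _)
    intro n
    induction n with
    | zero =>
      refine ⟨hmono ?_ (kerBound_of_lintegral_sq hfm hgm hε),
        hmono ?_ (kerBound_of_lintegral_sq hgm hfm hε)⟩
      · rw [pow_zero, div_one]
        exact le_self_add
      · rw [pow_zero, div_one, ht₀, mul_right_comm]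
        exact le_self_add
    | succ n ih =>
      have e : (t₀ / 2 ^ n + 2 * M * B) / 2 + M * B = t₀ / 2 ^ (n + 1) + 2 * M * B := by
        rw [mul_assoc]
        exact ENNReal.half_step _ _ _
      rw [← e]
      exact ⟨hstep f g B hfm hf hgm hg hfb hgb h h' ε _ hε ih.1 ih.2,
        hstep g f B hgm hg hfm hf hgb hfb h' h ε _ hε ih.2 ih.1⟩
  intro a ha
  have hlim : Tendsto (fun n : ℕ => (t₀ / 2 ^ n + 2 * M * B) * ∫⁻ ζ, (a ζ : ℝ≥0∞) ^ 2) atTop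
      (𝓝 ((0 + 2 * M * B) * ∫⁻ ζ, (a ζ : ℝ≥0∞) ^ 2)) :=
    ENNReal.Tendsto.mul_const ((tendsto_div_two_pow t₀ ht₀').add tendsto_const_nhds)
      (Or.inr ha.lintegral_sq_lt_top.ne)
  rw [zero_add] at hlim
  exact ge_of_tendsto' hlim fun n => (hn n).1 a ha

/-! ### Removing the integrability assumption by cutoffs -/

/-- The factor `conj ψ` goes into the test function and `ψ` only diminishes the result, so the same
`B` serves for all cutoff symbols. -/
theorem CauchyBound.mul {f g ψ : ℂ → ℂ} {B : ℝ≥0∞} (h : CauchyBound f g B) (hψ : Measurable ψ)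
    (hψ1 : ∀ w ∈ upper, ‖ψ w‖ ≤ 1) :
    CauchyBound (fun w => f w * ψ w) (fun w => g w * ψ w) B := by
  rintro α hα ⟨N, hN⟩ ⟨ε, hε, R, hR⟩
  have hle : ∀ ζ, ‖conj (ψ ζ) * α ζ‖ ≤ ‖α ζ‖ := by
    intro ζ
    rcases eq_or_ne (α ζ) 0 with h0 | h0
    · simp [h0]
    · rw [norm_mul, RCLike.norm_conj]
      exact mul_le_of_le_one_left (norm_nonneg _) (hψ1 ζ (hε.trans_le (hR ζ h0).1))
  have key := h (fun ζ => conj (ψ ζ) * α ζ)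
    ((Complex.continuous_conj.measurable.comp hψ).mul hα) ⟨N, fun ζ => (hle ζ).trans (hN ζ)⟩
    ⟨ε, hε, R, fun ζ hζ => hR ζ (right_ne_zero_of_mul hζ)⟩
  calc _ ≤ ∫⁻ z in upper, ‖g z * ∫ ζ, conj (f ζ) * (conj (ψ ζ) * α ζ) / (z - conj ζ) ^ 2‖ₑ ^ 2 := by
        refine setLIntegral_mono' measurableSet_upper fun z hz => ?_
        have e : ∫ ζ, conj (f ζ * ψ ζ) * α ζ / (z - conj ζ) ^ 2 =
            ∫ ζ, conj (f ζ) * (conj (ψ ζ) * α ζ) / (z - conj ζ) ^ 2 := by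
          simp only [map_mul, mul_assoc]
        rw [e, mul_right_comm, enorm_mul _ (ψ z)]
        gcongr
        refine mul_le_of_le_one_right zero_le ?_
        rw [← ofReal_norm, ← ENNReal.ofReal_one]
        exact ENNReal.ofReal_le_ofReal (hψ1 z hz)
    _ ≤ _ := key
    _ ≤ _ := by
        gcongr with ζ
        rw [← ofReal_norm, ← ofReal_norm]
        exact ENNReal.ofReal_le_ofReal (hle ζ)

/-- Multipliers with decay at infinity, converging to `1`. -/
def cutoff (n : ℕ) (w : ℂ) : ℂ :=
  (((n + 1 : ℕ) : ℂ) * Complex.I / (w + ((n + 1 : ℕ) : ℂ) * Complex.I)) ^ 2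

theorem norm_natCast_mul_I_le {w : ℂ} (hw : 0 ≤ w.im) (n : ℕ) :
    ((n : ℕ) : ℝ) ≤ ‖w + (n : ℂ) * Complex.I‖ := by
  refine le_trans ?_ ((le_abs_self _).trans (Complex.abs_im_le_norm _))
  simpa using hw

theorem cutoff_denom_ne_zero {w : ℂ} (hw : 0 ≤ w.im) (n : ℕ) :
    w + ((n + 1 : ℕ) : ℂ) * Complex.I ≠ 0 := by
  refine norm_pos_iff.1 (lt_of_lt_of_le ?_ (norm_natCast_mul_I_le hw (n + 1)))
  positivity

theorem measurable_cutoff (n : ℕ) : Measurable (cutoff n) := by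
  unfold cutoff
  exact (measurable_const.div (measurable_id.add_const _)).pow_const 2

theorem differentiableOn_cutoff (n : ℕ) : DifferentiableOn ℂ (cutoff n) upper := by
  refine DifferentiableOn.pow (DifferentiableOn.div (differentiableOn_const _)
    (differentiableOn_id.add_const _) fun w hw => ?_) 2
  have hw : 0 < w.im := hw
  exact cutoff_denom_ne_zero hw.le n

theorem norm_cutoff_le_one (n : ℕ) {w : ℂ} (hw : w ∈ upper) : ‖cutoff n w‖ ≤ 1 := by
  have hw : 0 < w.im := hw
  rw [cutoff, norm_pow, norm_div, norm_mul, Complex.norm_I, mul_one, Complex.norm_natCast]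
  refine pow_le_one₀ (by positivity) (div_le_one_of_le₀ (norm_natCast_mul_I_le hw.le _)
    (norm_nonneg _))

/-- This decay makes a symbol pulled back from the disc square integrable: after the change of
variables such a symbol is in `L²` only against the weight `‖w + i‖⁻⁴`. -/
theorem norm_cutoff_le (n : ℕ) {w : ℂ} (hw : w ∈ upper) :
    ‖cutoff n w‖ ≤ ((n + 1 : ℕ) : ℝ) ^ 2 * (1 / ‖w + Complex.I‖ ^ 2) := by
  have hw : 0 < w.im := hw
  rw [cutoff, norm_pow, norm_div, norm_mul, Complex.norm_I, mul_one, Complex.norm_natCast,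
    div_pow, mul_one_div]
  have h0 : 0 < ‖w + Complex.I‖ := by
    have := norm_pos_iff.2 (cutoff_denom_ne_zero hw.le 0)
    simpa using this
  have h1 : ‖w + Complex.I‖ ≤ ‖w + ((n + 1 : ℕ) : ℂ) * Complex.I‖ := by
    rw [Complex.norm_def, Complex.norm_def]
    refine Real.sqrt_le_sqrt ?_
    rw [Complex.normSq_apply, Complex.normSq_apply]
    simp
    nlinarith
  gcongr

theorem tendsto_cutoff {w : ℂ} (hw : w ∈ upper) :
    Tendsto (fun n => cutoff n w) atTop (𝓝 1) := by
  have hw : 0 < w.im := hw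
  have h1 : Tendsto (fun n : ℕ => w / Complex.I * (((n + 1 : ℕ) : ℂ))⁻¹) atTop (𝓝 0) := by
    have : Tendsto (fun n : ℕ => (((n + 1 : ℕ) : ℂ))⁻¹) atTop (𝓝 0) :=
      (tendsto_inv_atTop_nhds_zero_nat (𝕜 := ℂ)).comp (tendsto_add_atTop_nat 1)
    simpa using this.const_mul (w / Complex.I)
  have h2 : Tendsto (fun n : ℕ => (((w / Complex.I * (((n + 1 : ℕ) : ℂ))⁻¹) + 1)⁻¹) ^ 2) atTop
      (𝓝 (((0 + 1 : ℂ)⁻¹) ^ 2)) := ((h1.add_const 1).inv₀ (by simp)).pow 2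
  simp only [zero_add, inv_one, one_pow] at h2
  refine h2.congr fun n => ?_
  rw [cutoff]
  congr 1
  have hn : (((n + 1 : ℕ) : ℂ)) ≠ 0 := by exact_mod_cast Nat.succ_ne_zero n
  have hI := Complex.I_ne_zero
  rw [inv_eq_one_div, div_eq_div_iff]
  · field_simp
  · intro h0
    refine cutoff_denom_ne_zero hw.le n ?_
    have e : w + ((n + 1 : ℕ) : ℂ) * Complex.I =
      (w / Complex.I * (((n + 1 : ℕ) : ℂ))⁻¹ + 1) * (((n + 1 : ℕ) : ℂ) * Complex.I) := by
      field_simp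
    rw [e, h0, zero_mul]
  · exact cutoff_denom_ne_zero hw.le n

/-- The positive operator on the upper half plane is bounded. -/
theorem exists_bound_upper : ∃ M : ℝ≥0∞, M ≠ ∞ ∧ ∀ (f g : ℂ → ℂ) (B : ℝ≥0∞),
    Measurable f → DifferentiableOn ℂ f upper → Measurable g → DifferentiableOn ℂ g upper →
      ∫⁻ w in upper, (‖f w‖ₑ * ENNReal.ofReal (1 / ‖w + Complex.I‖ ^ 2)) ^ 2 ≠ ∞ →
      ∫⁻ w in upper, (‖g w‖ₑ * ENNReal.ofReal (1 / ‖w + Complex.I‖ ^ 2)) ^ 2 ≠ ∞ →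
      CauchyBound f g B → CauchyBound g f B → ∀ a : ℂ → ℝ≥0∞, Measurable a →
      ∫⁻ z in upper, (∫⁻ ζ in upper, weighted f g kerP z ζ * a ζ) ^ 2 ≤
        M * B * ∫⁻ ζ in upper, a ζ ^ 2 := by
  obtain ⟨M, hM, hbound⟩ := exists_kerBound
  refine ⟨M, hM, fun f g B hfm hf hgm hg hf2 hg2 h h' a ha => ?_⟩
  have hL2 : ∀ F : ℂ → ℂ,
      ∫⁻ w in upper, (‖F w‖ₑ * ENNReal.ofReal (1 / ‖w + Complex.I‖ ^ 2)) ^ 2 ≠ ∞ → ∀ n,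
      ∫⁻ w in upper, ‖F w * cutoff n w‖ₑ ^ 2 ≠ ∞ := by
    intro F hF n
    refine ne_top_of_le_ne_top (ENNReal.mul_ne_top (a := ENNReal.ofReal (((n + 1 : ℕ) : ℝ) ^ 2) ^ 2)
      (by finiteness) hF) ?_
    rw [← lintegral_const_mul' _ _ (by finiteness)]
    refine setLIntegral_mono' measurableSet_upper fun w hw => ?_
    rw [enorm_mul, ← mul_pow, mul_left_comm, ← ENNReal.ofReal_mul (by positivity), ← ofReal_norm]
    gcongr
    rw [← ofReal_norm]
    exact ENNReal.ofReal_le_ofReal (norm_cutoff_le n hw)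
  -- truncations
  set S : ℕ → Set ℂ := fun n => {z | 1 / ((n : ℝ) + 1) ≤ z.im ∧ ‖z‖ ≤ n} with hS
  have hSm : ∀ n, MeasurableSet (S n) := fun n =>
    (measurableSet_le_im _).inter (measurableSet_le measurable_norm measurable_const)
  have hSu : ∀ n, S n ⊆ upper := fun n z hz => lt_of_lt_of_le (by positivity) hz.1
  set b : ℕ → ℂ → ℝ≥0 := fun n => (S n).indicator fun z => (min (a z) n).toNNReal with hb
  have hbt : ∀ n : ℕ, IsTest (1 / ((n : ℝ) + 1)) (b n) := by
    intro n
    refine ⟨((ha.min measurable_const).ennreal_toNNReal).indicator (hSm n), ⟨n, fun ζ => ?_⟩,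
      n, fun ζ hζ => ?_⟩
    · refine indicator_apply_le' (fun z => ?_) (fun _ => bot_le)
      rw [← ENNReal.coe_le_coe, ENNReal.coe_toNNReal, ENNReal.coe_natCast]
      · exact min_le_right _ _
      · exact ne_top_of_le_ne_top (ENNReal.natCast_ne_top n) (min_le_right _ _)
    · have h1 : ζ ∈ S n := mem_of_indicator_ne_zero hζ
      exact h1
  have hbc : ∀ n z, (b n z : ℝ≥0∞) = (S n).indicator (fun z => min (a z) n) z := by
    intro n z
    by_cases hz : z ∈ S n
    · simp only [hb, indicator_of_mem hz]
      rw [ENNReal.coe_toNNReal]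
      exact ne_top_of_le_ne_top (ENNReal.natCast_ne_top n) (min_le_right _ _)
    · simp only [hb, indicator_of_notMem hz, ENNReal.coe_zero]
  have hmemS : ∀ z ∈ upper, ∀ᶠ n in atTop, z ∈ S n := by
    intro z hz
    have hz : 0 < z.im := hz
    obtain ⟨n, hn⟩ := exists_nat_ge ‖z‖
    obtain ⟨m, hm⟩ := exists_nat_one_div_lt hz
    filter_upwards [eventually_ge_atTop n, eventually_ge_atTop m] with k hk1 hk2
    refine ⟨le_trans ?_ hm.le, hn.trans (by exact_mod_cast hk1)⟩
    have : (m : ℝ) ≤ k := by exact_mod_cast hk2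
    gcongr
  have hblim : ∀ z ∈ upper, Tendsto (fun n => (b n z : ℝ≥0∞)) atTop (𝓝 (a z)) := by
    intro z hz
    have h1 : Tendsto (fun n : ℕ => min (a z) (n : ℝ≥0∞)) atTop (𝓝 (min (a z) ∞)) :=
      tendsto_const_nhds.min ENNReal.tendsto_nat_nhds_top
    rw [min_eq_left le_top] at h1
    refine h1.congr' ?_
    filter_upwards [hmemS z hz] with n hn
    rw [hbc, indicator_of_mem hn]
  have hba : ∀ n, ∫⁻ ζ, (b n ζ : ℝ≥0∞) ^ 2 ≤ ∫⁻ ζ in upper, a ζ ^ 2 := by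
    intro n
    rw [← lintegral_indicator measurableSet_upper]
    refine lintegral_mono fun z => ?_
    rw [hbc]
    by_cases hz : z ∈ S n
    · rw [indicator_of_mem hz, indicator_of_mem (hSu n hz)]
      gcongr
      exact min_le_left _ _
    · rw [indicator_of_notMem hz, zero_pow two_ne_zero]
      exact zero_le
  set fn : ℕ → ℂ → ℂ := fun n w => f w * cutoff n w with hfn
  set gn : ℕ → ℂ → ℂ := fun n w => g w * cutoff n w with hgn
  have hfnm : ∀ n, Measurable (fn n) := fun n => hfm.mul (measurable_cutoff n)
  have hgnm : ∀ n, Measurable (gn n) := fun n => hgm.mul (measurable_cutoff n)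
  have hKm : ∀ n, Measurable (Function.uncurry fun z ζ => weighted (fn n) (gn n) kerP z ζ * b n ζ) :=
    fun n => (measurable_weighted (hfnm n) (hgnm n) measurable_kerP).mul
      ((hbt n).meas.coe_nnreal_ennreal.comp measurable_snd)
  set X : ℕ → ℂ → ℝ≥0∞ := fun n z => (S n).indicator
    (fun z => ∫⁻ ζ in upper, weighted (fn n) (gn n) kerP z ζ * b n ζ) z with hX
  have hXm : ∀ n, Measurable (X n) := fun n =>
    (Measurable.lintegral_prod_right (hKm n)).indicator (hSm n)
  have hXle : ∀ n, ∫⁻ z in upper, X n z ^ 2 ≤ M * B * ∫⁻ ζ in upper, a ζ ^ 2 := by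
    intro n
    have hε : (0 : ℝ) < 1 / ((n : ℝ) + 1) := by positivity
    have key := hbound (fn n) (gn n) B (hfnm n) (hf.mul (differentiableOn_cutoff n)) (hgnm n)
      (hg.mul (differentiableOn_cutoff n)) (hL2 f hf2 n) (hL2 g hg2 n)
      (h.mul (measurable_cutoff n) fun w hw => norm_cutoff_le_one n hw)
      (h'.mul (measurable_cutoff n) fun w hw => norm_cutoff_le_one n hw) _ hε (b n) (hbt n)
    refine le_trans ?_ (key.trans (mul_le_mul_right (hba n) _))
    rw [← lintegral_indicator (measurableSet_le_im _)]
    refine (setLIntegral_le_lintegral _ _).trans (lintegral_mono fun z => ?_)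
    by_cases hz : z ∈ S n
    · have hz' : z ∈ {z : ℂ | 1 / ((n : ℝ) + 1) ≤ z.im} := hz.1
      rw [indicator_of_mem hz', hX]
      simp only [indicator_of_mem hz]
      gcongr
      exact Measure.restrict_le_self
    · rw [hX]
      simp only [indicator_of_notMem hz]
      rw [zero_pow two_ne_zero]
      exact zero_le
  -- Fatou's lemma is used twice, in `ζ` and then in `z`. The bounds for the cutoff symbols and
  -- truncated densities are uniform in `n`.
  calc ∫⁻ z in upper, (∫⁻ ζ in upper, weighted f g kerP z ζ * a ζ) ^ 2
      ≤ ∫⁻ z in upper, liminf (fun n => X n z ^ 2) atTop := by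
        refine setLIntegral_mono' measurableSet_upper fun z hz => ?_
        have e : liminf (fun n => X n z ^ 2) atTop = (liminf (fun n => X n z) atTop) ^ 2 :=
          ((pow_left_mono 2).map_liminf_of_continuousAt (fun n => X n z)
            (ENNReal.continuous_pow 2).continuousAt).symm
        rw [e]
        gcongr
        calc ∫⁻ ζ in upper, weighted f g kerP z ζ * a ζ
            ≤ ∫⁻ ζ in upper, liminf (fun n => weighted (fn n) (gn n) kerP z ζ * b n ζ) atTop := by
              refine setLIntegral_mono' measurableSet_upper fun ζ hζ => ?_
              rcases eq_or_ne (weighted f g kerP z ζ) 0 with h0 | h0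
              · rw [h0, zero_mul]
                exact zero_le
              have hkt : kerP z ζ ≠ ∞ := ENNReal.ofReal_ne_top
              have hw : Tendsto (fun n => weighted (fn n) (gn n) kerP z ζ) atTop
                  (𝓝 (weighted f g kerP z ζ)) := by
                have h1 : Tendsto (fun n => ‖gn n z‖ₑ) atTop (𝓝 ‖g z‖ₑ) := by
                  have := ((tendsto_cutoff hz).const_mul (g z)).enorm
                  rwa [mul_one] at this
                have h2 : Tendsto (fun n => ‖fn n ζ‖ₑ) atTop (𝓝 ‖f ζ‖ₑ) := by
                  have := ((tendsto_cutoff hζ).const_mul (f ζ)).enorm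
                  rwa [mul_one] at this
                refine ENNReal.Tendsto.mul (ENNReal.Tendsto.mul_const h1 (Or.inr hkt))
                  (Or.inr enorm_ne_top) h2 (Or.inr (ENNReal.mul_ne_top enorm_ne_top hkt))
              have hwt : weighted f g kerP z ζ ≠ ∞ :=
                ENNReal.mul_ne_top (ENNReal.mul_ne_top enorm_ne_top hkt) enorm_ne_top
              exact (ENNReal.Tendsto.mul hw (Or.inl h0) (hblim ζ hζ)
                (Or.inr hwt)).liminf_eq.ge
          _ ≤ liminf (fun n => ∫⁻ ζ in upper, weighted (fn n) (gn n) kerP z ζ * b n ζ) atTop :=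
              lintegral_liminf_le fun n => (hKm n).of_uncurry_left
          _ = liminf (fun n => X n z) atTop := by
              refine liminf_congr ?_
              filter_upwards [hmemS z hz] with n hn
              rw [hX]
              simp only [indicator_of_mem hn]
    _ ≤ liminf (fun n => ∫⁻ z in upper, X n z ^ 2) atTop :=
        lintegral_liminf_le fun n => (hXm n).pow_const 2
    _ ≤ _ := by
        refine (liminf_le_liminf (Eventually.of_forall hXle)).trans ?_
        rw [liminf_const]

/-! ### The Cayley transform -/

/-- The Cayley transform of the upper half plane onto the disc. -/
def cay (w : ℂ) : ℂ := (w - Complex.I) / (w + Complex.I)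

/-- The derivative of the Cayley transform. -/
def cayDeriv (w : ℂ) : ℂ := 2 * Complex.I / (w + Complex.I) ^ 2

/-- The inverse of the Cayley transform. -/
def cayInv (z : ℂ) : ℂ := Complex.I * (1 + z) / (1 - z)

theorem add_I_ne_zero {w : ℂ} (hw : w ∈ upper) : w + Complex.I ≠ 0 := by
  have hw : 0 < w.im := hw
  intro h
  have := congrArg Complex.im h
  simp at this
  linarith

theorem one_sub_ne_zero {z : ℂ} (hz : z ∈ ball (0 : ℂ) 1) : 1 - z ≠ 0 := by
  intro h
  have h1 : z = 1 := (sub_eq_zero.1 h).symm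
  rw [h1, mem_ball_zero_iff, norm_one] at hz
  exact lt_irrefl _ hz

theorem cayInv_cay {w : ℂ} (hw : w ∈ upper) : cayInv (cay w) = w := by
  have h := add_I_ne_zero hw
  have h2 : w + Complex.I - (w - Complex.I) ≠ 0 := by
    rw [add_sub_sub_cancel, ← two_mul]
    exact mul_ne_zero two_ne_zero Complex.I_ne_zero
  rw [cayInv, cay, one_add_div h, one_sub_div h, mul_div_assoc', div_div_div_cancel_right₀ h,
    div_eq_iff h2]
  ring

theorem cay_cayInv {z : ℂ} (hz : z ∈ ball (0 : ℂ) 1) : cay (cayInv z) = z := by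
  have h := one_sub_ne_zero hz
  have h2 : Complex.I * (1 + z) + Complex.I * (1 - z) ≠ 0 := by
    rw [show Complex.I * (1 + z) + Complex.I * (1 - z) = 2 * Complex.I by ring]
    exact mul_ne_zero two_ne_zero Complex.I_ne_zero
  rw [cay, cayInv, div_sub' h, div_add' _ _ _ h, div_div_div_cancel_right₀ h, mul_comm (1 - z),
    div_eq_iff h2]
  ring

theorem one_sub_norm_cay_sq {w : ℂ} (hw : w ∈ upper) :
    1 - ‖cay w‖ ^ 2 = 4 * w.im / ‖w + Complex.I‖ ^ 2 := by
  have h : ‖w + Complex.I‖ ^ 2 ≠ 0 := pow_ne_zero 2 (norm_ne_zero_iff.2 (add_I_ne_zero hw))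
  rw [cay, norm_div, div_pow, one_sub_div h]
  congr 1
  rw [← Complex.normSq_eq_norm_sq, ← Complex.normSq_eq_norm_sq, Complex.normSq_apply,
    Complex.normSq_apply]
  simp
  ring

theorem cay_mem_ball {w : ℂ} (hw : w ∈ upper) : cay w ∈ ball (0 : ℂ) 1 := by
  have h1 := one_sub_norm_cay_sq hw
  have h2 : 0 < ‖w + Complex.I‖ := norm_pos_iff.2 (add_I_ne_zero hw)
  have hw : 0 < w.im := hw
  have h3 : 0 < 4 * w.im / ‖w + Complex.I‖ ^ 2 := by positivity
  rw [mem_ball_zero_iff]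
  have := norm_nonneg (cay w)
  nlinarith

theorem cayInv_mem_upper {z : ℂ} (hz : z ∈ ball (0 : ℂ) 1) : cayInv z ∈ upper := by
  have h := one_sub_ne_zero hz
  have e : (cayInv z).im = (1 - ‖z‖ ^ 2) / ‖1 - z‖ ^ 2 := by
    rw [cayInv, Complex.div_im, ← Complex.normSq_eq_norm_sq, ← Complex.normSq_eq_norm_sq,
      ← sub_div]
    congr 1
    rw [Complex.normSq_apply]
    simp
    ring
  have h2 : 0 < ‖1 - z‖ := norm_pos_iff.2 h
  have h3 : ‖z‖ < 1 := mem_ball_zero_iff.1 hz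
  have : 0 < (cayInv z).im := by
    rw [e]
    have h4 : ‖z‖ ^ 2 < 1 := pow_lt_one₀ (norm_nonneg _) h3 two_ne_zero
    have : 0 < 1 - ‖z‖ ^ 2 := by linarith
    positivity
  exact this

theorem image_cay : cay '' upper = ball (0 : ℂ) 1 := by
  ext z
  constructor
  · rintro ⟨w, hw, rfl⟩
    exact cay_mem_ball hw
  · exact fun hz => ⟨cayInv z, cayInv_mem_upper hz, cay_cayInv hz⟩

theorem injOn_cay : InjOn cay upper := fun w hw w' hw' h => by
  rw [← cayInv_cay hw, h, cayInv_cay hw']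

theorem hasDerivAt_cay {w : ℂ} (hw : w ∈ upper) : HasDerivAt cay (cayDeriv w) w := by
  have h := ((hasDerivAt_id w).sub_const Complex.I).div ((hasDerivAt_id w).add_const Complex.I)
    (add_I_ne_zero hw)
  refine HasDerivAt.congr_deriv (f := cay) h ?_
  rw [cayDeriv]
  congr 1
  simp only [id_eq]
  ring

theorem cayDeriv_ne_zero {w : ℂ} (hw : w ∈ upper) : cayDeriv w ≠ 0 :=
  div_ne_zero (mul_ne_zero two_ne_zero Complex.I_ne_zero) (pow_ne_zero 2 (add_I_ne_zero hw))

theorem norm_cayDeriv (w : ℂ) : ‖cayDeriv w‖ = 2 * (1 / ‖w + Complex.I‖ ^ 2) := by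
  rw [cayDeriv, norm_div, norm_mul, Complex.norm_I, norm_pow]
  simp [div_eq_mul_inv]

theorem det_complex_smul_one (c : ℂ) : (c • (1 : ℂ →L[ℝ] ℂ)).det = ‖c‖ ^ 2 := by
  have h : ((c • (1 : ℂ →L[ℝ] ℂ) : ℂ →L[ℝ] ℂ) : ℂ →ₗ[ℝ] ℂ) = Algebra.lmul ℝ ℂ c := by
    ext
    simp
  rw [ContinuousLinearMap.det, h, ← Algebra.norm_apply, Algebra.norm_complex_apply,
    Complex.normSq_eq_norm_sq]

theorem hasFDerivWithinAt_cay {w : ℂ} (hw : w ∈ upper) :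
    HasFDerivWithinAt cay (cayDeriv w • (1 : ℂ →L[ℝ] ℂ)) upper w :=
  (hasDerivAt_cay hw).complexToReal_fderiv.hasFDerivWithinAt

theorem lintegral_disc_eq (F : ℂ → ℝ≥0∞) :
    ∫⁻ z in ball (0 : ℂ) 1, F z = ∫⁻ w in upper, ‖cayDeriv w‖ₑ ^ 2 * F (cay w) := by
  rw [← image_cay, lintegral_image_eq_lintegral_abs_det_fderiv_mul volume measurableSet_upper
    (fun w hw => hasFDerivWithinAt_cay hw) injOn_cay]
  refine lintegral_congr fun w => ?_
  rw [det_complex_smul_one, abs_of_nonneg (by positivity), ENNReal.ofReal_pow (norm_nonneg _),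
    ofReal_norm]

theorem integral_disc_eq (F : ℂ → ℂ) :
    ∫ z in ball (0 : ℂ) 1, F z = ∫ w in upper, ((‖cayDeriv w‖ ^ 2 : ℝ) : ℂ) * F (cay w) := by
  rw [← image_cay, integral_image_eq_integral_abs_det_fderiv_smul volume measurableSet_upper
    (fun w hw => hasFDerivWithinAt_cay hw) injOn_cay]
  refine integral_congr_ae (Eventually.of_forall fun w => ?_)
  simp only
  rw [det_complex_smul_one, abs_of_nonneg (by positivity), Complex.real_smul]

theorem one_sub_conj_mul_cay {w ω : ℂ} (hw : w ∈ upper) (hω : ω ∈ upper) :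
    (1 - conj (cay ω) * cay w) ^ 2 * (cayDeriv w * conj (cayDeriv ω)) = -(cayDeriv w *
      conj (cayDeriv ω)) ^ 2 * (w - conj ω) ^ 2 := by
  have h1 := add_I_ne_zero hw
  have h2 : conj ω - Complex.I ≠ 0 := by
    have := (map_ne_zero (starRingEnd ℂ)).2 (add_I_ne_zero hω)
    simpa [sub_eq_add_neg] using this
  have e1 : conj (cay ω) = (conj ω + Complex.I) / (conj ω - Complex.I) := by
    simp [cay, sub_eq_add_neg]
  have e2 : conj (cayDeriv ω) = -(2 * Complex.I) / (conj ω - Complex.I) ^ 2 := by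
    simp [cayDeriv, sub_eq_add_neg, Complex.conj_ofNat]
  have e3 : 1 - conj (cay ω) * cay w =
      -2 * Complex.I * (w - conj ω) / ((conj ω - Complex.I) * (w + Complex.I)) := by
    rw [e1, cay, div_mul_div_comm, one_sub_div (mul_ne_zero h2 h1)]
    congr 1
    ring
  rw [e3, e2, cayDeriv]
  field_simp

/-- Conformal covariance of the Bergman kernel. It rests on `1 - conj (cay ω) * cay w = -2i (w - ω̄)
/ ((ω̄ - i)(w + i))`. -/
theorem kernel_cay {w ω : ℂ} (hw : w ∈ upper) (hω : ω ∈ upper) :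
    1 / (1 - conj (cay ω) * cay w) ^ 2 =
      -(1 / (w - conj ω) ^ 2) / (cayDeriv w * conj (cayDeriv ω)) := by
  have hw0 : 0 < w.im := hw
  have hω0 : 0 < ω.im := hω
  have h1 : cayDeriv w * conj (cayDeriv ω) ≠ 0 :=
    mul_ne_zero (cayDeriv_ne_zero hw) ((map_ne_zero (starRingEnd ℂ)).2 (cayDeriv_ne_zero hω))
  have h2 : (w - conj ω) ^ 2 ≠ 0 := pow_ne_zero 2 (sub_conj_ne_zero hw0 hω0.le)
  have key := one_sub_conj_mul_cay hw hω
  set D := cayDeriv w * conj (cayDeriv ω) with hD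
  have h3 : (1 - conj (cay ω) * cay w) ^ 2 = -D * (w - conj ω) ^ 2 := by
    have : (1 - conj (cay ω) * cay w) ^ 2 * D = (-D * (w - conj ω) ^ 2) * D := by
      rw [key]
      ring
    exact mul_right_cancel₀ h1 this
  rw [h3]
  field_simp

theorem norm_kernel_cay {w ω : ℂ} (hw : w ∈ upper) (hω : ω ∈ upper) :
    1 / ‖1 - conj (cay ω) * cay w‖ ^ 2 =
      1 / ‖w - conj ω‖ ^ 2 / (‖cayDeriv w‖ * ‖cayDeriv ω‖) := by
  have h := congrArg norm (kernel_cay hw hω)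
  simpa [norm_div, norm_pow, norm_mul] using h

/-! ### Transfer between the disc and the half plane -/

/-- The boundedness of `u ↦ f P (conj g u)` on bounded functions with compact support in the
disc, where `P` is the Bergman projection. -/
def DiscBound (f g : ℂ → ℂ) (B : ℝ≥0∞) : Prop :=
  ∀ u : ℂ → ℂ, Measurable u → (∃ N, ∀ ζ, ‖u ζ‖ ≤ N) → (∃ r < 1, ∀ ζ, u ζ ≠ 0 → ‖ζ‖ ≤ r) →
    ∫⁻ z, ‖f z * ∫ ζ, conj (g ζ) * u ζ / (1 - conj ζ * z) ^ 2 ∂dA‖ₑ ^ 2 ∂dA ≤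
      B * ∫⁻ ζ, ‖u ζ‖ₑ ^ 2 ∂dA

theorem volume_disc_ne_zero : volume (ball (0 : ℂ) 1) ≠ 0 :=
  (measure_ball_pos volume (0 : ℂ) one_pos).ne'

theorem volume_disc_ne_top : volume (ball (0 : ℂ) 1) ≠ ∞ := measure_ball_lt_top.ne

theorem lintegral_dA (F : ℂ → ℝ≥0∞) :
    ∫⁻ z, F z ∂dA = (volume (ball (0 : ℂ) 1))⁻¹ * ∫⁻ z in ball (0 : ℂ) 1, F z := by
  rw [dA, lintegral_smul_measure, smul_eq_mul]

theorem volume_mul_lintegral_dA (F : ℂ → ℝ≥0∞) :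
    volume (ball (0 : ℂ) 1) * ∫⁻ z, F z ∂dA = ∫⁻ z in ball (0 : ℂ) 1, F z := by
  rw [lintegral_dA, ← mul_assoc, ENNReal.mul_inv_cancel volume_disc_ne_zero volume_disc_ne_top,
    one_mul]

theorem volume_smul_integral_dA (F : ℂ → ℂ) :
    volume.real (ball (0 : ℂ) 1) • ∫ z, F z ∂dA = ∫ z in ball (0 : ℂ) 1, F z := by
  rw [dA, integral_smul_measure, smul_smul, ENNReal.toReal_inv, Measure.real,
    mul_inv_cancel₀ (ENNReal.toReal_pos volume_disc_ne_zero volume_disc_ne_top).ne', one_smul]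

theorem DiscBound.setLIntegral_le {f g : ℂ → ℂ} {B : ℝ≥0∞} (h : DiscBound f g B) {u : ℂ → ℂ}
    (hu : Measurable u) (hb : ∃ N, ∀ ζ, ‖u ζ‖ ≤ N) (hs : ∃ r < 1, ∀ ζ, u ζ ≠ 0 → ‖ζ‖ ≤ r) :
    ∫⁻ z in ball (0 : ℂ) 1,
        ‖f z * ∫ ζ in ball (0 : ℂ) 1, conj (g ζ) * u ζ / (1 - conj ζ * z) ^ 2‖ₑ ^ 2 ≤
      volume (ball (0 : ℂ) 1) ^ 2 * B * ∫⁻ ζ in ball (0 : ℂ) 1, ‖u ζ‖ₑ ^ 2 := by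
  have key := h u hu hb hs
  have e : ∀ z, ‖f z * ∫ ζ in ball (0 : ℂ) 1, conj (g ζ) * u ζ / (1 - conj ζ * z) ^ 2‖ₑ ^ 2 =
      volume (ball (0 : ℂ) 1) ^ 2 *
        ‖f z * ∫ ζ, conj (g ζ) * u ζ / (1 - conj ζ * z) ^ 2 ∂dA‖ₑ ^ 2 := by
    intro z
    rw [← volume_smul_integral_dA, enorm_mul, enorm_smul, enorm_mul,
      Real.enorm_of_nonneg measureReal_nonneg, ofReal_measureReal volume_disc_ne_top]
    ring
  simp only [e]
  rw [lintegral_const_mul' _ _ (ENNReal.pow_ne_top volume_disc_ne_top),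
    ← volume_mul_lintegral_dA, ← volume_mul_lintegral_dA fun ζ => ‖u ζ‖ₑ ^ 2]
  calc _ ≤ volume (ball (0 : ℂ) 1) ^ 2 * (volume (ball (0 : ℂ) 1) *
        (B * ∫⁻ ζ, ‖u ζ‖ₑ ^ 2 ∂dA)) := by gcongr
    _ = _ := by ring

/-- The pull-back of a function on the disc to the upper half plane, extended by zero. -/
def pull (f : ℂ → ℂ) : ℂ → ℂ := upper.indicator fun w => f (cay w)

theorem pull_apply (f : ℂ → ℂ) {w : ℂ} (hw : w ∈ upper) : pull f w = f (cay w) :=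
  indicator_of_mem hw _

theorem differentiableOn_pull {f : ℂ → ℂ} (hf : DifferentiableOn ℂ f (ball (0 : ℂ) 1)) :
    DifferentiableOn ℂ (pull f) upper := by
  refine DifferentiableOn.congr (f := fun w => f (cay w)) ?_ fun w hw => pull_apply f hw
  exact hf.comp (fun w hw => (hasDerivAt_cay hw).differentiableAt.differentiableWithinAt)
    fun w hw => cay_mem_ball hw

theorem measurable_pull {f : ℂ → ℂ} (hf : DifferentiableOn ℂ f (ball (0 : ℂ) 1)) :
    Measurable (pull f) := by
  classical
  have hc : ContinuousOn (fun w => f (cay w)) upper :=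
    (differentiableOn_pull hf).continuousOn.congr fun w hw => (pull_apply f hw).symm
  rw [pull, ← piecewise_eq_indicator]
  exact hc.measurable_piecewise continuous_zero.continuousOn measurableSet_upper

theorem lintegral_pull_ne_top {f : ℂ → ℂ} (hf : MemLp f 2 dA) :
    ∫⁻ w in upper, (‖pull f w‖ₑ * ENNReal.ofReal (1 / ‖w + Complex.I‖ ^ 2)) ^ 2 ≠ ∞ := by
  have h1 : ∫⁻ z in ball (0 : ℂ) 1, ‖f z‖ₑ ^ 2 ≠ ∞ := by
    rw [← volume_mul_lintegral_dA]
    refine ENNReal.mul_ne_top volume_disc_ne_top ?_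
    have := (eLpNorm_lt_top_iff_lintegral_rpow_enorm_lt_top two_ne_zero ENNReal.ofNat_ne_top).1
      hf.2
    simpa using this.ne
  rw [lintegral_disc_eq] at h1
  refine ne_top_of_le_ne_top h1 ?_
  refine setLIntegral_mono' measurableSet_upper fun w hw => ?_
  rw [pull_apply f hw, mul_pow, mul_comm]
  gcongr
  rw [← ofReal_norm, norm_cayDeriv]
  refine ENNReal.ofReal_le_ofReal ?_
  have : 0 ≤ 1 / ‖w + Complex.I‖ ^ 2 := by positivity
  linarith

theorem measurable_cayInv : Measurable cayInv := by
  unfold cayInv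
  fun_prop

theorem measurable_cayDeriv : Measurable cayDeriv := by
  unfold cayDeriv
  fun_prop

theorem measurable_cay : Measurable cay := by
  unfold cay
  fun_prop

/-- The transfer of a test function from the half plane to the disc. -/
def push (α : ℂ → ℂ) : ℂ → ℂ :=
  (ball (0 : ℂ) 1).indicator fun z => α (cayInv z) / cayDeriv (cayInv z)

theorem push_cay (α : ℂ → ℂ) {w : ℂ} (hw : w ∈ upper) : push α (cay w) = α w / cayDeriv w := by
  rw [push, indicator_of_mem (cay_mem_ball hw), cayInv_cay hw]

theorem measurable_push {α : ℂ → ℂ} (hα : Measurable α) : Measurable (push α) :=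
  ((hα.comp measurable_cayInv).div (measurable_cayDeriv.comp measurable_cayInv)).indicator
    measurableSet_ball

theorem push_ne_zero {α : ℂ → ℂ} {z : ℂ} (h : push α z ≠ 0) :
    z ∈ ball (0 : ℂ) 1 ∧ α (cayInv z) ≠ 0 := by
  have hz : z ∈ ball (0 : ℂ) 1 := by
    by_contra hz
    exact h (indicator_of_notMem hz _)
  refine ⟨hz, fun h0 => h ?_⟩
  rw [push, indicator_of_mem hz, h0, zero_div]

theorem exists_norm_push_le {α : ℂ → ℂ} {N ε R : ℝ} (hN : ∀ ζ, ‖α ζ‖ ≤ N)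
    (hs : ∀ ζ, α ζ ≠ 0 → ε ≤ ζ.im ∧ ‖ζ‖ ≤ R) : ∃ M, ∀ z, ‖push α z‖ ≤ M := by
  have hN0 : 0 ≤ N := (norm_nonneg _).trans (hN 0)
  refine ⟨N * (|R| + 1) ^ 2, fun z => ?_⟩
  by_cases h : push α z = 0
  · rw [h, norm_zero]
    positivity
  · obtain ⟨hz, hα⟩ := push_ne_zero h
    have hR := (hs _ hα).2
    rw [push, indicator_of_mem hz, norm_div, norm_cayDeriv, div_le_iff₀]
    · have hp : 0 < ‖cayInv z + Complex.I‖ :=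
        norm_pos_iff.2 (add_I_ne_zero (cayInv_mem_upper hz))
      have h1 : ‖cayInv z + Complex.I‖ ≤ |R| + 1 := by
        refine (norm_add_le _ _).trans ?_
        rw [Complex.norm_I]
        linarith [le_abs_self R]
      have h2 : 1 ≤ (|R| + 1) ^ 2 * (1 / ‖cayInv z + Complex.I‖ ^ 2) := by
        rw [mul_one_div, one_le_div (by positivity)]
        gcongr
      calc ‖α (cayInv z)‖ ≤ N := hN _
        _ ≤ N * (2 * ((|R| + 1) ^ 2 * (1 / ‖cayInv z + Complex.I‖ ^ 2))) :=
          le_mul_of_one_le_right hN0 (by linarith)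
        _ = _ := by ring
    · have hp : 0 < ‖cayInv z + Complex.I‖ :=
        norm_pos_iff.2 (add_I_ne_zero (cayInv_mem_upper hz))
      positivity

theorem exists_norm_le_of_push_ne_zero {α : ℂ → ℂ} {ε R : ℝ} (hε : 0 < ε)
    (hs : ∀ ζ, α ζ ≠ 0 → ε ≤ ζ.im ∧ ‖ζ‖ ≤ R) : ∃ r < 1, ∀ z, push α z ≠ 0 → ‖z‖ ≤ r := by
  refine ⟨√(1 - 4 * ε / (|R| + 1) ^ 2), ?_, fun z hz => ?_⟩
  · rw [Real.sqrt_lt' one_pos]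
    have : 0 < 4 * ε / (|R| + 1) ^ 2 := by positivity
    linarith
  · obtain ⟨hz, hα⟩ := push_ne_zero hz
    obtain ⟨h1, h2⟩ := hs _ hα
    have hu := cayInv_mem_upper hz
    have hp : 0 < ‖cayInv z + Complex.I‖ := norm_pos_iff.2 (add_I_ne_zero hu)
    have h3 : ‖cayInv z + Complex.I‖ ≤ |R| + 1 := by
      refine (norm_add_le _ _).trans ?_
      rw [Complex.norm_I]
      linarith [le_abs_self R]
    have h4 := one_sub_norm_cay_sq hu
    rw [cay_cayInv hz] at h4
    refine Real.le_sqrt_of_sq_le ?_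
    have : 4 * ε / (|R| + 1) ^ 2 ≤ 4 * (cayInv z).im / ‖cayInv z + Complex.I‖ ^ 2 := by
      have := hε.trans_le h1
      gcongr
    linarith

/-- The Jacobian `|φ'(ω)|²`, with `φ = cay`, cancels the factor `1/φ'(ω)` in `push` and the factor
`1/conj φ'(ω)` from the kernel. Only `-1/φ'(w)` is left. -/
theorem integral_push {g : ℂ → ℂ} (α : ℂ → ℂ) {w : ℂ} (hw : w ∈ upper) :
    ∫ ζ in ball (0 : ℂ) 1, conj (g ζ) * push α ζ / (1 - conj ζ * cay w) ^ 2 =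
      -(1 / cayDeriv w) * ∫ ω, conj (pull g ω) * α ω / (w - conj ω) ^ 2 := by
  have e : ∫ ω, conj (pull g ω) * α ω / (w - conj ω) ^ 2 =
      ∫ ω in upper, conj (pull g ω) * α ω / (w - conj ω) ^ 2 := by
    refine (setIntegral_eq_integral_of_forall_compl_eq_zero fun ω hω => ?_).symm
    rw [pull, indicator_of_notMem hω, map_zero, zero_mul, zero_div]
  rw [integral_disc_eq, e, ← integral_const_mul]
  refine setIntegral_congr_fun measurableSet_upper fun ω hω => ?_
  have h1 := cayDeriv_ne_zero hw
  have h2 := cayDeriv_ne_zero hω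
  have h3 : conj (cayDeriv ω) ≠ 0 := (map_ne_zero (starRingEnd ℂ)).2 h2
  have h4 : ((‖cayDeriv ω‖ ^ 2 : ℝ) : ℂ) = cayDeriv ω * conj (cayDeriv ω) := by
    rw [Complex.mul_conj, Complex.normSq_eq_norm_sq]
  rw [push_cay α hω, pull_apply g hω, div_eq_mul_one_div _ ((1 - _) ^ 2), kernel_cay hw hω, h4]
  field_simp

/-- The remaining `1/φ'(w)` cancels against the Jacobian of the outer integral, so both sides
transform isometrically. The symbols change places because `CauchyBound` lists the inner symbol
first. The squared area undoes the normalization of `dA` in the inner integral. -/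
theorem DiscBound.cauchyBound {f g : ℂ → ℂ} {B : ℝ≥0∞} (h : DiscBound f g B) :
    CauchyBound (pull g) (pull f) (volume (ball (0 : ℂ) 1) ^ 2 * B) := by
  rintro α hα ⟨N, hN⟩ ⟨ε, hε, R, hs⟩
  have key := h.setLIntegral_le (measurable_push hα) (exists_norm_push_le hN hs)
    (exists_norm_le_of_push_ne_zero hε hs)
  rw [lintegral_disc_eq, lintegral_disc_eq] at key
  calc _ = ∫⁻ w in upper, ‖cayDeriv w‖ₑ ^ 2 * ‖f (cay w) * ∫ ζ in ball (0 : ℂ) 1,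
          conj (g ζ) * push α ζ / (1 - conj ζ * cay w) ^ 2‖ₑ ^ 2 := by
        refine setLIntegral_congr_fun measurableSet_upper fun w hw => ?_
        have h1 := cayDeriv_ne_zero hw
        rw [integral_push α hw, pull_apply f hw, ← mul_pow, ← enorm_mul, ← enorm_neg]
        congr 2
        field_simp
    _ ≤ _ := key
    _ = volume (ball (0 : ℂ) 1) ^ 2 * B * ∫⁻ w in upper, ‖α w‖ₑ ^ 2 := by
        congr 1
        refine setLIntegral_congr_fun measurableSet_upper fun w hw => ?_
        have h1 := cayDeriv_ne_zero hw
        rw [push_cay α hw, ← mul_pow, ← enorm_mul, mul_div_cancel₀ _ h1]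
    _ ≤ _ := by
        gcongr
        exact Measure.restrict_le_self

/-- Boundedness of the products `f P conj g` and `g P conj f` on compactly supported bounded
functions gives the boundedness of the positive operator. -/
theorem exists_bound_disc {f g : ℂ → ℂ} {B : ℝ≥0∞} (hB : B ≠ ∞) (hf : MemA2 f) (hg : MemA2 g)
    (hfg : DiscBound f g B) (hgf : DiscBound g f B) :
    ∃ M : ℝ≥0∞, M ≠ ∞ ∧ ∀ a : ℂ → ℝ≥0∞, Measurable a →
      ∫⁻ z, (∫⁻ ζ, ‖f z‖ₑ * ENNReal.ofReal (1 / ‖1 - conj ζ * z‖ ^ 2) * ‖g ζ‖ₑ * a ζ ∂dA) ^ 2 ∂dA ≤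
        M * ∫⁻ ζ, a ζ ^ 2 ∂dA := by
  obtain ⟨M, hM, key⟩ := exists_bound_upper
  have key := key (pull g) (pull f) _ (measurable_pull hg.1) (differentiableOn_pull hg.1)
    (measurable_pull hf.1) (differentiableOn_pull hf.1) (lintegral_pull_ne_top hg.2)
    (lintegral_pull_ne_top hf.2) hfg.cauchyBound hgf.cauchyBound
  refine ⟨(volume (ball (0 : ℂ) 1))⁻¹ ^ 2 * (M * (volume (ball (0 : ℂ) 1) ^ 2 * B)), ?_,
    fun a ha => ?_⟩
  · exact ENNReal.mul_ne_top
      (ENNReal.pow_ne_top (ENNReal.inv_ne_top.2 volume_disc_ne_zero)) (ENNReal.mul_ne_top hM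
      (ENNReal.mul_ne_top (ENNReal.pow_ne_top volume_disc_ne_top) hB))
  -- The factor `|φ'|` makes the transfer of densities isometric in `L²`, up to the normalization of
  -- `dA`.
  have key := key (fun ω => ‖cayDeriv ω‖ₑ * a (cay ω))
    (measurable_cayDeriv.enorm.mul (ha.comp measurable_cay))
  have hV := volume_disc_ne_zero
  set V := volume (ball (0 : ℂ) 1) with hVdef
  have e1 : ∀ z, (∫⁻ ζ, ‖f z‖ₑ * ENNReal.ofReal (1 / ‖1 - conj ζ * z‖ ^ 2) * ‖g ζ‖ₑ * a ζ ∂dA) ^ 2 =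
      V⁻¹ ^ 2 * (∫⁻ ζ in ball (0 : ℂ) 1,
        ‖f z‖ₑ * ENNReal.ofReal (1 / ‖1 - conj ζ * z‖ ^ 2) * ‖g ζ‖ₑ * a ζ) ^ 2 := by
    intro z
    rw [lintegral_dA, mul_pow]
  simp only [e1]
  rw [lintegral_const_mul' _ _ (ENNReal.pow_ne_top (ENNReal.inv_ne_top.2 hV)), lintegral_dA,
    lintegral_dA fun ζ => a ζ ^ 2, lintegral_disc_eq, lintegral_disc_eq fun ζ => a ζ ^ 2]
  have e2 : ∫⁻ w in upper, ‖cayDeriv w‖ₑ ^ 2 * (∫⁻ ζ in ball (0 : ℂ) 1, ‖f (cay w)‖ₑ *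
        ENNReal.ofReal (1 / ‖1 - conj ζ * cay w‖ ^ 2) * ‖g ζ‖ₑ * a ζ) ^ 2 =
      ∫⁻ z in upper, (∫⁻ ζ in upper,
        weighted (pull g) (pull f) kerP z ζ * (‖cayDeriv ζ‖ₑ * a (cay ζ))) ^ 2 := by
    refine setLIntegral_congr_fun measurableSet_upper fun w hw => ?_
    rw [lintegral_disc_eq, ← mul_pow, ← lintegral_const_mul' _ _ enorm_ne_top]
    congr 1
    refine setLIntegral_congr_fun measurableSet_upper fun ω hω => ?_
    have h1 : 0 < ‖cayDeriv w‖ := norm_pos_iff.2 (cayDeriv_ne_zero hw)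
    have h2 : 0 < ‖cayDeriv ω‖ := norm_pos_iff.2 (cayDeriv_ne_zero hω)
    have e : kerP w ω = ENNReal.ofReal (1 / ‖1 - conj (cay ω) * cay w‖ ^ 2) *
        (‖cayDeriv w‖ₑ * ‖cayDeriv ω‖ₑ) := by
      rw [norm_kernel_cay hw hω, ← enorm_mul, ← ofReal_norm, norm_mul,
        ← ENNReal.ofReal_mul (by positivity), kerP, div_mul_cancel₀ _ (by positivity)]
    rw [weighted, pull_apply f hw, pull_apply g hω, e]
    ring
  have e3 : ∫⁻ w in upper, (‖cayDeriv w‖ₑ * a (cay w)) ^ 2 =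
      ∫⁻ w in upper, ‖cayDeriv w‖ₑ ^ 2 * a (cay w) ^ 2 := by simp only [mul_pow]
  rw [e3] at key
  rw [e2]
  calc _ ≤ V⁻¹ ^ 2 * (V⁻¹ * (M * (V ^ 2 * B) *
        ∫⁻ w in upper, ‖cayDeriv w‖ₑ ^ 2 * a (cay w) ^ 2)) := by gcongr
    _ = _ := by ring

/-! ### The Bergman kernel and the Bergman projection -/

theorem norm_one_sub_ge {z ζ : ℂ} {r : ℝ} (hz : ‖z‖ ≤ 1) (hζ : ‖ζ‖ ≤ r) (hr : 0 ≤ r) :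
    1 - r ≤ ‖1 - ζ * z‖ := by
  have h1 : ‖ζ * z‖ ≤ r := by
    rw [norm_mul]
    calc ‖ζ‖ * ‖z‖ ≤ r * 1 := mul_le_mul hζ hz (norm_nonneg _) hr
      _ = r := mul_one r
  have h2 := norm_sub_norm_le (1 : ℂ) (ζ * z)
  rw [norm_one] at h2
  linarith

theorem one_sub_mul_ne_zero {z ζ : ℂ} (hz : ‖z‖ ≤ 1) (hζ : ‖ζ‖ < 1) : 1 - ζ * z ≠ 0 := by
  rw [← norm_pos_iff]
  have := norm_one_sub_ge hz le_rfl (norm_nonneg ζ)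
  linarith

/-- On the circle `conj z = ρ²/z`, so `1 - ζ conj z = (z - ρ²ζ)/z`. The average becomes Cauchy's
integral formula for the derivative of `z h(z)` at `ρ²ζ`. -/
theorem circleAverage_div_one_sub_sq {h : ℂ → ℂ} {ζ : ℂ} {ρ : ℝ}
    (hh : DifferentiableOn ℂ h (ball (0 : ℂ) 1)) (hζ : ‖ζ‖ < 1) (h0 : 0 < ρ) (h1 : ρ < 1) :
    Real.circleAverage (fun z => h z / (1 - ζ * conj z) ^ 2) 0 ρ =
      deriv (fun z => z * h z) ((ρ : ℂ) ^ 2 * ζ) := by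
  have hmem : (ρ : ℂ) ^ 2 * ζ ∈ ball (0 : ℂ) ρ := by
    rw [mem_ball_zero_iff, norm_mul, norm_pow, Complex.norm_real, Real.norm_of_nonneg h0.le]
    nlinarith [norm_nonneg ζ]
  have hzh : DifferentiableOn ℂ (fun z => z * h z) (ball (0 : ℂ) 1) := differentiableOn_id.mul hh
  rw [Real.circleAverage_eq_circleIntegral h0.ne',
    ← Complex.two_pi_I_inv_smul_circleIntegral_sub_sq_inv_smul_of_differentiable isOpen_ball
      (closedBall_subset_ball h1) hzh hmem]
  congr 1
  refine circleIntegral.integral_congr h0.le fun z hz => ?_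
  have hz : ‖z‖ = ρ := mem_sphere_zero_iff_norm.1 hz
  have hz0 : z ≠ 0 := norm_pos_iff.1 (hz ▸ h0)
  have hc : z * conj z = (ρ : ℂ) ^ 2 := by
    rw [Complex.mul_conj, Complex.normSq_eq_norm_sq, hz, Complex.ofReal_pow]
  have hk : 1 - ζ * conj z ≠ 0 :=
    one_sub_mul_ne_zero (by rw [RCLike.norm_conj, hz]; exact h1.le) hζ
  have e : z - (ρ : ℂ) ^ 2 * ζ = z * (1 - ζ * conj z) := by
    rw [← hc]
    ring
  simp only [smul_eq_mul, sub_zero, e]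
  field_simp

/-- In polar coordinates the radial integrand is exact: `2πt (z h)'(t²ζ)` is the derivative of `πt²
h(t²ζ)` in `t`. -/
theorem integral_ball_div_one_sub_sq {h : ℂ → ℂ} {ζ : ℂ} {r : ℝ}
    (hh : DifferentiableOn ℂ h (ball (0 : ℂ) 1)) (hζ : ‖ζ‖ < 1) (h0 : 0 < r) (h1 : r < 1) :
    ∫ z in ball (0 : ℂ) r, h z / (1 - ζ * conj z) ^ 2 =
      Real.pi * (r : ℂ) ^ 2 * h ((r : ℂ) ^ 2 * ζ) := by
  have hsub : closedBall (0 : ℂ) r ⊆ ball (0 : ℂ) 1 := closedBall_subset_ball h1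
  have hc : ContinuousOn (fun z => h z / (1 - ζ * conj z) ^ 2) (closedBall (0 : ℂ) r) := by
    refine (hh.continuousOn.mono hsub).div ?_ fun z hz => pow_ne_zero 2
      (one_sub_mul_ne_zero ?_ hζ)
    · exact Continuous.continuousOn (by fun_prop)
    · rw [RCLike.norm_conj]
      exact (mem_closedBall_zero_iff.1 hz).trans h1.le
  have hmem : ∀ t ∈ Icc (0 : ℝ) r, (t : ℂ) ^ 2 * ζ ∈ ball (0 : ℂ) 1 := by
    intro t ht
    rw [mem_ball_zero_iff, norm_mul, norm_pow, Complex.norm_real, Real.norm_of_nonneg ht.1]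
    have h2 : t ^ 2 ≤ 1 := pow_le_one₀ ht.1 (ht.2.trans h1.le)
    nlinarith [norm_nonneg ζ]
  have hzh : DifferentiableOn ℂ (fun z => z * h z) (ball (0 : ℂ) 1) := differentiableOn_id.mul hh
  have hd : ∀ t ∈ uIcc (0 : ℝ) r, HasDerivAt
      (fun t : ℝ => Real.pi * (t : ℂ) ^ 2 * h ((t : ℂ) ^ 2 * ζ))
      ((2 * Real.pi * t : ℝ) • deriv (fun z => z * h z) ((t : ℂ) ^ 2 * ζ)) t := by
    intro t ht
    rw [uIcc_of_le h0.le] at ht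
    have hda : HasDerivAt h (deriv h ((t : ℂ) ^ 2 * ζ)) ((t : ℂ) ^ 2 * ζ) :=
      (hh.differentiableAt (isOpen_ball.mem_nhds (hmem t ht))).hasDerivAt
    have hp : HasDerivAt (fun t : ℝ => (t : ℂ) ^ 2) (2 * (t : ℂ)) t := by
      have hp := (hasDerivAt_id t).ofReal_comp.pow 2
      simp only [id_eq, Nat.cast_ofNat, Nat.add_one_sub_one, pow_one, Complex.ofReal_one,
        mul_one] at hp
      exact hp
    have hq := HasDerivAt.comp t hda (hp.mul_const ζ)
    have hr := (hp.const_mul (Real.pi : ℂ)).mul hq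
    have e : deriv (fun z => z * h z) ((t : ℂ) ^ 2 * ζ) =
        1 * h ((t : ℂ) ^ 2 * ζ) + (t : ℂ) ^ 2 * ζ * deriv h ((t : ℂ) ^ 2 * ζ) :=
      ((hasDerivAt_id _).mul hda).deriv
    refine HasDerivAt.congr_deriv hr ?_
    rw [e, Complex.real_smul]
    push_cast
    simp only [Function.comp_apply]
    ring
  have hci : ContinuousOn (fun t : ℝ => (2 * Real.pi * t : ℝ) •
      deriv (fun z => z * h z) ((t : ℂ) ^ 2 * ζ)) (uIcc (0 : ℝ) r) := by
    rw [uIcc_of_le h0.le]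
    have hcl : Continuous fun t : ℝ => 2 * Real.pi * t := by fun_prop
    refine hcl.continuousOn.smul ?_
    have hcp : Continuous fun t : ℝ => (t : ℂ) ^ 2 * ζ := by fun_prop
    exact (hzh.deriv isOpen_ball).continuousOn.comp hcp.continuousOn hmem
  rw [setIntegral_ball_eq hc, ← integral_Ioc_eq_integral_Ioo,
    ← intervalIntegral.integral_of_le h0.le]
  have hcong : ∫ t in (0 : ℝ)..r, (2 * Real.pi * t : ℝ) •
      Real.circleAverage (fun z => h z / (1 - ζ * conj z) ^ 2) 0 t =
      ∫ t in (0 : ℝ)..r, (2 * Real.pi * t : ℝ) • deriv (fun z => z * h z) ((t : ℂ) ^ 2 * ζ) := by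
    refine intervalIntegral.integral_congr_ae (Eventually.of_forall fun t ht => ?_)
    rw [uIoc_of_le h0.le] at ht
    rw [circleAverage_div_one_sub_sq hh hζ ht.1 (ht.2.trans_lt h1)]
  rw [hcong, intervalIntegral.integral_eq_sub_of_hasDerivAt hd hci.intervalIntegrable]
  simp

theorem ae_mem_disc : ∀ᵐ z ∂dA, z ∈ ball (0 : ℂ) 1 :=
  Measure.ae_smul_measure (ae_restrict_mem measurableSet_ball) _

theorem integrableOn_of_integrable_dA {F : ℂ → ℂ} (hF : Integrable F dA) :
    IntegrableOn F (ball (0 : ℂ) 1) := by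
  rw [dA] at hF
  exact (integrable_smul_measure (ENNReal.inv_ne_zero.2 volume_disc_ne_top)
    (ENNReal.inv_ne_top.2 volume_disc_ne_zero)).1 hF

theorem integrable_div_one_sub_sq {h : ℂ → ℂ} {ζ : ℂ} (hi : Integrable h dA) (hζ : ‖ζ‖ < 1) :
    Integrable (fun z => h z / (1 - ζ * conj z) ^ 2) dA := by
  have hm : Measurable fun z : ℂ => ((1 - ζ * conj z) ^ 2)⁻¹ := by fun_prop
  simp only [div_eq_mul_inv]
  refine hi.mul_bdd (c := ((1 - ‖ζ‖) ^ 2)⁻¹) hm.aestronglyMeasurable ?_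
  filter_upwards [ae_mem_disc] with z hz
  have hz : ‖z‖ < 1 := mem_ball_zero_iff.1 hz
  rw [norm_inv, norm_pow]
  have h1 : 0 < 1 - ‖ζ‖ := sub_pos.2 hζ
  have h2 := norm_one_sub_ge (z := conj z) (by rw [RCLike.norm_conj]; exact hz.le) le_rfl
    (norm_nonneg ζ)
  gcongr

/-- The reproducing property of the Bergman kernel. -/
theorem integral_div_one_sub_sq {h : ℂ → ℂ} {ζ : ℂ} (hi : Integrable h dA)
    (hh : DifferentiableOn ℂ h (ball (0 : ℂ) 1)) (hζ : ‖ζ‖ < 1) :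
    ∫ z, h z / (1 - ζ * conj z) ^ 2 ∂dA = h ζ := by
  have hint := integrableOn_of_integrable_dA (integrable_div_one_sub_sq hi hζ)
  -- The function `h` need not extend continuously to the boundary circle, so the formula is proved
  -- on smaller discs, with `r → 1`.
  obtain ⟨r, hr, hrm, hrt⟩ := exists_seq_strictMono_tendsto' (zero_lt_one (α := ℝ))
  have hU : ⋃ n, ball (0 : ℂ) (r n) = ball (0 : ℂ) 1 := by
    refine Subset.antisymm (iUnion_subset fun n => ball_subset_ball (hrm n).2.le) fun z hz => ?_
    obtain ⟨n, hn⟩ := (hrt.eventually (lt_mem_nhds (mem_ball_zero_iff.1 hz))).exists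
    exact mem_iUnion.2 ⟨n, mem_ball_zero_iff.2 hn⟩
  have hlim := tendsto_setIntegral_of_monotone (μ := volume)
    (f := fun z => h z / (1 - ζ * conj z) ^ 2) (fun n => measurableSet_ball (x := (0 : ℂ)) (ε := r n))
    (fun m n hmn => ball_subset_ball (hr.monotone hmn)) (by rw [hU]; exact hint)
  rw [hU] at hlim
  have hlim2 : Tendsto (fun n => ∫ z in ball (0 : ℂ) (r n), h z / (1 - ζ * conj z) ^ 2) atTop
      (𝓝 (Real.pi * ((1 : ℝ) : ℂ) ^ 2 * h (((1 : ℝ) : ℂ) ^ 2 * ζ))) := by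
    simp only [integral_ball_div_one_sub_sq hh hζ (hrm _).1 (hrm _).2]
    have hrc : Tendsto (fun n => ((r n : ℝ) : ℂ)) atTop (𝓝 ((1 : ℝ) : ℂ)) :=
      (Complex.continuous_ofReal.tendsto 1).comp hrt
    refine (tendsto_const_nhds.mul (hrc.pow 2)).mul ?_
    have hcont : ContinuousAt h (((1 : ℝ) : ℂ) ^ 2 * ζ) := by
      refine hh.continuousOn.continuousAt (isOpen_ball.mem_nhds ?_)
      simpa using hζ
    exact hcont.tendsto.comp ((hrc.pow 2).mul_const ζ)
  have heq := tendsto_nhds_unique hlim hlim2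
  rw [← volume_smul_integral_dA] at heq
  have hV : volume.real (ball (0 : ℂ) 1) = Real.pi := by
    simp [Measure.real, Complex.volume_ball]
  rw [hV, Complex.real_smul] at heq
  have hpi : (Real.pi : ℂ) ≠ 0 := Complex.ofReal_ne_zero.2 Real.pi_ne_zero
  refine mul_left_cancel₀ hpi (heq.trans ?_)
  simp

/-- The integral operator whose kernel is the Bergman kernel. -/
def bergmanInt (u : ℂ → ℂ) (z : ℂ) : ℂ := ∫ ζ, u ζ / (1 - conj ζ * z) ^ 2 ∂dA

theorem bergmanInt_congr {u v : ℂ → ℂ} (h : u =ᵐ[dA] v) (z : ℂ) :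
    bergmanInt u z = bergmanInt v z := by
  refine integral_congr_ae ?_
  filter_upwards [h] with ζ hζ
  rw [hζ]

theorem aestronglyMeasurable_dA {h : ℂ → ℂ} (hh : DifferentiableOn ℂ h (ball (0 : ℂ) 1)) :
    AEStronglyMeasurable h dA :=
  (hh.continuousOn.aestronglyMeasurable measurableSet_ball).smul_measure _

theorem memLp_of_bounded {h : ℂ → ℂ} {N : ℝ} (hm : AEStronglyMeasurable h dA)
    (hN : ∀ z ∈ ball (0 : ℂ) 1, ‖h z‖ ≤ N) : MemLp h 2 dA := by
  refine MemLp.of_bound hm N ?_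
  filter_upwards [ae_mem_disc] with z hz
  exact hN z hz

/-- The element of the Bergman space given by an analytic square integrable function. -/
def ofMemA2 (h : ℂ → ℂ) (hh : MemA2 h) : A2 := ⟨hh.2.toLp h, h, hh.1, hh.2.coeFn_toLp⟩

theorem ofMemA2_ae (h : ℂ → ℂ) (hh : MemA2 h) : (ofMemA2 h hh : Lp ℂ 2 dA) =ᵐ[dA] h :=
  hh.2.coeFn_toLp

/-- The Bergman kernel at `z`, as an analytic function. -/
def bergmanKer (z ζ : ℂ) : ℂ := 1 / (1 - conj z * ζ) ^ 2

theorem norm_bergmanKer_le {z ζ : ℂ} (hz : ‖z‖ < 1) (hζ : ‖ζ‖ < 1) :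
    ‖bergmanKer z ζ‖ ≤ 1 / (1 - ‖z‖) ^ 2 := by
  have h1 : 0 < 1 - ‖z‖ := sub_pos.2 hz
  have h2 := norm_one_sub_ge (ζ := conj z) hζ.le (RCLike.norm_conj z).le (norm_nonneg z)
  rw [bergmanKer, norm_div, norm_one, norm_pow]
  gcongr

theorem differentiableOn_bergmanKer {z : ℂ} (hz : ‖z‖ < 1) :
    DifferentiableOn ℂ (bergmanKer z) (ball (0 : ℂ) 1) := by
  refine DifferentiableOn.div (by fun_prop) (by fun_prop) fun ζ hζ => pow_ne_zero 2 ?_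
  exact one_sub_mul_ne_zero (mem_ball_zero_iff.1 hζ).le (by rwa [RCLike.norm_conj])

theorem memA2_bergmanKer {z : ℂ} (hz : ‖z‖ < 1) : MemA2 (bergmanKer z) :=
  ⟨differentiableOn_bergmanKer hz, memLp_of_bounded
    (aestronglyMeasurable_dA (differentiableOn_bergmanKer hz)) fun _ hζ =>
      norm_bergmanKer_le hz (mem_ball_zero_iff.1 hζ)⟩

theorem inner_bergmanKer {z : ℂ} (hz : ‖z‖ < 1) (u : Lp ℂ 2 dA) :
    inner ℂ (ofMemA2 _ (memA2_bergmanKer hz) : Lp ℂ 2 dA) u = bergmanInt u z := by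
  rw [L2.inner_def]
  refine integral_congr_ae ?_
  filter_upwards [ofMemA2_ae _ (memA2_bergmanKer hz)] with ζ hζ
  rw [hζ, RCLike.inner_apply, bergmanKer]
  simp only [map_div₀, map_one, map_pow, map_sub, map_mul, Complex.conj_conj]
  rw [mul_one_div, mul_comm z]

theorem bergmanInt_eq_self {h : ℂ → ℂ} (hh : MemA2 h) {z : ℂ} (hz : ‖z‖ < 1) :
    bergmanInt h z = h z := by
  rw [← integral_div_one_sub_sq (hh.2.integrable one_le_two) hh.1 hz]
  simp only [bergmanInt, mul_comm]

/-- A square integrable analytic function representing an element of the Bergman space. -/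
theorem exists_memA2 (v : A2) : ∃ h, MemA2 h ∧ (v : Lp ℂ 2 dA) =ᵐ[dA] h := by
  obtain ⟨h, hh, hv⟩ := v.2
  exact ⟨h, ⟨hh, (memLp_congr_ae hv).1 (Lp.memLp _)⟩, hv⟩

/-- The Bergman projection is given by the Bergman kernel. -/
theorem exists_memA2_bergmanProj (u : Lp ℂ 2 dA) : ∃ h, MemA2 h ∧
    (bergmanProj u : Lp ℂ 2 dA) =ᵐ[dA] h ∧ EqOn (bergmanInt u) h (ball (0 : ℂ) 1) := by
  obtain ⟨h, hh, hu⟩ := exists_memA2 (bergmanProj u)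
  refine ⟨h, hh, hu, fun z hz => ?_⟩
  have hz : ‖z‖ < 1 := mem_ball_zero_iff.1 hz
  -- With the kernel `K_z ∈ A²`: `⟨K_z, u⟩ = ⟨K_z, P_B u⟩`, and the reproducing property evaluates
  -- the right side at `z`.
  have e := Submodule.inner_orthogonalProjectionOnto_eq_of_mem_left
    (ofMemA2 _ (memA2_bergmanKer hz)) u
  rw [inner_bergmanKer hz, Submodule.coe_inner] at e
  rw [← e, ← bergmanInt_eq_self hh hz, ← bergmanInt_congr hu, ← inner_bergmanKer hz]
  rfl

theorem differentiableOn_bergmanInt (u : Lp ℂ 2 dA) :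
    DifferentiableOn ℂ (bergmanInt u) (ball (0 : ℂ) 1) := by
  obtain ⟨h, hh, -, he⟩ := exists_memA2_bergmanProj u
  exact hh.1.congr he

theorem bergmanProj_ae (u : Lp ℂ 2 dA) : (bergmanProj u : Lp ℂ 2 dA) =ᵐ[dA] bergmanInt u := by
  obtain ⟨h, -, hu, he⟩ := exists_memA2_bergmanProj u
  filter_upwards [hu, ae_mem_disc] with z h1 h2
  rw [h1, he h2]

theorem bergmanProj_of_mem (v : A2) : bergmanProj (v : Lp ℂ 2 dA) = v :=
  Submodule.orthogonalProjectionOnto_mem_subspace_eq_self v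

theorem inner_bergmanProj_left (u : Lp ℂ 2 dA) (v : A2) :
    inner ℂ (bergmanProj u) v = inner ℂ u (v : Lp ℂ 2 dA) :=
  Submodule.inner_orthogonalProjectionOnto_eq_of_mem_right v u

theorem inner_bergmanProj_right (u : Lp ℂ 2 dA) (v : A2) :
    inner ℂ v (bergmanProj u) = inner ℂ (v : Lp ℂ 2 dA) u :=
  Submodule.inner_orthogonalProjectionOnto_eq_of_mem_left v u

/-! ### Test functions and Toeplitz operators -/

/-- Bounded measurable functions with compact support in the disc. -/
structure IsDiscTest (u : ℂ → ℂ) : Prop where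
  measurable : Measurable u
  bounded : ∃ N, ∀ ζ, ‖u ζ‖ ≤ N
  support : ∃ r < 1, ∀ ζ, u ζ ≠ 0 → ‖ζ‖ ≤ r

theorem IsDiscTest.memLp {u : ℂ → ℂ} (hu : IsDiscTest u) : MemLp u 2 dA := by
  obtain ⟨N, hN⟩ := hu.bounded
  exact memLp_of_bounded hu.measurable.aestronglyMeasurable fun z _ => hN z

theorem measurable_indicator_closedBall {h : ℂ → ℂ} {r : ℝ} (hr : r < 1)
    (hh : ContinuousOn h (ball (0 : ℂ) 1)) : Measurable ((closedBall (0 : ℂ) r).indicator h) := by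
  classical
  rw [← piecewise_eq_indicator]
  exact (hh.mono (closedBall_subset_ball hr)).measurable_piecewise
    continuous_zero.continuousOn measurableSet_closedBall

theorem exists_norm_le_on_closedBall {h : ℂ → ℂ} {r : ℝ} (hr : r < 1)
    (hh : ContinuousOn h (ball (0 : ℂ) 1)) : ∃ N, 0 ≤ N ∧ ∀ z ∈ closedBall (0 : ℂ) r, ‖h z‖ ≤ N := by
  obtain ⟨N, hN⟩ := (isCompact_closedBall (0 : ℂ) r).exists_bound_of_continuousOn
    (hh.mono (closedBall_subset_ball hr))
  exact ⟨max N 0, le_max_right _ _, fun z hz => (hN z hz).trans (le_max_left _ _)⟩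

theorem isDiscTest_indicator {h : ℂ → ℂ} {r : ℝ} (hr : r < 1)
    (hh : ContinuousOn h (ball (0 : ℂ) 1)) : IsDiscTest ((closedBall (0 : ℂ) r).indicator h) := by
  obtain ⟨N, hN0, hN⟩ := exists_norm_le_on_closedBall hr hh
  refine ⟨measurable_indicator_closedBall hr hh, ⟨N, fun z => ?_⟩, r, hr, fun z hz => ?_⟩
  · by_cases hz : z ∈ closedBall (0 : ℂ) r
    · rw [indicator_of_mem hz]
      exact hN z hz
    · rw [indicator_of_notMem hz, norm_zero]
      exact hN0
  · by_contra h1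
    exact hz (indicator_of_notMem (fun h2 => h1 (mem_closedBall_zero_iff.1 h2)) _)

theorem IsDiscTest.conj_mul {g u : ℂ → ℂ} (hg : ContinuousOn g (ball (0 : ℂ) 1))
    (hu : IsDiscTest u) : IsDiscTest fun z => conj (g z) * u z := by
  obtain ⟨N, hN⟩ := hu.bounded
  obtain ⟨r, hr, hs⟩ := hu.support
  obtain ⟨K, hK0, hK⟩ := exists_norm_le_on_closedBall hr hg
  have e : (fun z => conj (g z) * u z) =
      fun z => conj ((closedBall (0 : ℂ) r).indicator g z) * u z := by
    funext z
    by_cases hz : u z = 0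
    · rw [hz, mul_zero, mul_zero]
    · rw [indicator_of_mem (mem_closedBall_zero_iff.2 (hs z hz))]
  refine ⟨?_, ⟨K * N, fun z => ?_⟩, r, hr, fun z hz => hs z (right_ne_zero_of_mul hz)⟩
  · rw [e]
    exact (Complex.continuous_conj.measurable.comp
      (measurable_indicator_closedBall hr hg)).mul hu.measurable
  · have hN0 : 0 ≤ N := (norm_nonneg _).trans (hN z)
    by_cases hz : u z = 0
    · rw [hz, mul_zero, norm_zero]
      positivity
    · rw [norm_mul, RCLike.norm_conj]
      exact mul_le_mul (hK z (mem_closedBall_zero_iff.2 (hs z hz))) (hN z) (norm_nonneg _) hK0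

/-- The Bergman kernel is bounded when one variable stays in a compact subset of the disc.
Projections of test functions are therefore bounded and lie in the domain of every `T_f` with `f ∈
A²`. -/
theorem IsDiscTest.exists_norm_bergmanInt_le {u : ℂ → ℂ} (hu : IsDiscTest u) :
    ∃ K, ∀ z ∈ ball (0 : ℂ) 1, ‖bergmanInt u z‖ ≤ K := by
  obtain ⟨N, hN⟩ := hu.bounded
  obtain ⟨r, hr, hs⟩ := hu.support
  have h1 : 0 < 1 - max r 0 := sub_pos.2 (max_lt hr one_pos)
  have hN0 : 0 ≤ N := (norm_nonneg _).trans (hN 0)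
  refine ⟨N / (1 - max r 0) ^ 2, fun z hz => ?_⟩
  have h := norm_integral_le_of_norm_le_const (μ := dA)
    (f := fun ζ => u ζ / (1 - conj ζ * z) ^ 2) (C := N / (1 - max r 0) ^ 2)
    (Eventually.of_forall fun ζ => ?_)
  · simpa [bergmanInt] using h
  · by_cases h0 : u ζ = 0
    · rw [h0, zero_div, norm_zero]
      positivity
    · have h2 := norm_one_sub_ge (ζ := conj ζ) (mem_ball_zero_iff.1 hz).le
        ((RCLike.norm_conj ζ).le.trans ((hs ζ h0).trans (le_max_left r 0))) (le_max_right r 0)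
      rw [norm_div, norm_pow]
      have := hN ζ
      gcongr

theorem IsDiscTest.differentiableOn_bergmanInt {u : ℂ → ℂ} (hu : IsDiscTest u) :
    DifferentiableOn ℂ (bergmanInt u) (ball (0 : ℂ) 1) :=
  (BergmanToeplitz.differentiableOn_bergmanInt (hu.memLp.toLp u)).congr fun z _ =>
    (bergmanInt_congr hu.memLp.coeFn_toLp z).symm

/-- The product of a square integrable function with a bounded one. -/
theorem memLp_mul_of_bounded {f h k : ℂ → ℂ} {K : ℝ} (hf : MemLp f 2 dA)
    (hm : AEStronglyMeasurable h dA) (hk : h =ᵐ[dA] k)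
    (hK : ∀ z ∈ ball (0 : ℂ) 1, ‖k z‖ ≤ K) : MemLp (fun z => f z * h z) 2 dA := by
  have hb : ∀ᵐ z ∂dA, ‖f z * h z‖ ≤ K * ‖f z‖ := by
    filter_upwards [hk, ae_mem_disc] with z h1 h2
    rw [h1, norm_mul, mul_comm]
    exact mul_le_mul_of_nonneg_right (hK z h2) (norm_nonneg _)
  exact hf.of_le_mul (hf.1.mul hm) hb

theorem bergmanProj_mem_toeplitz_domain {f u : ℂ → ℂ} (hf : MemA2 f) (hu : IsDiscTest u) :
    bergmanProj (hu.memLp.toLp u) ∈ (toeplitz f).domain := by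
  obtain ⟨K, hK⟩ := hu.exists_norm_bergmanInt_le
  refine memLp_mul_of_bounded (K := K) hf.2 (Lp.aestronglyMeasurable _) (bergmanProj_ae _)
    fun z hz => ?_
  rw [bergmanInt_congr hu.memLp.coeFn_toLp]
  exact hK z hz

/-- An element `v` of `A²` orthogonal to all projections of test functions is orthogonal to the test
functions themselves. The truncation of `v` to a smaller disc is one of them, so `v` vanishes there.
-/
theorem dense_of_bergmanProj_mem (S : Submodule ℂ A2)
    (hS : ∀ u (hu : IsDiscTest u), bergmanProj (hu.memLp.toLp u) ∈ S) : Dense (S : Set A2) := by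
  rw [Submodule.dense_iff_topologicalClosure_eq_top, Submodule.topologicalClosure_eq_top_iff,
    Submodule.eq_bot_iff]
  intro v hv
  obtain ⟨h, hh, hvh⟩ := exists_memA2 v
  have hzero : ∀ r < 1, ∀ᵐ z ∂dA, z ∈ closedBall (0 : ℂ) r → h z = 0 := by
    intro r hr
    have hu := isDiscTest_indicator hr hh.1.continuousOn
    have h1 := (Submodule.mem_orthogonal _ _).1 hv _ (hS _ hu)
    rw [inner_bergmanProj_left] at h1
    have h2 : inner ℂ (hu.memLp.toLp _) (hu.memLp.toLp _) = 0 := by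
      refine Eq.trans ?_ h1
      rw [L2.inner_def, L2.inner_def]
      refine integral_congr_ae ?_
      filter_upwards [hu.memLp.coeFn_toLp, hvh] with z hz1 hz2
      rw [hz1, hz2]
      by_cases hz : z ∈ closedBall (0 : ℂ) r
      · rw [indicator_of_mem hz]
      · rw [indicator_of_notMem hz, inner_zero_left, inner_zero_left]
    have h3 := inner_self_eq_zero.1 h2
    rw [Lp.eq_zero_iff_ae_eq_zero] at h3
    filter_upwards [h3, hu.memLp.coeFn_toLp] with z hz1 hz2 hz
    rw [hz1, indicator_of_mem hz] at hz2
    exact hz2.symm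
  obtain ⟨r, -, hr, hrt⟩ := exists_seq_strictMono_tendsto (1 : ℝ)
  have hall := ae_all_iff.2 fun n => hzero (r n) (hr n)
  rw [← Submodule.coe_eq_zero, Lp.eq_zero_iff_ae_eq_zero]
  filter_upwards [hall, hvh, ae_mem_disc] with z h1 h2 h3
  obtain ⟨n, hn⟩ := (hrt.eventually (lt_mem_nhds (mem_ball_zero_iff.1 h3))).exists
  rw [h2, h1 n (mem_closedBall_zero_iff.2 hn.le)]
  rfl

theorem dense_toeplitz_domain {f : ℂ → ℂ} (hf : MemA2 f) :
    Dense ((toeplitz f).domain : Set A2) :=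
  dense_of_bergmanProj_mem _ fun _ hu => bergmanProj_mem_toeplitz_domain hf hu

/-- Multiplication by an analytic symbol does not leave the Bergman space. -/
theorem toeplitz_apply_ae {f : ℂ → ℂ} (hf : MemA2 f) (v : (toeplitz f).domain) :
    (toeplitz f v : Lp ℂ 2 dA) =ᵐ[dA] fun z => f z * ((v : A2) : Lp ℂ 2 dA) z := by
  obtain ⟨h, hh, hv⟩ := exists_memA2 (v : A2)
  have hae := (memLp_of_toeplitzDomain v).coeFn_toLp
  have hmem : mulSymbol f v ∈ A2 := by
    refine ⟨fun z => f z * h z, hf.1.mul hh.1, ?_⟩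
    filter_upwards [hae, hv] with z h1 h2
    rw [← h2, ← h1]
    rfl
  have e : toeplitz f v = ⟨mulSymbol f v, hmem⟩ := bergmanProj_of_mem ⟨mulSymbol f v, hmem⟩
  rw [e]
  exact hae

/-- The adjoint of the Toeplitz operator on projections of test functions. -/
theorem adjoint_toeplitz_bergmanProj {g u : ℂ → ℂ} (hg : MemA2 g) (hu : IsDiscTest u) :
    ∃ h : bergmanProj (hu.memLp.toLp u) ∈ (toeplitz g)†.domain,
      (toeplitz g)† ⟨_, h⟩ =
        bergmanProj ((hu.conj_mul hg.1.continuousOn).memLp.toLp fun z => conj (g z) * u z) := by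
  -- Both sides equal `∫ ū g v`. On the right `T_g v` is simply `g v`, and the projections are
  -- removed because they are paired with elements of `A²`.
  have key : ∀ v : (toeplitz g).domain,
      inner ℂ (bergmanProj ((hu.conj_mul hg.1.continuousOn).memLp.toLp fun z => conj (g z) * u z))
        (v : A2) = inner ℂ (bergmanProj (hu.memLp.toLp u)) (toeplitz g v) := by
    intro v
    rw [inner_bergmanProj_left, inner_bergmanProj_left, L2.inner_def, L2.inner_def]
    refine integral_congr_ae ?_
    filter_upwards [hu.memLp.coeFn_toLp, (hu.conj_mul hg.1.continuousOn).memLp.coeFn_toLp,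
      toeplitz_apply_ae hg v] with z h1 h2 h3
    rw [h1, h2, h3, RCLike.inner_apply, RCLike.inner_apply, map_mul, Complex.conj_conj]
    ring
  have hmem := LinearPMap.mem_adjoint_domain_of_exists _ ⟨_, key⟩
  exact ⟨hmem, LinearPMap.adjoint_apply_eq (dense_toeplitz_domain hg) ⟨_, hmem⟩ key⟩

theorem bergmanProj_mem_toeplitzProd_domain {f g u : ℂ → ℂ} (hf : MemA2 f) (hg : MemA2 g)
    (hu : IsDiscTest u) : bergmanProj (hu.memLp.toLp u) ∈ (toeplitzProd f g).domain := by
  obtain ⟨h, e⟩ := adjoint_toeplitz_bergmanProj hg hu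
  refine mem_opProd_domain.2 ⟨h, ?_⟩
  rw [e]
  exact bergmanProj_mem_toeplitz_domain hf (hu.conj_mul hg.1.continuousOn)

theorem toeplitzProd_bergmanProj_ae {f g u : ℂ → ℂ} (hf : MemA2 f) (hg : MemA2 g)
    (hu : IsDiscTest u) :
    (toeplitzProd f g ⟨_, bergmanProj_mem_toeplitzProd_domain hf hg hu⟩ : Lp ℂ 2 dA) =ᵐ[dA]
      fun z => f z * bergmanInt (fun ζ => conj (g ζ) * u ζ) z := by
  obtain ⟨h, e⟩ := adjoint_toeplitz_bergmanProj hg hu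
  obtain ⟨h1, h2⟩ := mem_opProd_domain.1 (bergmanProj_mem_toeplitzProd_domain hf hg hu)
  rw [show toeplitzProd f g ⟨_, bergmanProj_mem_toeplitzProd_domain hf hg hu⟩ = _ from
    opProd_apply _ h1 h2]
  refine (toeplitz_apply_ae hf _).trans ?_
  have h3 := bergmanProj_ae ((hu.conj_mul hg.1.continuousOn).memLp.toLp fun z => conj (g z) * u z)
  rw [← e] at h3
  filter_upwards [h3] with z hz
  rw [hz, bergmanInt_congr (hu.conj_mul hg.1.continuousOn).memLp.coeFn_toLp]

theorem enorm_sq_eq_lintegral (u : Lp ℂ 2 dA) : ‖u‖ₑ ^ 2 = ∫⁻ z, ‖u z‖ₑ ^ 2 ∂dA := by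
  rw [Lp.enorm_def, eLpNorm_eq_lintegral_rpow_enorm_toReal two_ne_zero ENNReal.ofNat_ne_top,
    ← ENNReal.rpow_natCast, ← ENNReal.rpow_mul]
  simp

/-- The product sends `P_B u` to `f P_B(ḡ u)`, and `‖P_B u‖ ≤ ‖u‖`. -/
theorem discBound_of_isBoundedOnA2 {f g : ℂ → ℂ} (hf : MemA2 f) (hg : MemA2 g)
    (h : IsBoundedOnA2 (toeplitzProd f g)) : ∃ B : ℝ≥0∞, B ≠ ∞ ∧ DiscBound f g B := by
  obtain ⟨-, C, hC⟩ := h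
  -- The constant in the definition of boundedness is not assumed nonnegative.
  refine ⟨ENNReal.ofReal |C| ^ 2, ENNReal.pow_ne_top ENNReal.ofReal_ne_top,
    fun u h1 h2 h3 => ?_⟩
  have hu : IsDiscTest u := ⟨h1, h2, h3⟩
  have key := hC ⟨_, bergmanProj_mem_toeplitzProd_domain hf hg hu⟩
  have hP : ‖bergmanProj (hu.memLp.toLp u)‖ ≤ ‖hu.memLp.toLp u‖ :=
    Submodule.norm_orthogonalProjectionOnto_apply_le _ _
  have key2 : ‖(toeplitzProd f g ⟨_, bergmanProj_mem_toeplitzProd_domain hf hg hu⟩ : Lp ℂ 2 dA)‖ₑ ≤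
      ENNReal.ofReal |C| * ‖hu.memLp.toLp u‖ₑ := by
    rw [← ofReal_norm, ← ofReal_norm, ← ENNReal.ofReal_mul (abs_nonneg C)]
    refine ENNReal.ofReal_le_ofReal (key.trans ?_)
    exact mul_le_mul (le_abs_self C) hP (norm_nonneg _) (abs_nonneg C)
  have key3 := pow_le_pow_left₀ zero_le key2 2
  rw [mul_pow, enorm_sq_eq_lintegral, enorm_sq_eq_lintegral] at key3
  have e1 : ∫⁻ z, ‖hu.memLp.toLp u z‖ₑ ^ 2 ∂dA = ∫⁻ z, ‖u z‖ₑ ^ 2 ∂dA := by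
    refine lintegral_congr_ae ?_
    filter_upwards [hu.memLp.coeFn_toLp] with z hz
    rw [hz]
  have e2 := lintegral_congr_ae (μ := dA)
    ((toeplitzProd_bergmanProj_ae hf hg hu).fun_comp fun x => ‖x‖ₑ ^ 2)
  rw [e1] at key3
  exact e2.symm.le.trans key3

/-! ### Duality on the disc -/

/-- The adjoint of `f P conj g` is `g P conj f`. -/
theorem DiscBound.swap {f g : ℂ → ℂ} (hf : MemA2 f) (hg : MemA2 g) {B : ℝ≥0∞}
    (h : DiscBound f g B) : DiscBound g f B := by
  intro v hv1 hv2 hv3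
  have hv : IsDiscTest v := ⟨hv1, hv2, hv3⟩
  have hV := (hv.conj_mul hf.1.continuousOn)
  set F : ℂ → ℂ := fun z => g z * bergmanInt (fun ζ => conj (f ζ) * v ζ) z with hF
  have hFc : ContinuousOn F (ball (0 : ℂ) 1) :=
    (hg.1.mul hV.differentiableOn_bergmanInt).continuousOn
  obtain ⟨r, hrm, hr, hrt⟩ := exists_seq_strictMono_tendsto (1 : ℝ)
  have hbound : ∀ n, ∫⁻ z in closedBall (0 : ℂ) (r n), ‖F z‖ₑ ^ 2 ∂dA ≤
      B * ∫⁻ ζ, ‖v ζ‖ₑ ^ 2 ∂dA := by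
    intro n
    -- The output `F`, truncated to a smaller disc, is itself a test function `u`. Then `‖u‖² = ⟨ḡu,
    -- P_B(f̄v)⟩ = ⟨P_B(ḡu), f̄v⟩ ≤ ∫ |f P_B(ḡu)| |v|`, and the hypothesis leaves a finite factor
    -- `‖u‖` to cancel.
    have hu := isDiscTest_indicator (hr n) hFc
    set u := (closedBall (0 : ℂ) (r n)).indicator F with hudef
    have hU := hu.conj_mul hg.1.continuousOn
    have hb := h u hu.1 hu.2 hu.3
    have e1 : ∫⁻ z in closedBall (0 : ℂ) (r n), ‖F z‖ₑ ^ 2 ∂dA = ∫⁻ z, ‖u z‖ₑ ^ 2 ∂dA := by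
      rw [← lintegral_indicator measurableSet_closedBall]
      refine lintegral_congr fun z => ?_
      by_cases hz : z ∈ closedBall (0 : ℂ) (r n)
      · rw [indicator_of_mem hz, hudef, indicator_of_mem hz]
      · rw [indicator_of_notMem hz, hudef, indicator_of_notMem hz]
        simp
    have hfin : ∫⁻ z, ‖u z‖ₑ ^ 2 ∂dA ≠ ∞ := by
      have := (eLpNorm_lt_top_iff_lintegral_rpow_enorm_lt_top two_ne_zero
        ENNReal.ofNat_ne_top).1 hu.memLp.2
      simpa using this.ne
    -- self-adjointness of the projection
    have hsa : inner ℂ (hU.memLp.toLp _) (bergmanProj (hV.memLp.toLp _) : Lp ℂ 2 dA) =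
        inner ℂ (bergmanProj (hU.memLp.toLp _) : Lp ℂ 2 dA) (hV.memLp.toLp _) := by
      rw [← inner_bergmanProj_left, ← inner_bergmanProj_right]
    have hl : ‖inner ℂ (hU.memLp.toLp _) (bergmanProj (hV.memLp.toLp _) : Lp ℂ 2 dA)‖ₑ =
        ∫⁻ z, ‖u z‖ₑ ^ 2 ∂dA := by
      have e : inner ℂ (hU.memLp.toLp _) (bergmanProj (hV.memLp.toLp _) : Lp ℂ 2 dA) =
          inner ℂ (hu.memLp.toLp _) (hu.memLp.toLp _) := by
        rw [L2.inner_def, L2.inner_def]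
        refine integral_congr_ae ?_
        filter_upwards [hU.memLp.coeFn_toLp, bergmanProj_ae (hV.memLp.toLp _),
          hu.memLp.coeFn_toLp] with z h1 h2 h3
        rw [h1, h2, h3, bergmanInt_congr hV.memLp.coeFn_toLp, RCLike.inner_apply,
          RCLike.inner_apply, map_mul, Complex.conj_conj]
        by_cases hz : z ∈ closedBall (0 : ℂ) (r n)
        · rw [hudef, indicator_of_mem hz, hF]
          ring
        · rw [hudef, indicator_of_notMem hz, map_zero]
          ring
      rw [e, inner_self_eq_norm_sq_to_K, enorm_pow]
      have : ‖((‖hu.memLp.toLp u‖ : ℝ) : ℂ)‖ₑ = ‖hu.memLp.toLp u‖ₑ := by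
        rw [← ofReal_norm, Complex.norm_real, norm_norm, ofReal_norm]
      refine (congrArg (· ^ 2) this).trans ?_
      rw [enorm_sq_eq_lintegral]
      refine lintegral_congr_ae ?_
      filter_upwards [hu.memLp.coeFn_toLp] with z hz
      rw [hz]
    have hle : ∫⁻ z, ‖u z‖ₑ ^ 2 ∂dA ≤
        ∫⁻ z, ‖f z * bergmanInt (fun ζ => conj (g ζ) * u ζ) z‖ₑ * ‖v z‖ₑ ∂dA := by
      rw [← hl, hsa, L2.inner_def]
      refine (enorm_integral_le_lintegral_enorm _).trans (le_of_eq ?_)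
      refine lintegral_congr_ae ?_
      filter_upwards [bergmanProj_ae (hU.memLp.toLp _), hV.memLp.coeFn_toLp] with z h1 h2
      rw [h1, h2, bergmanInt_congr hU.memLp.coeFn_toLp, RCLike.inner_apply, enorm_mul, enorm_mul,
        enorm_mul, RCLike.enorm_conj, RCLike.enorm_conj]
      ring
    rw [e1]
    refine le_of_sq_le_mul hfin ?_
    have hm : AEStronglyMeasurable
        (fun z => f z * bergmanInt (fun ζ => conj (g ζ) * u ζ) z) dA :=
      aestronglyMeasurable_dA (hf.1.mul hU.differentiableOn_bergmanInt)
    calc _ ≤ _ := pow_le_pow_left₀ zero_le hle 2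
      _ ≤ _ := sq_lintegral_mul_le hm.enorm hv1.aemeasurable.enorm
      _ ≤ (B * ∫⁻ z, ‖u z‖ₑ ^ 2 ∂dA) * ∫⁻ z, ‖v z‖ₑ ^ 2 ∂dA := by
        gcongr
        exact hb
      _ = _ := mul_assoc _ _ _
  have hU : ⋃ n, closedBall (0 : ℂ) (r n) =ᵐ[dA] (univ : Set ℂ) := by
    rw [eventuallyEq_univ]
    filter_upwards [ae_mem_disc] with z hz
    obtain ⟨n, hn⟩ := (hrt.eventually (lt_mem_nhds (mem_ball_zero_iff.1 hz))).exists
    exact mem_iUnion.2 ⟨n, mem_closedBall_zero_iff.2 hn.le⟩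
  calc _ = ∫⁻ z in ⋃ n, closedBall (0 : ℂ) (r n), ‖F z‖ₑ ^ 2 ∂dA := by
        rw [setLIntegral_congr hU, setLIntegral_univ]
        rfl
    _ = ⨆ n, ∫⁻ z in closedBall (0 : ℂ) (r n), ‖F z‖ₑ ^ 2 ∂dA :=
        setLIntegral_iUnion_of_directed _ (Monotone.directed_le fun m n hmn =>
          closedBall_subset_closedBall (hrm.monotone hmn))
    _ ≤ _ := iSup_le hbound

/-! ### The two implications -/

theorem aestronglyMeasurable_Pplus {f g u : ℂ → ℂ} (hf : AEStronglyMeasurable f dA)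
    (hg : AEStronglyMeasurable g dA) (hu : AEStronglyMeasurable u dA) :
    AEStronglyMeasurable (Pplus f g u) dA := by
  have h1 : AEStronglyMeasurable (fun z => (‖f z‖ : ℂ)) dA :=
    Complex.continuous_ofReal.comp_aestronglyMeasurable hf.norm
  refine h1.mul ?_
  have e : (fun z => ∫ ζ, (‖g ζ‖ : ℂ) * u ζ / ((‖1 - conj ζ * z‖ ^ 2 : ℝ) : ℂ) ∂dA) = fun z =>
      ∫ ζ, (‖hg.mk g ζ‖ : ℂ) * hu.mk u ζ / ((‖1 - conj ζ * z‖ ^ 2 : ℝ) : ℂ) ∂dA := by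
    funext z
    refine integral_congr_ae ?_
    filter_upwards [hg.ae_eq_mk, hu.ae_eq_mk] with ζ h1 h2
    rw [h1, h2]
  rw [e]
  have hm : Measurable fun p : ℂ × ℂ => (‖hg.mk g p.2‖ : ℂ) * hu.mk u p.2 /
      ((‖1 - conj p.2 * p.1‖ ^ 2 : ℝ) : ℂ) := by
    have h2 := hg.stronglyMeasurable_mk.measurable
    have h3 := hu.stronglyMeasurable_mk.measurable
    fun_prop
  exact (hm.stronglyMeasurable.integral_prod_right' (ν := dA)).aestronglyMeasurable

theorem enorm_Pplus_le (f g u : ℂ → ℂ) (z : ℂ) : ‖Pplus f g u z‖ₑ ≤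
    ∫⁻ ζ, ‖f z‖ₑ * ENNReal.ofReal (1 / ‖1 - conj ζ * z‖ ^ 2) * ‖g ζ‖ₑ * ‖u ζ‖ₑ ∂dA := by
  have hofReal : ∀ x : ℝ, ‖(x : ℂ)‖ₑ = ENNReal.ofReal |x| := fun x => by
    rw [← ofReal_norm, Complex.norm_real, Real.norm_eq_abs]
  have e1 : ∀ x : ℂ, ‖((‖x‖ : ℝ) : ℂ)‖ₑ = ‖x‖ₑ := fun x => by
    rw [hofReal, abs_norm, ofReal_norm]
  rw [Pplus, enorm_mul, e1]
  refine (mul_le_mul_right (enorm_integral_le_lintegral_enorm _) _).trans (le_of_eq ?_)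
  rw [← lintegral_const_mul' _ _ enorm_ne_top]
  refine lintegral_congr fun ζ => ?_
  rw [div_eq_mul_one_div, ← Complex.ofReal_one, ← Complex.ofReal_div, enorm_mul, enorm_mul, e1,
    hofReal, abs_of_nonneg (by positivity)]
  ring

/-- The estimate for nonnegative densities, applied to `|u|`, also supplies the square integrability
of `Pplus f g u`. -/
theorem pplusBounded_of_isBoundedOnA2 {f g : ℂ → ℂ} (hf : MemA2 f) (hg : MemA2 g)
    (h : IsBoundedOnA2 (toeplitzProd f g)) : PplusBounded f g := by
  obtain ⟨B, hB, hfg⟩ := discBound_of_isBoundedOnA2 hf hg h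
  obtain ⟨M, hM, key⟩ := exists_bound_disc hB hf hg hfg (hfg.swap hf hg)
  refine ⟨√M.toReal, fun u => ?_⟩
  have key := key (fun ζ => ‖u ζ‖ₑ) (Lp.stronglyMeasurable u).measurable.enorm
  have hle : ∫⁻ z, ‖Pplus f g u z‖ₑ ^ 2 ∂dA ≤ M * ‖u‖ₑ ^ 2 := by
    rw [enorm_sq_eq_lintegral]
    refine le_trans (lintegral_mono fun z => ?_) key
    exact pow_le_pow_left₀ zero_le (enorm_Pplus_le f g u z) 2
  have hfin : M * ‖u‖ₑ ^ 2 ≠ ∞ := ENNReal.mul_ne_top hM (ENNReal.pow_ne_top enorm_ne_top)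
  have hmem : MemLp (Pplus f g u) 2 dA := by
    refine ⟨aestronglyMeasurable_Pplus hf.2.1 hg.2.1 (Lp.aestronglyMeasurable u), ?_⟩
    rw [eLpNorm_lt_top_iff_lintegral_rpow_enorm_lt_top two_ne_zero ENNReal.ofNat_ne_top]
    simpa using hle.trans_lt hfin.lt_top
  refine ⟨hmem.toLp _, hmem.coeFn_toLp.symm, ?_⟩
  have h1 : ‖hmem.toLp (Pplus f g u)‖ₑ ^ 2 ≤ M * ‖u‖ₑ ^ 2 := by
    rw [enorm_sq_eq_lintegral]
    refine le_trans (le_of_eq (lintegral_congr_ae ?_)) hle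
    exact hmem.coeFn_toLp.fun_comp fun x => ‖x‖ₑ ^ 2
  have h2 := ENNReal.toReal_mono hfin h1
  rw [ENNReal.toReal_mul, ENNReal.toReal_pow, ENNReal.toReal_pow, toReal_enorm, toReal_enorm] at h2
  refine le_of_sq_le_sq ?_ (by positivity)
  rwa [mul_pow, Real.sq_sqrt ENNReal.toReal_nonneg]

theorem bergmanKer_mem_toeplitz_domain {g : ℂ → ℂ} (hg : MemA2 g) {z : ℂ} (hz : ‖z‖ < 1) :
    ofMemA2 _ (memA2_bergmanKer hz) ∈ (toeplitz g).domain :=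
  memLp_mul_of_bounded hg.2 (Lp.aestronglyMeasurable _) (ofMemA2_ae _ _) fun _ hζ =>
    norm_bergmanKer_le hz (mem_ball_zero_iff.1 hζ)

/-- The adjoint of a Toeplitz operator is an integral operator. -/
theorem adjoint_toeplitz_ae {g : ℂ → ℂ} (hg : MemA2 g) (v : (toeplitz g)†.domain) :
    ((toeplitz g)† v : Lp ℂ 2 dA) =ᵐ[dA]
      bergmanInt fun ζ => conj (g ζ) * ((v : A2) : Lp ℂ 2 dA) ζ := by
  have h1 := bergmanProj_ae ((toeplitz g)† v : Lp ℂ 2 dA)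
  rw [bergmanProj_of_mem] at h1
  filter_upwards [h1, ae_mem_disc] with z h2 h3
  have hz : ‖z‖ < 1 := mem_ball_zero_iff.1 h3
  rw [h2, ← inner_bergmanKer hz]
  -- The adjoint relation is tested on the Bergman kernel at `z`, which is bounded and hence in the
  -- domain of `T_g`. This evaluates `T_g^* v` at `z`.
  have h4 := LinearPMap.adjoint_isFormalAdjoint (dense_toeplitz_domain hg) v
    ⟨_, bergmanKer_mem_toeplitz_domain hg hz⟩
  have h5 := congrArg conj h4
  rw [inner_conj_symm, inner_conj_symm] at h5
  refine (h5 : _).trans ?_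
  rw [Submodule.coe_inner, L2.inner_def]
  refine integral_congr_ae ?_
  filter_upwards [toeplitz_apply_ae hg ⟨_, bergmanKer_mem_toeplitz_domain hg hz⟩,
    ofMemA2_ae _ (memA2_bergmanKer hz)] with ζ h6 h7
  rw [h6, h7, RCLike.inner_apply, bergmanKer]
  simp only [map_div₀, map_one, map_pow, map_sub, map_mul, Complex.conj_conj]
  rw [mul_comm z]
  ring

theorem norm_mul_bergmanInt_le (f g v : ℂ → ℂ) (z : ℂ) :
    ‖f z * bergmanInt (fun ζ => conj (g ζ) * v ζ) z‖ ≤ ‖Pplus f g (fun ζ => (‖v ζ‖ : ℂ)) z‖ := by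
  have e : ∫ ζ, (‖g ζ‖ : ℂ) * (‖v ζ‖ : ℂ) / ((‖1 - conj ζ * z‖ ^ 2 : ℝ) : ℂ) ∂dA =
      ((∫ ζ, ‖conj (g ζ) * v ζ / (1 - conj ζ * z) ^ 2‖ ∂dA : ℝ) : ℂ) := by
    rw [← integral_complex_ofReal]
    refine integral_congr_ae (Eventually.of_forall fun ζ => ?_)
    simp only [norm_div, norm_mul, norm_pow, RCLike.norm_conj, Complex.ofReal_div,
      Complex.ofReal_mul]
  rw [Pplus, e, norm_mul, norm_mul, Complex.norm_real, norm_norm, Complex.norm_real,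
    Real.norm_of_nonneg (integral_nonneg fun _ => norm_nonneg _)]
  gcongr
  exact norm_integral_le_integral_norm _

/-- Almost everywhere `|T_f T_g^* v| = |f P_B(ḡ v)|` is at most `P^+_{f,g}` applied to `|v|`, and
`|v|` has the same norm as `v`. -/
theorem isBoundedOnA2_of_pplusBounded {f g : ℂ → ℂ} (hf : MemA2 f) (hg : MemA2 g)
    (h : PplusBounded f g) : IsBoundedOnA2 (toeplitzProd f g) := by
  obtain ⟨C, hC⟩ := h
  refine ⟨dense_of_bergmanProj_mem _ fun u hu => bergmanProj_mem_toeplitzProd_domain hf hg hu, C,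
    fun v => ?_⟩
  obtain ⟨h1, h2⟩ := mem_opProd_domain.1 v.2
  have hv : MemLp (fun z => (‖((v : A2) : Lp ℂ 2 dA) z‖ : ℂ)) 2 dA :=
    (Lp.memLp ((v : A2) : Lp ℂ 2 dA)).norm.ofReal (K := ℂ)
  obtain ⟨w, hw, hwle⟩ := hC (hv.toLp _)
  have hnorm : ‖hv.toLp _‖ = ‖v‖ := by
    have : ‖v‖ = ‖((v : A2) : Lp ℂ 2 dA)‖ := rfl
    rw [this, Lp.norm_toLp, Lp.norm_def]
    congr 1
    exact eLpNorm_congr_norm_ae (Eventually.of_forall fun z => by simp)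
  rw [hnorm] at hwle
  refine le_trans ?_ hwle
  rw [show toeplitzProd f g v = _ from opProd_apply _ h1 h2, Submodule.coe_norm]
  refine Lp.norm_le_norm_of_ae_le ?_
  filter_upwards [toeplitz_apply_ae hf ⟨_, h2⟩, adjoint_toeplitz_ae hg ⟨_, h1⟩, hw] with z h3 h4 h5
  rw [h3, h4, ← h5]
  refine (norm_mul_bergmanInt_le f g _ z).trans (le_of_eq ?_)
  congr 1
  rw [Pplus, Pplus]
  congr 1
  refine integral_congr_ae ?_
  filter_upwards [hv.coeFn_toLp] with ζ hζ
  rw [hζ]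

end BergmanToeplitz

end

theorem theorem4p1 (f g : ℂ → ℂ) (hf : BergmanToeplitz.MemA2 f) (hg : BergmanToeplitz.MemA2 g) :
    BergmanToeplitz.IsBoundedOnA2 (BergmanToeplitz.toeplitzProd f g) ↔
      BergmanToeplitz.PplusBounded f g :=
  ⟨BergmanToeplitz.pplusBounded_of_isBoundedOnA2 hf hg,
    BergmanToeplitz.isBoundedOnA2_of_pplusBounded hf hg⟩
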